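/- All graphs are finite and simple. For a graph $G$ let $C(G)$ be the set of induced cycles of $G$ (induced subgraphs that are cycles, of length at least $3$). A \emph{solid graph} is a graph of one of the following four types. (1) A \emph{pyramid}: a cycle together with one further vertex that is joined to at least three vertices of the cycle. (2) A \emph{trihedron}: the union of three paths of length at least $2$ with the same two distinct ends, such that no interior vertex of one of the paths lies on another one. (3) A \emph{stamp}: the union of a triangle and three paths of length at least $1$ that start at the three different vertices of the triangle, end at the same vertex $x$, and are pairwise disjoint apart from $x$. (4) A \emph{prism}: the union of two vertex-disjoint triangles with vertices $x_1,x_2,x_3$ and $y_1,y_2,y_3$, and of three pairwise vertex-disjoint paths, the $i$-th one from $x_i$ to $y_i$. Let $S(G)$ be the set of solids in $G$, that is, of induced subgraphs of $G$ that are isomorphic to a solid graph. Let $G$ be a connected graph drawn in the plane (vertices are distinct points, edges are simple arcs that meet each other and the vertices only at common end vertices). Then the number $F$ of regions, i.e. of connected components of the complement of the drawing in the plane (the unbounded one included), is finite, and $$|S(G)|-|C(G)|+F\ \ge\ 1 .$$ Moreover, if $|S(G)|-|C(G)|+F=1$, then $\chi(G)\le 4$. -/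

import Mathlib

namespace GraphSolids

/-- `H` is (isomorphic to) a cycle, of some length at least three. -/
def IsCycleGraph {W : Type*} (H : SimpleGraph W) : Prop :=
  ∃ n : ℕ, 3 ≤ n ∧ Nonempty (H ≃g SimpleGraph.cycleGraph n)

/-- A pyramid: a cycle together with one further vertex `w` (the apex) that is joined to at least
three vertices of the cycle. -/
def IsPyramid {W : Type*} (H : SimpleGraph W) : Prop :=
  ∃ w : W, IsCycleGraph (H.induce {w}ᶜ) ∧ 3 ≤ (H.neighborSet w).encard

/-- A trihedron: the union of three paths with the same two distinct ends `a` and `b`, each with at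
least one interior vertex, such that no interior vertex of a path lies on another of the paths. -/
def IsTrihedron {W : Type*} (H : SimpleGraph W) : Prop :=
  ∃ (a b : W) (P : Fin 3 → H.Walk a b),
    a ≠ b ∧
    (∀ i, (P i).IsPath ∧ 2 ≤ (P i).length) ∧
    (∀ i j, i ≠ j → ∀ v, v ∈ (P i).support → v ∈ (P j).support → v = a ∨ v = b) ∧
    ⨆ i, (P i).toSubgraph = ⊤

/-- The subgraph of `H` with vertices `x 0`, `x 1`, `x 2` and all edges of `H` between them; a
triangle as soon as these vertices are pairwise adjacent. -/
def triangle {W : Type*} (H : SimpleGraph W) (x : Fin 3 → W) : H.Subgraph :=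
  (⊤ : H.Subgraph).induce (Set.range x)

/-- A stamp: the union of a triangle and three paths of length at least one, which start at the
three different vertices of the triangle, end at the same vertex `y`, and are disjoint apart from
`y`. -/
def IsStamp {W : Type*} (H : SimpleGraph W) : Prop :=
  ∃ (x : Fin 3 → W) (y : W) (P : ∀ i, H.Walk (x i) y),
    (∀ i j, i ≠ j → H.Adj (x i) (x j)) ∧
    (∀ i, (P i).IsPath ∧ 1 ≤ (P i).length) ∧
    (∀ i j, i ≠ j → ∀ v, v ∈ (P i).support → v ∈ (P j).support → v = y) ∧
    triangle H x ⊔ ⨆ i, (P i).toSubgraph = ⊤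

/-- A prism: the union of two vertex-disjoint triangles `x` and `y` and three vertex-disjoint paths,
the `i`-th one from `x i` to `y i`. -/
def IsPrism {W : Type*} (H : SimpleGraph W) : Prop :=
  ∃ (x y : Fin 3 → W) (P : ∀ i, H.Walk (x i) (y i)),
    (∀ i j, i ≠ j → H.Adj (x i) (x j)) ∧
    (∀ i j, i ≠ j → H.Adj (y i) (y j)) ∧
    (∀ i j, x i ≠ y j) ∧
    (∀ i, (P i).IsPath) ∧
    (∀ i j, i ≠ j → ∀ v, v ∈ (P i).support → v ∉ (P j).support) ∧
    triangle H x ⊔ triangle H y ⊔ ⨆ i, (P i).toSubgraph = ⊤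

/-- The solid graphs. -/
def IsSolidGraph {W : Type*} (H : SimpleGraph W) : Prop :=
  IsPyramid H ∨ IsTrihedron H ∨ IsStamp H ∨ IsPrism H

/-- `C(G)`: the set of all induced cycles in `G`. -/
def inducedCycles {V : Type*} (G : SimpleGraph V) : Set G.Subgraph :=
  {H | H.IsInduced ∧ IsCycleGraph H.coe}

/-- `S(G)`: the set of all solids in `G`, the induced subgraphs that are solid graphs. -/
def solids {V : Type*} (G : SimpleGraph V) : Set G.Subgraph :=
  {H | H.IsInduced ∧ IsSolidGraph H.coe}

/-- A drawing of `G` in the plane (the plane being `ℂ` with its usual topology): distinct vertices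
are distinct points, the edge `uv` is a simple arc between the points `u` and `v` that contains no
other vertex, and two different edges have no point in common except for vertices. -/
structure PlaneDrawing {V : Type*} (G : SimpleGraph V) where
  /-- The point that represents a vertex. -/
  point : V → ℂ
  /-- The set of points of an edge, its ends included. -/
  arc : G.edgeSet → Set ℂ
  point_injective : Function.Injective point
  arc_isArc : ∀ (u v : V) (h : G.Adj u v), ∃ γ : Path (point u) (point v),
    Function.Injective γ ∧ Set.range γ = arc ⟨s(u, v), h⟩
  mem_of_point_mem_arc : ∀ (e : G.edgeSet) (w : V), point w ∈ arc e → w ∈ (e : Sym2 V)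
  arc_inter_arc : ∀ e f : G.edgeSet, e ≠ f → arc e ∩ arc f ⊆ Set.range point

/-- The set of all points of the drawing. -/
def PlaneDrawing.carrier {V : Type*} {G : SimpleGraph V} (D : PlaneDrawing G) : Set ℂ :=
  Set.range D.point ∪ ⋃ e, D.arc e

/-- The regions of the drawing: the connected components of the complement of the drawing in the
plane, the unbounded one included. -/
def PlaneDrawing.regions {V : Type*} {G : SimpleGraph V} (D : PlaneDrawing G) : Set (Set ℂ) :=
  (fun z => connectedComponentIn D.carrierᶜ z) '' D.carrierᶜ

end GraphSolids

/-! For a set `U` of vertices let `H` be the graph induced on `U` and let `excess U` be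
`|S(H)| - |C(H)| + |E(H)| - |V(H)| + c(H)`, where `c` counts components. Taking away adjacent
vertices `v` and `x` separately and together gives a second difference in which an induced cycle
through `v` and `x` is a connector, that is, a minimal connected set `Q` off `v` and `x` with
neighbours of both, and a component with neighbours of both `v` and `x` counts `1`. Call two
connectors linked if a chain of connectors joins them in which consecutive ones lie in a common
connected proper subset of `D`. If two connectors in a connected set `D` are not linked, then
`D ∪ {v, x}` is a solid; and among any three connectors in `D` two are linked. So the connectors in
a component are classified by at most one equation per solid, which makes the second difference
nonnegative. Consequently `excess` is monotone and nonnegative.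

Winding numbers show that a plane drawing has at least `E - V + c + 1` regions. An edge `pq`
outside a spanning forest closes a cycle. Off an arc from `p` to `q` the function
`(z - p) / (z - q)` has a logarithm, and the difference of these logarithms for the two arcs of the
cycle is a winding number (times `2πi`); it is constant on regions and jumps across the edge but
across no other edge outside the forest. Hence these functions and the constant `1` are linearly
independent functions on the set of regions. This set is finite: for more points `a` in bounded
regions than there are edges, some nontrivial product of powers of the `z - a` has a logarithm on
the drawing, so two of these points lie in the same region. Together with `excess univ ≥ 0` this is
the inequality.

In the case of equality `excess univ = 0`, so `excess` vanishes identically, and so do all its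
iterated differences. Suppose that `v` has four neighbours, any two of which are adjacent or both
attached to a connected set `C` without neighbours of `v`. The difference of `excess` with respect
to these five vertices involves no cycles, edges or vertices, and the number of components
contributes `1`, a contradiction. So every induced subgraph has a vertex of degree at most three,
and the graph can be coloured greedily with four colours. -/

namespace GraphSolids

open Set

/-! ### Regions of a plane drawing -/

section Drawings

open Complex Topology Metric
open scoped unitInterval

section Logarithms

variable {X : Type*} [TopologicalSpace X]

theorem exists_exp_eq_of_homotopy (H : C(I × X, ℂ)) (hne : ∀ p, H p ≠ 0)
    (h0 : ∀ x, H (0, x) = 1) : ∃ l : C(X, ℂ), ∀ x, exp (l x) = H (1, x) := by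
  let H' : C(I × X, {z : ℂ // z ≠ 0}) := ⟨fun p => ⟨H p, hne p⟩, by fun_prop⟩
  have hstart : ∀ x, H' (0, x) = ⟨exp (ContinuousMap.const X 0 x), exp_ne_zero _⟩ :=
    fun x => Subtype.ext (by simp [H', h0])
  let L := isCoveringMap_exp.liftHomotopy H' (ContinuousMap.const X 0) hstart
  refine ⟨⟨fun x => L (1, x), by fun_prop⟩, fun x => ?_⟩
  exact congrArg Subtype.val (congrFun (isCoveringMap_exp.liftHomotopy_lifts H' _ hstart) (1, x))

theorem exists_exp_eq [ContractibleSpace X] (f : C(X, ℂ)) (hf : ∀ x, f x ≠ 0) :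
    ∃ l : C(X, ℂ), ∀ x, exp (l x) = f x := by
  obtain ⟨x₀, ⟨F⟩⟩ := id_nullhomotopic X
  let H : C(I × X, ℂ) := ⟨fun p => f (F.symm p) / f x₀, by fun_prop⟩
  obtain ⟨l, hl⟩ := exists_exp_eq_of_homotopy H (fun p => div_ne_zero (hf _) (hf _))
    (fun x => by simp [H, hf])
  refine ⟨⟨fun x => l x + log (f x₀), by fun_prop⟩, fun x => ?_⟩
  simp [H, exp_add, hl, exp_log (hf x₀), hf]

theorem eq_of_exp_eq_one {S : Set X} (hS : IsPreconnected S) {f : X → ℂ} (hf : ContinuousOn f S)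
    (h1 : ∀ z ∈ S, exp (f z) = 1) {x y : X} (hx : x ∈ S) (hy : y ∈ S) : f x = f y :=
  isCoveringMap_exp.constOn_of_comp hS hf
    (fun a ha b hb => Subtype.ext ((h1 a ha).trans (h1 b hb).symm)) hx hy

theorem exists_exp_eq_div_of_joinedIn {A : Set ℂ} {p q : ℂ} (h : JoinedIn A p q) :
    ∃ l : ℂ → ℂ, ContinuousOn l Aᶜ ∧ ∀ z ∉ A, exp (l z) = (z - p) / (z - q) := by
  classical
  obtain ⟨α, hα⟩ := h
  have hne : ∀ (z : (Aᶜ : Set ℂ)) (t : I), (z : ℂ) - α t ≠ 0 := fun z t h0 =>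
    z.2 (sub_eq_zero.1 h0 ▸ hα t)
  let H : C(I × (Aᶜ : Set ℂ), ℂ) :=
    ⟨fun z => ((z.2 : ℂ) - α (unitInterval.symm z.1)) / ((z.2 : ℂ) - α 1),
      Continuous.div (by fun_prop) (by fun_prop) fun z => hne _ _⟩
  obtain ⟨l, hl⟩ := exists_exp_eq_of_homotopy H (fun z => div_ne_zero (hne _ _) (hne _ _))
    (fun z => by simpa [H] using div_self (hne z 1))
  refine ⟨fun z => if h : z ∈ Aᶜ then l ⟨z, h⟩ else 0, ?_, fun z h => ?_⟩
  · rw [continuousOn_iff_continuous_domRestrict]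
    refine l.continuous.congr fun z => ?_
    simp only [domRestrict_apply, z.2, dif_pos]
  · simp only [dif_pos (show z ∈ Aᶜ from h), hl]
    simp [H]

theorem eq_zero_of_exp_eq_zpow_on_sphere {p : ℂ} {ρ : ℝ} (hρ : 0 < ρ) {n : ℤ} {L : ℂ → ℂ}
    (hL : ContinuousOn L (sphere p ρ)) (h : ∀ z ∈ sphere p ρ, exp (L z) = (z - p) ^ n) :
    n = 0 := by
  have hmem : ∀ θ : ℝ, circleMap p ρ θ ∈ sphere p ρ := circleMap_mem_sphere p hρ.le
  have hρ' : (ρ : ℂ) ≠ 0 := ofReal_ne_zero.2 hρ.ne'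
  have hcont : ContinuousOn
      (fun θ : ℝ => L (circleMap p ρ θ) - n * (Real.log ρ + θ * Complex.I)) univ :=
    (hL.comp (continuous_circleMap p ρ).continuousOn fun θ _ => hmem θ).sub (by fun_prop)
  have hconst := eq_of_exp_eq_one (x := 0) (y := 2 * Real.pi) isPreconnected_univ hcont
    (fun θ _ => by
      rw [exp_sub, h _ (hmem θ), exp_int_mul, exp_add, ← ofReal_exp, Real.exp_log hρ]
      simp only [circleMap, add_sub_cancel_left]
      exact div_self (zpow_ne_zero _ (mul_ne_zero hρ' (exp_ne_zero _)))) (mem_univ _) (mem_univ _)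
  have hclosed : circleMap p ρ (2 * Real.pi) = circleMap p ρ 0 := by
    simpa using periodic_circleMap p ρ 0
  simp only [hclosed, ofReal_zero, ofReal_mul, ofReal_ofNat] at hconst
  have hturn : (n : ℂ) * (2 * Real.pi * Complex.I) = 0 := by linear_combination hconst
  simpa [two_pi_I_ne_zero] using hturn

theorem not_exp_eq_div_on_sphere {p q : ℂ} {ρ : ℝ} (hρ : 0 < ρ) (hρq : ρ < dist p q) {L : ℂ → ℂ}
    (hL : ContinuousOn L (sphere p ρ)) :
    ¬ ∀ z ∈ sphere p ρ, exp (L z) = (z - p) / (z - q) := by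
  intro h
  have hpq : p - q ≠ 0 := sub_ne_zero.2 (dist_pos.1 (hρ.trans hρq))
  have hslit : ∀ z ∈ sphere p ρ, 1 + (z - p) / (p - q) ∈ slitPlane := fun z hz => by
    apply mem_slitPlane_of_norm_lt_one
    rwa [norm_div, ← dist_eq_norm, ← dist_eq_norm, mem_sphere.1 hz, div_lt_one (hρ.trans hρq)]
  refine one_ne_zero (eq_zero_of_exp_eq_zpow_on_sphere (p := p) (n := 1) hρ
    (L := fun z => L z + (log (p - q) + log (1 + (z - p) / (p - q))))
    (hL.add (continuousOn_const.add (ContinuousOn.clog (by fun_prop) hslit))) fun z hz => ?_)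
  have hzq : z - q ≠ 0 := sub_ne_zero.2 fun hzq => by
    rw [← hzq, dist_comm, mem_sphere.1 hz] at hρq
    exact hρq.false
  rw [exp_add, h z hz, exp_add, exp_log hpq, exp_log (slitPlane_ne_zero (hslit z hz)), zpow_one]
  field_simp
  ring

theorem exists_exp_eq_path_sub {x y a : ℂ} (γ : Path x y) (ha : ∀ t, γ t ≠ a) :
    ∃ (w : C(I, ℂ)) (d : ℤ), (∀ t, exp (w t) = γ t - a) ∧ w 0 = log (x - a) ∧
      w 1 = log (y - a) + d * (2 * Real.pi * Complex.I) := by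
  have hne : ∀ t, γ t - a ≠ 0 := fun t => sub_ne_zero.2 (ha t)
  have : ContractibleSpace I := (convex_Icc (0 : ℝ) 1).contractibleSpace ⟨0, by simp⟩
  obtain ⟨l, hl⟩ := exists_exp_eq (X := I) ⟨fun t => γ t - a, by fun_prop⟩ hne
  let w : C(I, ℂ) := ⟨fun t => l t - l 0 + log (x - a), by fun_prop⟩
  have hw : ∀ t, exp (w t) = γ t - a := fun t => by
    have hx : x - a ≠ 0 := by simpa using hne 0
    simp [w, exp_add, exp_sub, hl, exp_log hx, hx]
  have hw1 : exp (w 1) = exp (log (y - a)) := by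
    rw [hw, exp_log (by simpa using hne 1), γ.target]
  obtain ⟨d, hd⟩ := exp_eq_exp_iff_exists_int.1 hw1
  exact ⟨w, d, hw, by simp [w], hd⟩

end Logarithms

section Winding

theorem exists_continuousOn_union {U₁ U₂ : Set ℂ} (h₁ : IsOpen U₁) (h₂ : IsOpen U₂)
    {l₁ l₂ : ℂ → ℂ} (c₁ : ContinuousOn l₁ U₁) (c₂ : ContinuousOn l₂ U₂)
    (h : EqOn l₁ l₂ (U₁ ∩ U₂)) :
    ∃ L : ℂ → ℂ, ContinuousOn L (U₁ ∪ U₂) ∧ EqOn L l₁ U₁ ∧ EqOn L l₂ U₂ := by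
  classical
  have e₁ : EqOn (U₁.piecewise l₁ l₂) l₁ U₁ := piecewise_eqOn _ _ _
  have e₂ : EqOn (U₁.piecewise l₁ l₂) l₂ U₂ := fun z hz => by
    by_cases hz1 : z ∈ U₁
    · rw [e₁ hz1, h ⟨hz1, hz⟩]
    · exact piecewise_eq_of_notMem _ _ _ hz1
  exact ⟨_, (c₁.congr e₁).union_of_isOpen (c₂.congr e₂) h₁ h₂, e₁, e₂⟩

theorem exists_sub_ne_of_exp_eq_div {B A₁ A₂ : Set ℂ} {p q : ℂ} (hB : IsOpen B) (hp : p ∈ B)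
    (hpq : p ≠ q) (h₁ : IsClosed A₁) (h₂ : IsClosed A₂) (hA : B ∩ A₁ ∩ A₂ ⊆ {p, q})
    {l₁ l₂ : ℂ → ℂ}
    (c₁ : ContinuousOn l₁ A₁ᶜ) (e₁ : ∀ z ∉ A₁, exp (l₁ z) = (z - p) / (z - q))
    (c₂ : ContinuousOn l₂ A₂ᶜ) (e₂ : ∀ z ∉ A₂, exp (l₂ z) = (z - p) / (z - q)) {k : ℂ}
    (hk : exp k = 1) : ∃ z ∈ B \ (A₁ ∪ A₂), l₁ z - l₂ z ≠ k := by
  by_contra! hcon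
  have c₂' : ContinuousOn (fun z => l₂ z + k) (B ∩ A₂ᶜ) :=
    (c₂.mono inter_subset_right).add continuousOn_const
  obtain ⟨L, hL, hL₁, hL₂⟩ := exists_continuousOn_union
    (hB.inter h₁.isOpen_compl) (hB.inter h₂.isOpen_compl) (c₁.mono inter_subset_right) c₂'
    fun z hz => by linear_combination hcon z ⟨hz.1.1, fun h => h.elim hz.1.2 hz.2.2⟩
  obtain ⟨ε, hε, hεB⟩ := isOpen_iff.1 hB p hp
  obtain ⟨ρ, hρ, hρm⟩ := exists_between (lt_min hε (dist_pos.2 hpq))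
  obtain ⟨hρε, hρq⟩ := lt_min_iff.1 hρm
  have hsphere : sphere p ρ ⊆ B ∩ A₁ᶜ ∪ B ∩ A₂ᶜ := fun z hz => by
    have hzB : z ∈ B := hεB (by rwa [mem_ball, mem_sphere.1 hz])
    by_contra hcov
    have hzA : z ∈ B ∩ A₁ ∩ A₂ := by
      simpa [hzB, or_iff_not_imp_left] using hcov
    rcases hA hzA with rfl | rfl
    · exact hρ.ne (by rw [← mem_sphere.1 hz, dist_self])
    · exact hρq.ne (by rw [← mem_sphere.1 hz, dist_comm])
  refine not_exp_eq_div_on_sphere hρ hρq (hL.mono hsphere) fun z hz => ?_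
  rcases hsphere hz with hz₁ | hz₂
  · rw [hL₁ hz₁, e₁ z hz₁.2]
  · rw [hL₂ hz₂, exp_add, hk, mul_one, e₂ z hz₂.2]

/-- `n` is `2πi` times a winding number around a closed curve contained in `A`: it has integral
values (expressed by `exp (n z) = 1`) and is continuous off `A`. -/
structure IsWinding (n : ℂ → ℂ) (A : Set ℂ) : Prop where
  continuousOn : ContinuousOn n Aᶜ
  exp_eq_one : ∀ z ∉ A, exp (n z) = 1

theorem IsWinding.eq_of_isPreconnected {n : ℂ → ℂ} {A S : Set ℂ} (h : IsWinding n A)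
    (hS : IsPreconnected S) (hSA : Disjoint S A) {x y : ℂ} (hx : x ∈ S) (hy : y ∈ S) :
    n x = n y :=
  have hsub : S ⊆ Aᶜ := subset_compl_iff_disjoint_right.2 hSA
  eq_of_exp_eq_one hS (h.continuousOn.mono hsub) (fun z hz => h.exp_eq_one z (hsub hz)) hx hy

theorem exists_isWinding {B A₁ A₂ : Set ℂ} {p q : ℂ} (hB : IsOpen B) (hp : p ∈ B) (hpq : p ≠ q)
    (h₁ : IsClosed A₁) (h₂ : IsClosed A₂) (hA : B ∩ A₁ ∩ A₂ ⊆ {p, q})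
    (hj₁ : JoinedIn A₁ p q) (hj₂ : JoinedIn A₂ p q) :
    ∃ n, IsWinding n (A₁ ∪ A₂) ∧ ∃ z ∈ B \ (A₁ ∪ A₂), ∃ w ∈ B \ (A₁ ∪ A₂), n z ≠ n w := by
  obtain ⟨l₁, c₁, e₁⟩ := exists_exp_eq_div_of_joinedIn hj₁
  obtain ⟨l₂, c₂, e₂⟩ := exists_exp_eq_div_of_joinedIn hj₂
  have hn : IsWinding (fun z => l₁ z - l₂ z) (A₁ ∪ A₂) := by
    refine ⟨(c₁.mono ?_).sub (c₂.mono ?_), fun z hz => ?_⟩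
    · exact compl_subset_compl.2 subset_union_left
    · exact compl_subset_compl.2 subset_union_right
    · have hz₁ : z ∉ A₁ := fun h => hz (Or.inl h)
      rw [exp_sub, e₁ z hz₁, e₂ z fun h => hz (Or.inr h)]
      refine div_self (div_ne_zero ?_ ?_) <;> rw [sub_ne_zero] <;> rintro rfl
      exacts [hz₁ hj₁.source_mem, hz₁ hj₁.target_mem]
  obtain ⟨w, hw, -⟩ := exists_sub_ne_of_exp_eq_div hB hp hpq h₁ h₂ hA c₁ e₁ c₂ e₂ exp_zero
  obtain ⟨z, hz, hzw⟩ := exists_sub_ne_of_exp_eq_div hB hp hpq h₁ h₂ hA c₁ e₁ c₂ e₂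
    (hn.exp_eq_one w hw.2)
  exact ⟨_, hn, z, hz, w, hw, hzw⟩

theorem joinedIn_image_uIcc {X : Type*} [TopologicalSpace X] {x y : X} (γ : Path x y) (s t : I) :
    JoinedIn (γ '' uIcc s t) (γ s) (γ t) :=
  ⟨γ.subpath s t, fun r => γ.range_subpath s t ▸ mem_range_self r⟩

theorem exists_isWinding_range_union {x y : ℂ} {γ : Path x y} (hγ : Function.Injective γ)
    {S : Set ℂ} (hS : IsClosed S) (hj : JoinedIn S x y) {B : Set ℂ} (hB : IsOpen B) {t : I}
    (ht : γ t ∈ B) (ht1 : t ≠ 1) (hBS : Disjoint B S) :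
    ∃ n, IsWinding n (range γ ∪ S) ∧
      ∃ z ∈ B \ (range γ ∪ S), ∃ w ∈ B \ (range γ ∪ S), n z ≠ n w := by
  let A₁ : Set ℂ := γ '' uIcc t 1
  let A₂ : Set ℂ := γ '' uIcc t 0 ∪ S
  have hA : A₁ ∪ A₂ = range γ ∪ S := by
    have hcover : uIcc t 1 ∪ uIcc t 0 = univ := by
      rw [uIcc_of_le unitInterval.le_one', uIcc_of_ge unitInterval.nonneg']
      exact eq_univ_of_forall fun s => (le_total t s).imp (⟨·, s.2.2⟩) (⟨s.2.1, ·⟩)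
    rw [← image_univ, ← hcover, image_union, union_assoc]
  have hinter : B ∩ A₁ ∩ A₂ ⊆ {γ t, y} := by
    rintro _ ⟨⟨hz, s, hs, rfl⟩, ⟨r, hr, hrs⟩ | hzS⟩
    · rw [uIcc_of_le unitInterval.le_one'] at hs
      rw [hγ hrs, uIcc_of_ge unitInterval.nonneg'] at hr
      exact Or.inl (by rw [le_antisymm hr.2 hs.1])
    · exact (disjoint_left.1 hBS hz hzS).elim
  have hclosed : ∀ s, IsClosed (γ '' uIcc t s) := fun s =>
    (isCompact_uIcc.image γ.continuous).isClosed
  have hj₁ : JoinedIn A₁ (γ t) y := by simpa using joinedIn_image_uIcc γ t 1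
  have hj₂ : JoinedIn A₂ (γ t) y := by
    have hback : JoinedIn (γ '' uIcc t 0) (γ t) x := by simpa using joinedIn_image_uIcc γ t 0
    exact (hback.mono subset_union_left).trans (hj.mono subset_union_right)
  have hty : γ t ≠ y := fun h => ht1 (hγ (h.trans γ.target.symm))
  rw [← hA]
  exact exists_isWinding hB ht hty (hclosed 1) ((hclosed 0).union hS) hinter hj₁ hj₂

end Winding

section Holes

theorem eq_zero_of_eq_zpow_on_frontier {U : Set ℂ} (hU : IsOpen U) (hb : Bornology.IsBounded U)
    {a : ℂ} (ha : a ∈ U) {n : ℤ} {φ : ℂ → ℂ} (hφ : ContinuousOn φ (closure U))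
    (hφ0 : ∀ z ∈ closure U, φ z ≠ 0) (h : ∀ z ∈ frontier U, φ z = (z - a) ^ n) : n = 0 := by
  classical
  have hsub : ∀ z ∉ U, z - a ≠ 0 := fun z hz h0 => hz (sub_eq_zero.1 h0 ▸ ha)
  have hcont : Continuous (U.piecewise φ fun z => (z - a) ^ n) :=
    continuous_piecewise h hφ <| ContinuousOn.zpow₀ (by fun_prop) _ fun z hz =>
      Or.inl (hsub z (by rwa [hU.isClosed_compl.closure_eq] at hz))
  obtain ⟨L, hL⟩ := exists_exp_eq ⟨_, hcont⟩ fun z => by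
    by_cases hz : z ∈ U
    · simpa [hz] using hφ0 z (subset_closure hz)
    · simpa [hz] using zpow_ne_zero n (hsub z hz)
  obtain ⟨R, hR⟩ := hb.subset_ball a
  have hRpos : 0 < R := pos_of_mem_ball (hR ha)
  refine eq_zero_of_exp_eq_zpow_on_sphere (p := a) hRpos L.continuous.continuousOn fun z hz => ?_
  have hzU : z ∉ U := fun hzU => (mem_ball.1 (hR hzU)).ne hz
  simp [hL, hzU]

variable {X : Type*} [TopologicalSpace X] [LocallyConnectedSpace X]

theorem connectedComponentIn_eq_of_mem_closure {U : Set X} (hU : IsOpen U) {a z : X}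
    (hz : z ∈ U) (hza : z ∈ closure (connectedComponentIn U a)) :
    connectedComponentIn U z = connectedComponentIn U a := by
  obtain ⟨w, hwz, hwa⟩ := mem_closure_iff.1 hza _ hU.connectedComponentIn
    (mem_connectedComponentIn hz)
  exact (connectedComponentIn_eq hwz).trans (connectedComponentIn_eq hwa).symm

theorem frontier_connectedComponentIn_subset {U : Set X} (hU : IsOpen U) (a : X) :
    frontier (connectedComponentIn U a) ⊆ Uᶜ := by
  intro z hz hzU
  rw [hU.connectedComponentIn.frontier_eq] at hz
  exact hz.2 (connectedComponentIn_eq_of_mem_closure hU hzU hz.1 ▸ mem_connectedComponentIn hzU)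

/-- The functions `z - a i` with `a i` in different bounded components of the complement of `K` are
multiplicatively independent modulo exponentials on `K`. -/
theorem eq_zero_of_exp_eq_prod_zpow {K : Set ℂ} (hK : IsClosed K) {ι : Type*} [Fintype ι]
    {a : ι → ℂ} (ha : ∀ i, a i ∉ K)
    (hd : Function.Injective fun i => connectedComponentIn Kᶜ (a i)) {n : ι → ℤ} {g : ℂ → ℂ}
    (hg : Continuous g) (h : ∀ z ∈ K, exp (g z) = ∏ i, (z - a i) ^ n i) {i : ι}
    (hb : Bornology.IsBounded (connectedComponentIn Kᶜ (a i))) : n i = 0 := by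
  classical
  have hne : ∀ z ∈ closure (connectedComponentIn Kᶜ (a i)), ∀ j ∈ Finset.univ.erase i,
      z - a j ≠ 0 := fun z hz j hj h0 => by
    obtain rfl := sub_eq_zero.1 h0
    exact Finset.ne_of_mem_erase hj
      (hd (connectedComponentIn_eq_of_mem_closure hK.isOpen_compl (ha j) hz))
  have hK_frontier : frontier (connectedComponentIn Kᶜ (a i)) ⊆ K := by
    simpa using frontier_connectedComponentIn_subset hK.isOpen_compl (a i)
  refine eq_zero_of_eq_zpow_on_frontier hK.isOpen_compl.connectedComponentIn hb
    (mem_connectedComponentIn (ha i))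
    (φ := fun z => exp (g z) / ∏ j ∈ Finset.univ.erase i, (z - a j) ^ n j) ?_ ?_ ?_
  · refine ContinuousOn.div (by fun_prop) (continuousOn_finsetProd _ fun j hj => ?_)
      fun z hz => Finset.prod_ne_zero_iff.2 fun j hj => zpow_ne_zero _ (hne z hz j hj)
    exact ContinuousOn.zpow₀ (by fun_prop) _ fun z hz => Or.inl (hne z hz j hj)
  · exact fun z hz => div_ne_zero (exp_ne_zero _)
      (Finset.prod_ne_zero_iff.2 fun j hj => zpow_ne_zero _ (hne z hz j hj))
  · intro z hz
    rw [h z (hK_frontier hz), ← Finset.mul_prod_erase Finset.univ _ (Finset.mem_univ i)]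
    exact mul_div_cancel_right₀ _ (Finset.prod_ne_zero_iff.2 fun j hj =>
      zpow_ne_zero _ (hne z (frontier_subset_closure hz) j hj))

variable {E : Type*} [NormedAddCommGroup E] [NormedSpace ℝ E]

theorem isPreconnected_compl_closedBall_zero (hE : 1 < Module.rank ℝ E) {R : ℝ} (hR : 0 ≤ R) :
    IsPreconnected (closedBall (0 : E) R)ᶜ := by
  have himage : IsPreconnected ((fun p : ℝ × E => p.1 • p.2) '' (Ioi R ×ˢ sphere 0 1)) :=
    (isPreconnected_Ioi.prod (isPreconnected_sphere hE 0 1)).image _ (by fun_prop)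
  convert himage using 1
  ext z
  simp only [mem_compl_iff, mem_closedBall_zero_iff, not_le]
  constructor
  · intro hz
    have hz0 : ‖z‖ ≠ 0 := (hR.trans_lt hz).ne'
    exact ⟨(‖z‖, ‖z‖⁻¹ • z), ⟨hz, by simp [norm_smul, hz0]⟩, by simp [smul_smul, hz0]⟩
  · rintro ⟨⟨r, u⟩, ⟨hr, hu⟩, rfl⟩
    rw [norm_smul, mem_sphere_zero_iff_norm.1 hu, mul_one]
    exact (mem_Ioi.1 hr).trans_le (le_abs_self r)

theorem connectedComponentIn_compl_eq_of_not_isBounded (hE : 1 < Module.rank ℝ E) {K : Set E}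
    (hK : Bornology.IsBounded K) {x y : E}
    (hx : ¬ Bornology.IsBounded (connectedComponentIn Kᶜ x))
    (hy : ¬ Bornology.IsBounded (connectedComponentIn Kᶜ y)) :
    connectedComponentIn Kᶜ x = connectedComponentIn Kᶜ y := by
  obtain ⟨R, hR0, hKR⟩ := hK.subset_closedBall_lt 0 0
  have hfar : ∀ {x}, ¬ Bornology.IsBounded (connectedComponentIn Kᶜ x) →
      ∃ z ∈ connectedComponentIn Kᶜ x, z ∈ (closedBall 0 R)ᶜ := fun hx => by
    contrapose! hx
    exact isBounded_closedBall.subset fun z hz => notMem_compl_iff.1 (hx z hz)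
  obtain ⟨z, hzx, hz⟩ := hfar hx
  obtain ⟨w, hwy, hw⟩ := hfar hy
  have hzw := (isPreconnected_compl_closedBall_zero hE hR0.le).subset_connectedComponentIn hz
    (compl_subset_compl.2 hKR) hw
  rw [connectedComponentIn_eq hzx, connectedComponentIn_eq hwy, connectedComponentIn_eq hzw]

end Holes

namespace PlaneDrawing

variable {V : Type*} {G : SimpleGraph V} (D : PlaneDrawing G)

section Arcs

theorem exists_param (e : G.edgeSet) : ∃ (u v : V) (γ : Path (D.point u) (D.point v)),
    e.1 = s(u, v) ∧ Function.Injective γ ∧ range γ = D.arc e := by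
  obtain ⟨e, he⟩ := e
  induction e with
  | _ u v =>
    obtain ⟨γ, hγ⟩ := D.arc_isArc u v he
    exact ⟨u, v, γ, rfl, hγ⟩

/-- The end of the edge `e` at which the parametrization `D.param e` starts. -/
noncomputable def tail (e : G.edgeSet) : V :=
  (D.exists_param e).choose

/-- The end of the edge `e` at which the parametrization `D.param e` stops. -/
noncomputable def head (e : G.edgeSet) : V :=
  (D.exists_param e).choose_spec.choose

/-- An injective parametrization of the arc of the edge `e`. -/
noncomputable def param (e : G.edgeSet) : Path (D.point (D.tail e)) (D.point (D.head e)) :=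
  (D.exists_param e).choose_spec.choose_spec.choose

theorem coe_eq_tail_head (e : G.edgeSet) : e.1 = s(D.tail e, D.head e) :=
  (D.exists_param e).choose_spec.choose_spec.choose_spec.1

theorem param_injective (e : G.edgeSet) : Function.Injective (D.param e) :=
  (D.exists_param e).choose_spec.choose_spec.choose_spec.2.1

theorem range_param (e : G.edgeSet) : range (D.param e) = D.arc e :=
  (D.exists_param e).choose_spec.choose_spec.choose_spec.2.2

theorem param_mem_arc (e : G.edgeSet) (t : I) : D.param e t ∈ D.arc e :=
  D.range_param e ▸ mem_range_self t

theorem isCompact_arc (e : G.edgeSet) : IsCompact (D.arc e) :=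
  D.range_param e ▸ isCompact_range (D.param e).continuous

theorem end_of_param_eq_point {e : G.edgeSet} {t : I} {v : V} (h : D.param e t = D.point v) :
    t = 0 ∧ v = D.tail e ∨ t = 1 ∧ v = D.head e := by
  have hv := D.mem_of_point_mem_arc e v (h ▸ D.param_mem_arc e t)
  rw [D.coe_eq_tail_head e, Sym2.mem_iff] at hv
  rcases hv with rfl | rfl
  · exact Or.inl ⟨D.param_injective e (h.trans (D.param e).source.symm), rfl⟩
  · exact Or.inr ⟨D.param_injective e (h.trans (D.param e).target.symm), rfl⟩

theorem sigma_eq_of_param_eq {e f : G.edgeSet} {t s : I} (h : D.param e t = D.param f s)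
    (hv : D.param e t ∉ range D.point) : (⟨e, t⟩ : Σ _ : G.edgeSet, I) = ⟨f, s⟩ := by
  have hef : e = f := by
    by_contra hne
    exact hv (D.arc_inter_arc e f hne ⟨D.param_mem_arc e t, h ▸ D.param_mem_arc f s⟩)
  subst hef
  rw [D.param_injective e h]

/-- The part of the drawing that consists of all vertices and of the edges in `S`. -/
def part (S : Set G.edgeSet) : Set ℂ :=
  range D.point ∪ ⋃ e ∈ S, D.arc e

theorem part_univ : D.part univ = D.carrier := by
  simp [part, carrier]

theorem part_mono {S T : Set G.edgeSet} (h : S ⊆ T) : D.part S ⊆ D.part T :=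
  union_subset_union_right _ (biUnion_subset_biUnion_left h)

theorem part_subset_carrier (S : Set G.edgeSet) : D.part S ⊆ D.carrier :=
  D.part_univ ▸ D.part_mono (subset_univ S)

theorem part_insert (e : G.edgeSet) (S : Set G.edgeSet) :
    D.part (insert e S) = D.arc e ∪ D.part S := by
  simp only [part, biUnion_insert, union_left_comm]

theorem arc_subset_part {e : G.edgeSet} {S : Set G.edgeSet} (he : e ∈ S) : D.arc e ⊆ D.part S :=
  (subset_biUnion_of_mem (u := D.arc) he).trans subset_union_right

theorem param_mem_carrier (e : G.edgeSet) (t : I) : D.param e t ∈ D.carrier :=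
  D.part_univ ▸ D.arc_subset_part (mem_univ e) (D.param_mem_arc e t)

theorem end_of_param_mem_part {e : G.edgeSet} {S : Set G.edgeSet} (he : e ∉ S) {t : I}
    (h : D.param e t ∈ D.part S) : t = 0 ∨ t = 1 := by
  have hpoint : D.param e t ∈ range D.point := by
    rcases h with h | h
    · exact h
    · obtain ⟨f, hf, hzf⟩ := mem_iUnion₂.1 h
      exact D.arc_inter_arc f e (fun hfe => he (hfe ▸ hf)) ⟨hzf, D.param_mem_arc e t⟩
  obtain ⟨v, hv⟩ := hpoint
  exact (D.end_of_param_eq_point hv.symm).imp And.left And.left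

theorem isCompact_part [Finite V] (S : Set G.edgeSet) : IsCompact (D.part S) :=
  (finite_range _).isCompact.union (S.toFinite.isCompact_biUnion fun e _ => D.isCompact_arc e)

theorem isCompact_carrier [Finite V] : IsCompact D.carrier :=
  D.part_univ ▸ D.isCompact_part univ

theorem exists_notMem_carrier [Finite V] : ∃ z, z ∉ D.carrier := by
  by_contra! h
  exact noncompact_univ ℂ (eq_univ_of_forall h ▸ D.isCompact_carrier)

end Arcs

end PlaneDrawing

section CountingRegions

theorem card_lt_card_of_apply_ne {K ι X : Type*} [Field K] [Fintype ι] [Fintype X] [Nonempty X]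
    {f : ι → X → K} {x y : ι → X} (hne : ∀ i, f i (x i) ≠ f i (y i))
    (heq : ∀ i j, j ≠ i → f j (x i) = f j (y i)) : Fintype.card ι < Fintype.card X := by
  classical
  have hli : LinearIndependent K (fun o : Option ι => o.elim 1 f) := by
    rw [Fintype.linearIndependent_iff]
    intro c hc
    have hval : ∀ z, c none + ∑ i, c (some i) * f i z = 0 := fun z => by
      simpa [Fintype.sum_option] using congrFun hc z
    have hsome : ∀ i, c (some i) = 0 := fun i => by
      have hdiff : ∑ j, c (some j) * (f j (x i) - f j (y i)) = 0 := by
        simp only [mul_sub, Finset.sum_sub_distrib]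
        linear_combination hval (x i) - hval (y i)
      rw [Finset.sum_eq_single i (fun j _ hj => by rw [heq i j hj, sub_self, mul_zero])
        (fun hi => absurd (Finset.mem_univ i) hi)] at hdiff
      exact (mul_eq_zero.1 hdiff).resolve_right (sub_ne_zero.2 (hne i))
    rintro (_ | i)
    · obtain ⟨z⟩ := ‹Nonempty X›
      simpa [hsome] using hval z
    · exact hsome i
  simpa [Fintype.card_option, Nat.succ_le_iff] using hli.fintype_card_le_finrank

namespace PlaneDrawing

variable {V : Type*} {G : SimpleGraph V} (D : PlaneDrawing G)

theorem exists_isWinding [Finite V] {e : G.edgeSet} {S : Set G.edgeSet} (he : e ∉ S)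
    (hj : JoinedIn (D.part S) (D.point (D.tail e)) (D.point (D.head e))) :
    ∃ (B : Set ℂ) (n : ℂ → ℂ), IsPreconnected B ∧ Disjoint B (D.part {e}ᶜ) ∧
      IsWinding n (D.part (insert e S)) ∧
      ∃ z ∈ B \ D.carrier, ∃ w ∈ B \ D.carrier, n z ≠ n w := by
  let half : I := ⟨1 / 2, by norm_num, by norm_num⟩
  have hhalf0 : half ≠ 0 := fun h => by simpa [half] using congrArg Subtype.val h
  have hhalf1 : half ≠ 1 := fun h => by simpa [half] using congrArg Subtype.val h
  have hmid : D.param e half ∉ D.part {e}ᶜ := fun h =>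
    (D.end_of_param_mem_part (by simp) h).elim hhalf0 hhalf1
  obtain ⟨ε, hε, hball⟩ := isOpen_iff.1 (D.isCompact_part {e}ᶜ).isClosed.isOpen_compl _ hmid
  have hdisj : Disjoint (ball (D.param e half) ε) (D.part {e}ᶜ) :=
    subset_compl_iff_disjoint_right.1 hball
  obtain ⟨n, hn, z, hz, w, hw, hzw⟩ := exists_isWinding_range_union (D.param_injective e)
    (D.isCompact_part S).isClosed hj isOpen_ball (mem_ball_self hε) hhalf1
    (hdisj.mono_right (D.part_mono (subset_compl_singleton_iff.2 he)))
  rw [D.range_param, ← part_insert] at hn hz hw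
  have hcarrier : ∀ z ∈ ball (D.param e half) ε \ D.part (insert e S), z ∉ D.carrier := by
    intro z hz hzD
    rw [← part_univ, ← union_compl_self {e}, ← insert_eq, part_insert] at hzD
    rw [part_insert] at hz
    exact hzD.elim (fun h => hz.2 (Or.inl h)) (disjoint_left.1 hdisj hz.1)
  exact ⟨_, n, (convex_ball _ _).isPreconnected, hdisj, hn,
    z, ⟨hz.1, hcarrier z hz⟩, w, ⟨hw.1, hcarrier w hw⟩, hzw⟩

theorem card_compl_lt_ncard_regions [Finite V] (hfin : D.regions.Finite) {S : Set G.edgeSet}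
    (hS : ∀ e ∉ S, JoinedIn (D.part S) (D.point (D.tail e)) (D.point (D.head e))) :
    Sᶜ.ncard < D.regions.ncard := by
  classical
  have := Fintype.ofFinite V
  have := Fintype.ofFinite (Sᶜ : Set G.edgeSet)
  have := hfin.fintype
  choose B n hB hBe hn z hz w hw hzw using fun e : (Sᶜ : Set G.edgeSet) => D.exists_isWinding e.2
    (hS e e.2)
  let region : (D.carrierᶜ : Set ℂ) → D.regions := fun z => ⟨_, mem_image_of_mem _ z.2⟩
  have hrep : ∀ W : D.regions, ∃ z ∉ D.carrier, connectedComponentIn D.carrierᶜ z = W :=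
    fun W => W.2
  choose r hrD hrW using hrep
  have hconst : ∀ e (z : (D.carrierᶜ : Set ℂ)), n e (r (region z)) = n e z := fun e z =>
    (hn e).eq_of_isPreconnected (isPreconnected_connectedComponentIn (x := (z : ℂ)))
      (disjoint_left.2 fun y hy hyS => connectedComponentIn_subset D.carrierᶜ _ hy
        (D.part_subset_carrier _ hyS))
      ((hrW (region z)).subset (mem_connectedComponentIn (hrD (region z))))
      (mem_connectedComponentIn z.2)
  have : Nonempty D.regions := D.exists_notMem_carrier.elim fun z hz => ⟨region ⟨z, hz⟩⟩
  rw [← Nat.card_coe_set_eq, ← Nat.card_coe_set_eq, Nat.card_eq_fintype_card,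
    Nat.card_eq_fintype_card]
  refine card_lt_card_of_apply_ne (f := fun e W => n e (r W))
    (x := fun e => region ⟨z e, (hz e).2⟩) (y := fun e => region ⟨w e, (hw e).2⟩)
    (fun e => by simpa only [hconst] using hzw e) fun e f hfe => ?_
  simp only [hconst]
  refine (hn f).eq_of_isPreconnected (hB e) ((hBe e).mono_right (D.part_mono ?_)) (hz e).1 (hw e).1
  rintro g (rfl | hg) hge
  exacts [hfe (Subtype.ext hge), e.2 (hge ▸ hg)]

theorem joinedIn_part_of_reachable {T : SimpleGraph V} (hT : T ≤ G) {u v : V}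
    (h : T.Reachable u v) :
    JoinedIn (D.part {e | e.1 ∈ T.edgeSet}) (D.point u) (D.point v) := by
  obtain ⟨p⟩ := h
  induction p with
  | nil => exact JoinedIn.refl (Or.inl (mem_range_self _))
  | @cons u v w huv _ ih =>
    obtain ⟨γ, -, hγ⟩ := D.arc_isArc u v (hT huv)
    have harc := D.arc_subset_part (S := {e | e.1 ∈ T.edgeSet}) (e := ⟨s(u, v), hT huv⟩) huv
    exact JoinedIn.trans ⟨γ, fun t => harc (hγ ▸ mem_range_self t)⟩ ih

end PlaneDrawing

theorem exists_adj_dist_lt {V : Type*} {G : SimpleGraph V} {v r : V} (h : G.Reachable v r)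
    (hne : v ≠ r) : ∃ w, G.Adj v w ∧ G.dist w r < G.dist v r := by
  obtain ⟨p, hp⟩ := h.exists_walk_length_eq_dist
  cases p with
  | nil => exact absurd rfl hne
  | cons hadj q => exact ⟨_, hadj, hp ▸ Nat.lt_succ_of_le (SimpleGraph.dist_le q)⟩

theorem reachable_of_parent {V : Type*} {T : SimpleGraph V} {root parent : V → V} {d : V → V → ℕ}
    (h : ∀ v, root v ≠ v → T.Adj v (parent v) ∧ root (parent v) = root v ∧
      d (parent v) (root v) < d v (root v)) (v : V) : T.Reachable v (root v) := by
  induction hk : d v (root v) using Nat.strong_induction_on generalizing v with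
  | _ k ih =>
    by_cases hv : root v = v
    · rw [hv]
    obtain ⟨hadj, hroot, hlt⟩ := h v hv
    exact hadj.reachable.trans (hroot ▸ ih _ (hk ▸ hroot.symm ▸ hlt) (parent v) rfl)

theorem exists_spanning_forest {V : Type*} [Finite V] (G : SimpleGraph V) :
    ∃ T ≤ G, (∀ u v, G.Reachable u v → T.Reachable u v) ∧
      T.edgeSet.ncard + Nat.card G.ConnectedComponent ≤ Nat.card V := by
  let root : V → V := fun v => (G.connectedComponentMk v).out
  have hroot : ∀ v, G.Reachable v (root v) := fun v =>
    (SimpleGraph.ConnectedComponent.exact (Quot.out_eq (G.connectedComponentMk v))).symm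
  have hroot_eq : ∀ {u v}, G.Reachable u v → root u = root v := fun h =>
    congrArg Quot.out (SimpleGraph.ConnectedComponent.sound h)
  have hparent : ∀ v, ∃ w, root v ≠ v → G.Adj v w ∧ G.dist w (root v) < G.dist v (root v) := by
    intro v
    by_cases hv : root v = v
    · exact ⟨v, fun h => absurd hv h⟩
    · exact (exists_adj_dist_lt (hroot v) (Ne.symm hv)).imp fun _ h _ => h
  choose parent hparent using hparent
  let E : Set (Sym2 V) := (fun v => s(v, parent v)) '' {v | root v ≠ v}
  have hE : ∀ v, root v ≠ v → (SimpleGraph.fromEdgeSet E).Adj v (parent v) := fun v hv =>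
    (SimpleGraph.fromEdgeSet_adj E).2 ⟨mem_image_of_mem _ hv, (hparent v hv).1.ne⟩
  have hreach : ∀ v, (SimpleGraph.fromEdgeSet E).Reachable v (root v) :=
    reachable_of_parent (d := G.dist) fun v hv =>
      ⟨hE v hv, hroot_eq (hparent v hv).1.reachable.symm, (hparent v hv).2⟩
  refine ⟨SimpleGraph.fromEdgeSet E, ?_, fun u v huv => ?_, ?_⟩
  · rw [← SimpleGraph.fromEdgeSet_edgeSet G]
    refine SimpleGraph.fromEdgeSet_mono ?_
    rintro _ ⟨v, hv, rfl⟩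
    exact (hparent v hv).1
  · exact (hreach u).trans (hroot_eq huv ▸ (hreach v).symm)
  · have hcomp : Nat.card G.ConnectedComponent ≤ {v | root v = v}.ncard := by
      rw [← Nat.card_coe_set_eq]
      refine Nat.card_le_card_of_injective
        (fun c => ⟨c.out, congrArg Quot.out (Quot.out_eq c)⟩) fun c d h => ?_
      exact Quotient.out_injective (s := G.reachableSetoid) (Subtype.ext_iff.1 h)
    have hedges : (SimpleGraph.fromEdgeSet E).edgeSet.ncard ≤ {v | root v = v}ᶜ.ncard := by
      rw [SimpleGraph.edgeSet_fromEdgeSet]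
      exact (ncard_le_ncard sdiff_subset).trans (ncard_image_le (toFinite _))
    have := ncard_add_ncard_compl {v | root v = v}
    omega

theorem PlaneDrawing.ncard_edgeSet_add_card_connectedComponent_lt {V : Type*} [Finite V]
    {G : SimpleGraph V} (D : PlaneDrawing G) (hfin : D.regions.Finite) :
    G.edgeSet.ncard + Nat.card G.ConnectedComponent < Nat.card V + D.regions.ncard := by
  obtain ⟨T, hTG, hreach, hT⟩ := exists_spanning_forest G
  let S : Set G.edgeSet := {e | e.1 ∈ T.edgeSet}
  have hcompl : Sᶜ.ncard < D.regions.ncard := D.card_compl_lt_ncard_regions hfin fun e _ =>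
    D.joinedIn_part_of_reachable hTG (hreach _ _ (SimpleGraph.Adj.reachable
      (G.mem_edgeSet.1 (D.coe_eq_tail_head e ▸ e.2))))
  have hS : S.ncard ≤ T.edgeSet.ncard :=
    ncard_le_ncard_of_injOn Subtype.val (fun _ he => he) Subtype.val_injective.injOn
  have := ncard_add_ncard_compl S
  rw [Nat.card_coe_set_eq] at this
  omega

end CountingRegions

universe u v

theorem exists_continuousMap_comp_eq {X : Type*} {Y : Type u} {Z : Type v} [TopologicalSpace X]
    [CompactSpace X] [TopologicalSpace Y] [T2Space Y] [NormalSpace Y] [TopologicalSpace Z]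
    [TietzeExtension.{u, v} Z]
    {p : C(X, Y)} {f : C(X, Z)} (h : Function.FactorsThrough f p) :
    ∃ g : C(Y, Z), ∀ x, g (p x) = f x := by
  let q : C(X, range p) := ⟨rangeFactorization p, p.continuous.rangeFactorization⟩
  have hquot : IsQuotientMap q :=
    q.continuous.isClosedMap.isQuotientMap q.continuous rangeFactorization_surjective
  have hq : Function.FactorsThrough f q := fun x y hxy => h (congrArg Subtype.val hxy)
  obtain ⟨g, hg⟩ := ContinuousMap.exists_restrict_eq (isCompact_range p.continuous).isClosed
    (hquot.lift f hq)
  exact ⟨g, fun x => (DFunLike.congr_fun hg (q x)).trans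
    (DFunLike.congr_fun (hquot.lift_comp f hq) x)⟩

namespace PlaneDrawing

variable {V : Type*} {G : SimpleGraph V} (D : PlaneDrawing G)

section FiniteRegions

theorem exists_continuousMap_extension [Finite V] (w : G.edgeSet → C(I, ℂ)) (l : V → ℂ)
    (h0 : ∀ e, w e 0 = l (D.tail e)) (h1 : ∀ e, w e 1 = l (D.head e)) :
    ∃ g : C(ℂ, ℂ), (∀ e t, g (D.param e t) = w e t) ∧ ∀ v, g (D.point v) = l v := by
  let _ : TopologicalSpace V := ⊥
  have : DiscreteTopology V := ⟨rfl⟩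
  let pos : C((Σ _ : G.edgeSet, I) ⊕ V, ℂ) :=
    { toFun := Sum.elim (fun p => D.param p.1 p.2) D.point
      continuous_toFun := continuous_sumElim.2
        ⟨continuous_sigma fun e => (D.param e).continuous, continuous_of_discreteTopology⟩ }
  let val : C((Σ _ : G.edgeSet, I) ⊕ V, ℂ) :=
    { toFun := Sum.elim (fun p => w p.1 p.2) l
      continuous_toFun := continuous_sumElim.2
        ⟨continuous_sigma fun e => (w e).continuous, continuous_of_discreteTopology⟩ }
  have hvertex : ∀ x v, pos x = D.point v → val x = l v := by
    rintro (⟨e, t⟩ | u) v h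
    · rcases D.end_of_param_eq_point h with ⟨rfl, rfl⟩ | ⟨rfl, rfl⟩
      exacts [h0 e, h1 e]
    · exact congrArg l (D.point_injective h)
  have hfactor : Function.FactorsThrough val pos := by
    intro x y hxy
    by_cases hx : pos x ∈ range D.point
    · obtain ⟨v, hv⟩ := hx
      rw [hvertex x v hv.symm, hvertex y v (hxy ▸ hv.symm)]
    · rcases x, y with ⟨⟨e, t⟩ | u, ⟨f, s⟩ | v⟩
      · rw [D.sigma_eq_of_param_eq hxy hx]
      · exact (hx ⟨v, hxy.symm⟩).elim
      all_goals exact (hx ⟨u, rfl⟩).elim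
  obtain ⟨g, hg⟩ := exists_continuousMap_comp_eq hfactor
  exact ⟨g, fun e t => hg (Sum.inl ⟨e, t⟩), fun v => hg (Sum.inr v)⟩

/-- The monodromies of the logarithms of `z - a i` along the edges are integral vectors, which are
linearly dependent as soon as there are more points than edges. -/
theorem exists_exp_eq_prod_zpow [Finite V] {ι : Type*} [Fintype ι] {a : ι → ℂ}
    (ha : ∀ i, a i ∉ D.carrier) (hι : Nat.card G.edgeSet < Fintype.card ι) :
    ∃ (n : ι → ℤ) (g : C(ℂ, ℂ)), n ≠ 0 ∧
      ∀ z ∈ D.carrier, exp (g z) = ∏ i, (z - a i) ^ n i := by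
  classical
  have := Fintype.ofFinite V
  choose w d hw hw0 hw1 using fun e i =>
    exists_exp_eq_path_sub (a := a i) (D.param e) fun t (h : D.param e t = a i) =>
      ha i (h ▸ D.param_mem_carrier e t)
  have hdep : ¬ LinearIndependent ℤ (fun i e => d e i) := fun hli => by
    have := hli.fintype_card_le_finrank
    rw [Module.finrank_fintype_fun_eq_card, ← Nat.card_eq_fintype_card (α := G.edgeSet)] at this
    omega
  obtain ⟨n, hn, i, hi⟩ := Fintype.not_linearIndependent_iff.1 hdep
  have hperiod : ∀ e, ∑ i, (n i : ℂ) * (d e i * (2 * Real.pi * Complex.I)) = 0 := fun e => by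
    have h : ∑ i, n i * d e i = 0 := by simpa [Finset.sum_apply] using congrFun hn e
    simp only [← mul_assoc, ← Finset.sum_mul]
    rw [show ∑ i, (n i : ℂ) * d e i = 0 by exact_mod_cast h]
    ring
  obtain ⟨g, hge, hgv⟩ := D.exists_continuousMap_extension
    (fun e => ⟨fun t => ∑ i, n i * w e i t, by fun_prop⟩)
    (fun v => ∑ i, n i * log (D.point v - a i)) (fun e => by simp [hw0])
    (fun e => by simp [hw1, mul_add, Finset.sum_add_distrib, hperiod])
  refine ⟨n, g, fun h => hi (congrFun h i), ?_⟩
  rintro z (⟨v, rfl⟩ | hz)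
  · simp only [hgv, exp_sum, exp_int_mul]
    refine Finset.prod_congr rfl fun j _ => ?_
    rw [exp_log (sub_ne_zero.2 fun h : D.point v = a j => ha j (h ▸ Or.inl (mem_range_self v)))]
  · obtain ⟨e, he⟩ := mem_iUnion.1 hz
    obtain ⟨t, rfl⟩ := D.range_param e ▸ he
    simp only [hge, ContinuousMap.coe_mk, exp_sum, exp_int_mul, hw]

theorem finite_bounded_regions [Finite V] :
    {W ∈ D.regions | Bornology.IsBounded W}.Finite := by
  by_contra hinf
  obtain ⟨t, ht, hcard⟩ := Set.Infinite.exists_subset_card_eq hinf (Nat.card G.edgeSet + 1)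
  have hrep : ∀ W : t, ∃ z ∉ D.carrier, connectedComponentIn D.carrierᶜ z = W := fun W =>
    (ht W.2).1
  choose a ha haW using hrep
  obtain ⟨n, g, hn, hg⟩ := D.exists_exp_eq_prod_zpow ha (by simp [hcard])
  refine hn (funext fun W => eq_zero_of_exp_eq_prod_zpow D.isCompact_carrier.isClosed ha
    (fun W W' h => Subtype.ext (by simpa only [haW] using h)) g.continuous hg ?_)
  rw [haW]
  exact (ht W.2).2

theorem subsingleton_unbounded_regions [Finite V] :
    {W ∈ D.regions | ¬ Bornology.IsBounded W}.Subsingleton := by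
  rintro _ ⟨⟨x, -, rfl⟩, hx⟩ _ ⟨⟨y, -, rfl⟩, hy⟩
  exact connectedComponentIn_compl_eq_of_not_isBounded (by simp [Complex.rank_real_complex])
    D.isCompact_carrier.isBounded hx hy

theorem finite_regions [Finite V] : D.regions.Finite := by
  refine (D.finite_bounded_regions.union D.subsingleton_unbounded_regions.finite).subset ?_
  exact fun W hW => (em (Bornology.IsBounded W)).imp (⟨hW, ·⟩) (⟨hW, ·⟩)

end FiniteRegions

end PlaneDrawing

end Drawings

/-! ### Connected sets and induced paths -/

section Connectivity

variable {V : Type*} {G : SimpleGraph V}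

/-- `T` is a union of components of the graph that `G` induces on `A`. -/
structure IsClosedIn (G : SimpleGraph V) (A T : Set V) : Prop where
  subset : T ⊆ A
  mem_of_adj : ∀ a ∈ T, ∀ b ∈ A, G.Adj a b → b ∈ T

/-- `A` induces a connected nonempty subgraph of `G`. -/
def Conn (G : SimpleGraph V) (A : Set V) : Prop :=
  (G.induce A).Connected

/-- Two sets of vertices touch if they have a common vertex or are joined by an edge. -/
def Touch (G : SimpleGraph V) (A B : Set V) : Prop :=
  ∃ a ∈ A, ∃ b ∈ B, a = b ∨ G.Adj a b

theorem Touch.symm {A B : Set V} (h : Touch G A B) : Touch G B A := by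
  obtain ⟨a, ha, b, hb, hab⟩ := h
  exact ⟨b, hb, a, ha, hab.imp Eq.symm fun hab => hab.symm⟩

theorem Touch.mono {A B A' B' : Set V} (h : Touch G A B) (hA : A ⊆ A') (hB : B ⊆ B') :
    Touch G A' B' := by
  obtain ⟨a, ha, b, hb, hab⟩ := h
  exact ⟨a, hA ha, b, hB hb, hab⟩

theorem IsClosedIn.inter {A T B : Set V} (h : IsClosedIn G A T) (hB : B ⊆ A) :
    IsClosedIn G B (T ∩ B) :=
  ⟨inter_subset_right, fun a ha b hb hab => ⟨h.mem_of_adj a ha.1 b (hB hb) hab, hb⟩⟩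

theorem IsClosedIn.diff {A T : Set V} (h : IsClosedIn G A T) : IsClosedIn G A (A \ T) :=
  ⟨sdiff_subset, fun a ha b hb hab => ⟨hb, fun hbT => ha.2 (h.mem_of_adj b hbT a ha.1 hab.symm)⟩⟩

theorem Conn.nonempty {A : Set V} (hA : Conn G A) : A.Nonempty :=
  nonempty_coe_sort.1 (SimpleGraph.Connected.nonempty hA)

theorem Conn.eq_of_isClosedIn {A T : Set V} (hA : Conn G A) (hT : IsClosedIn G A T)
    (hne : T.Nonempty) : T = A := by
  have hwalk : ∀ x y : A, (G.induce A).Walk x y → x.1 ∈ T → y.1 ∈ T := by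
    intro x y w
    induction w with
    | nil => exact id
    | @cons x y _ hxy _ ih => exact fun hx => ih (hT.mem_of_adj x hx y y.2 hxy)
  obtain ⟨t, ht⟩ := hne
  refine hT.subset.antisymm fun b hb => ?_
  obtain ⟨w⟩ := SimpleGraph.Connected.preconnected hA ⟨t, hT.subset ht⟩ ⟨b, hb⟩
  exact hwalk _ _ w ht

theorem conn_of_forall_isClosedIn {A : Set V} (hA : A.Nonempty)
    (h : ∀ T, IsClosedIn G A T → T.Nonempty → T = A) : Conn G A := by
  obtain ⟨a, ha⟩ := hA
  have hreach := h (Subtype.val '' {b : A | (G.induce A).Reachable ⟨a, ha⟩ b}) ⟨by simp, by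
    rintro _ ⟨b, hb, rfl⟩ c hc hbc
    exact ⟨⟨c, hc⟩, hb.trans (SimpleGraph.Adj.reachable hbc), rfl⟩⟩
    ⟨a, ⟨a, ha⟩, SimpleGraph.Reachable.refl _, rfl⟩
  refine (SimpleGraph.connected_iff_exists_forall_reachable _).2 ⟨⟨a, ha⟩, fun b => ?_⟩
  obtain ⟨c, hc, hcb⟩ := hreach.ge b.2
  rwa [← Subtype.ext hcb]

theorem conn_singleton (a : V) : Conn G {a} :=
  SimpleGraph.Connected.of_subsingleton

theorem Conn.union {A B : Set V} (hA : Conn G A) (hB : Conn G B) (h : Touch G A B) :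
    Conn G (A ∪ B) := by
  obtain ⟨a, ha, b, hb, rfl | hab⟩ := h
  · exact SimpleGraph.induce_union_connected hA.preconnected hB.preconnected ⟨a, ha, hb⟩
  · exact SimpleGraph.connected_induce_union hA.preconnected hB.preconnected ha hb hab

theorem Conn.insert_adj {A : Set V} (hA : Conn G A) {w a : V} (ha : a ∈ A) (h : G.Adj w a) :
    Conn G (insert w A) := by
  rw [insert_eq]
  exact (conn_singleton w).union hA ⟨w, rfl, a, ha, Or.inr h⟩

theorem Conn.subset_of_isClosedIn {A B T : Set V} (hB : Conn G B) (hBA : B ⊆ A)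
    (hT : IsClosedIn G A T) (h : (T ∩ B).Nonempty) : B ⊆ T :=
  inter_eq_right.1 (hB.eq_of_isClosedIn (hT.inter hBA) h)

theorem Conn.exists_adj {A T : Set V} (hA : Conn G A) (hT : T ⊂ A) (hne : T.Nonempty) :
    ∃ a ∈ T, ∃ b ∈ A, b ∉ T ∧ G.Adj a b := by
  by_contra! h
  exact hT.ne (hA.eq_of_isClosedIn
    ⟨hT.subset, fun a ha b hb hab => by_contra fun hbT => h a ha b hb hbT hab⟩ hne)

/-- The vertex sets of the components of the graph that `G` induces on `U`. -/
def comps (G : SimpleGraph V) (U : Set V) : Set (Set V) :=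
  {K | Conn G K ∧ IsClosedIn G U K}

theorem exists_mem_comps {U : Set V} {u : V} (hu : u ∈ U) : ∃ K ∈ comps G U, u ∈ K := by
  set K : Set V := ⋂₀ {T | IsClosedIn G U T ∧ u ∈ T}
  have huK : u ∈ K := mem_sInter.2 fun T hT => hT.2
  have hmin : ∀ T, IsClosedIn G U T → u ∈ T → K ⊆ T := fun T hT huT =>
    sInter_subset_of_mem ⟨hT, huT⟩
  have hclosed : IsClosedIn G U K := by
    refine ⟨hmin U ⟨subset_rfl, fun _ _ b hb _ => hb⟩ hu, fun a ha b hb hab => ?_⟩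
    exact mem_sInter.2 fun T hT => hT.1.mem_of_adj a (mem_sInter.1 ha T hT) b hb hab
  have hlift : ∀ T, IsClosedIn G K T → IsClosedIn G U T := fun T hT =>
    ⟨hT.subset.trans hclosed.subset, fun a ha b hb hab =>
      hT.mem_of_adj a ha b (hclosed.mem_of_adj a (hT.subset ha) b hb hab) hab⟩
  refine ⟨K, ⟨conn_of_forall_isClosedIn ⟨u, huK⟩ fun T hT hne => ?_, hclosed⟩, huK⟩
  by_cases huT : u ∈ T
  · exact hT.subset.antisymm (hmin T (hlift T hT) huT)
  · obtain ⟨t, ht⟩ := hne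
    exact absurd ht (hmin _ (hlift _ hT.diff) ⟨huK, huT⟩ (hT.subset ht)).2

theorem Conn.subset_of_mem_comps {U A K : Set V} (hA : Conn G A) (hAU : A ⊆ U)
    (hK : K ∈ comps G U) {a : V} (ha : a ∈ A) (haK : a ∈ K) : A ⊆ K :=
  hA.subset_of_isClosedIn hAU hK.2 ⟨a, haK, ha⟩

theorem comps_eq_of_mem {U K K' : Set V} (hK : K ∈ comps G U) (hK' : K' ∈ comps G U) {a : V}
    (ha : a ∈ K) (ha' : a ∈ K') : K = K' :=
  (hK.1.subset_of_mem_comps hK.2.subset hK' ha ha').antisymm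
    (hK'.1.subset_of_mem_comps hK'.2.subset hK ha' ha)

theorem comps_univ : comps G univ = range (SimpleGraph.ConnectedComponent.supp (G := G)) := by
  have hsupp : ∀ C : G.ConnectedComponent, C.supp ∈ comps G univ := fun C =>
    ⟨C.connected_toSimpleGraph, subset_univ _,
      fun _ ha _ _ hab => C.mem_supp_of_adj_mem_supp ha hab⟩
  refine subset_antisymm (fun K hK => ?_) (range_subset_iff.2 hsupp)
  obtain ⟨k, hk⟩ := hK.1.nonempty
  exact ⟨G.connectedComponentMk k, comps_eq_of_mem (hsupp _) hK rfl hk⟩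

theorem Conn.exists_conn_diff_singleton [Finite V] {D Q : Set V} (hD : Conn G D) (hQ : Conn G Q)
    (hQD : Q ⊂ D) : ∃ d ∈ D, d ∉ Q ∧ Conn G (D \ {d}) := by
  obtain ⟨E, hQE, hE⟩ := (toFinite {E : Set V | Conn G E ∧ E ⊂ D}).exists_le_maximal (a := Q)
    ⟨hQ, hQD⟩
  obtain ⟨a, ha, b, hb, hbE, hab⟩ := hD.exists_adj hE.1.2 hE.1.1.nonempty
  have hins : insert b E = D := by
    by_contra hne
    have hss : insert b E ⊂ D := (insert_subset hb hE.1.2.subset).ssubset_of_ne hne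
    exact hbE (hE.2 ⟨hE.1.1.insert_adj ha hab.symm, hss⟩ (subset_insert _ _) (mem_insert _ _))
  refine ⟨b, hb, fun h => hbE (hQE h), ?_⟩
  rw [← hins, insert_sdiff_of_mem _ (mem_singleton b), sdiff_singleton_eq_self hbE]
  exact hE.1.1

end Connectivity

section InducedPaths

variable {V : Type*} {G : SimpleGraph V}

/-- `IndPath G a b Q`: the set `Q` induces a path with ends `a` and `b`. -/
inductive IndPath (G : SimpleGraph V) : V → V → Set V → Prop
  | single (a : V) : IndPath G a a {a}
  | cons {a b c : V} {Q : Set V} (hab : G.Adj a b) (h : IndPath G b c Q) (ha : a ∉ Q)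
      (hu : ∀ z ∈ Q, G.Adj a z → z = b) : IndPath G a c (insert a Q)

namespace IndPath

theorem left_mem {a b : V} {Q : Set V} (h : IndPath G a b Q) : a ∈ Q := by
  cases h with
  | single => rfl
  | cons => exact mem_insert _ _

theorem right_mem {a b : V} {Q : Set V} (h : IndPath G a b Q) : b ∈ Q := by
  induction h with
  | single => rfl
  | cons _ _ _ _ ih => exact mem_insert_of_mem _ ih

theorem conn {a b : V} {Q : Set V} (h : IndPath G a b Q) : Conn G Q := by
  induction h with
  | single => exact conn_singleton _
  | cons hab h _ _ ih => exact ih.insert_adj h.left_mem hab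

theorem eq_singleton_or_exists_tail {a b : V} {Q : Set V} (h : IndPath G a b Q) :
    (a = b ∧ Q = {a}) ∨
      (a ≠ b ∧ ∃ c, G.Adj a c ∧ IndPath G c b (Q \ {a}) ∧ ∀ z ∈ Q, G.Adj a z → z = c) := by
  cases h with
  | single => exact Or.inl ⟨rfl, rfl⟩
  | @cons _ c _ Q hac h ha hu =>
    refine Or.inr ⟨fun hab => ha (hab ▸ h.right_mem), c, hac, ?_, ?_⟩
    · rwa [insert_sdiff_of_mem _ (mem_singleton a), sdiff_singleton_eq_self ha]
    · rintro z (rfl | hz) haz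
      · exact absurd haz G.irrefl
      · exact hu z hz haz

theorem eq_singleton {a : V} {Q : Set V} (h : IndPath G a a Q) : Q = {a} :=
  h.eq_singleton_or_exists_tail.elim And.right fun h' => absurd rfl h'.1

theorem append {a b c d : V} {Q Q' : Set V} (h : IndPath G a b Q) (h' : IndPath G c d Q')
    (hbc : G.Adj b c) (hdis : ∀ x ∈ Q, x ∉ Q')
    (hadj : ∀ x ∈ Q, ∀ y ∈ Q', G.Adj x y → x = b ∧ y = c) : IndPath G a d (Q ∪ Q') := by
  induction h with
  | single a =>
    rw [← insert_eq]
    exact cons hbc h' (hdis a rfl) fun z hz haz => (hadj a rfl z hz haz).2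
  | @cons a b' b Q hab h ha hu ih =>
    rw [insert_union]
    refine cons hab (ih hbc (fun x hx => hdis x (Or.inr hx)) fun x hx => hadj x (Or.inr hx)) ?_ ?_
    · rintro (haQ | haQ')
      · exact ha haQ
      · exact hdis a (Or.inl rfl) haQ'
    · rintro z (hz | hz) haz
      · exact hu z hz haz
      · exact absurd ((hadj a (Or.inl rfl) z hz haz).1 ▸ h.right_mem) ha

theorem symm {a b : V} {Q : Set V} (h : IndPath G a b Q) : IndPath G b a Q := by
  induction h with
  | single a => exact single a
  | @cons a b' b Q hab h ha hu ih =>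
    rw [insert_eq, union_comm]
    refine ih.append (single a) hab.symm ?_ ?_
    · rintro x hx rfl
      exact ha hx
    · rintro x hx _ rfl hxy
      exact ⟨hu x hx hxy.symm, rfl⟩

theorem exists_extend {a b : V} {Q : Set V} (h : IndPath G a b Q) (w : V)
    (hw : ∃ z ∈ Q, w = z ∨ G.Adj w z) : ∃ Q' ⊆ insert w Q, IndPath G w b Q' := by
  induction h with
  | single a =>
    obtain ⟨z, rfl, rfl | hwz⟩ := hw
    · exact ⟨_, subset_insert _ _, single w⟩
    · exact ⟨_, subset_rfl, cons hwz (single z) hwz.ne fun y hy _ => hy⟩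
  | @cons a c b Q hac h ha hu ih =>
    by_cases hQ : ∃ z ∈ Q, w = z ∨ G.Adj w z
    · obtain ⟨Q', hQ', hP⟩ := ih hQ
      exact ⟨Q', hQ'.trans (insert_subset_insert (subset_insert _ _)), hP⟩
    push Not at hQ
    obtain ⟨z, rfl | hz, rfl | hwz⟩ := hw
    · exact ⟨_, subset_insert _ _, cons hac h ha hu⟩
    · refine ⟨_, subset_rfl, cons hwz (cons hac h ha hu) ?_ ?_⟩
      · rintro (hwz' | hwQ)
        · exact hwz.ne hwz'
        · exact (hQ w hwQ).1 rfl
      · rintro y (rfl | hy) hwy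
        · rfl
        · exact absurd hwy (hQ y hy).2
    · exact absurd rfl (hQ w hz).1
    · exact absurd hwz (hQ z hz).2

theorem exists_suffix {a b : V} {Q : Set V} (h : IndPath G a b Q) {z : V} (hz : z ∈ Q) :
    ∃ Q' ⊆ Q, IndPath G z b Q' ∧ (a ∈ Q' → z = a) := by
  induction h with
  | single a =>
    obtain rfl : z = a := hz
    exact ⟨_, subset_rfl, single _, fun _ => rfl⟩
  | @cons a c b Q hac h ha hu ih =>
    rcases hz with rfl | hz
    · exact ⟨_, subset_rfl, cons hac h ha hu, fun _ => rfl⟩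
    · obtain ⟨Q', hQ', hP, -⟩ := ih hz
      exact ⟨Q', hQ'.trans (subset_insert _ _), hP, fun h => absurd (hQ' h) ha⟩

theorem exists_split {a b : V} {Q S : Set V} (h : IndPath G a b Q) (hS : (Q ∩ S).Nonempty) :
    ∃ z Q₁ Q₂, IndPath G a z Q₁ ∧ IndPath G z b Q₂ ∧ Q₁ ∪ Q₂ = Q ∧ Q₁ ∩ S = {z} ∧
      (∀ y ∈ Q₁, y ∈ Q₂ → y = z) ∧ ∀ y ∈ Q₁, ∀ y' ∈ Q₂, G.Adj y y' → y = z ∨ y' = z := by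
  induction h with
  | single a =>
    obtain ⟨z, rfl, hzS⟩ := hS
    exact ⟨_, _, _, single _, single _, union_self _, by simpa using hzS, fun y hy _ => hy,
      fun y hy _ _ _ => Or.inl hy⟩
  | @cons a c b Q hac h ha hu ih =>
    by_cases haS : a ∈ S
    · exact ⟨_, _, _, single a, cons hac h ha hu, by simp, by simpa using haS, fun y hy _ => hy,
        fun y hy _ _ _ => Or.inl hy⟩
    rw [insert_inter_of_notMem haS] at hS
    obtain ⟨z, Q₁, Q₂, h₁, h₂, hQ, hz, hdisj, hadj⟩ := ih hS
    have hQ₁ : Q₁ ⊆ Q := hQ ▸ subset_union_left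
    have hQ₂ : Q₂ ⊆ Q := hQ ▸ subset_union_right
    refine ⟨z, insert a Q₁, Q₂, cons hac h₁ (fun h => ha (hQ₁ h)) fun y hy => hu y (hQ₁ hy), h₂,
      by rw [insert_union, hQ], by rw [insert_inter_of_notMem haS, hz], ?_, ?_⟩
    · rintro y (rfl | hy) hy'
      · exact absurd (hQ₂ hy') ha
      · exact hdisj y hy hy'
    · rintro y (rfl | hy) y' hy' hyy'
      · obtain rfl := hu y' (hQ₂ hy') hyy'
        exact Or.inr (hdisj _ h₁.left_mem hy')
      · exact hadj y hy y' hy' hyy'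

theorem eq_of_subset {a b : V} {Q Q' : Set V} (h : IndPath G a b Q) (h' : IndPath G a b Q')
    (hQ : Q' ⊆ Q) : Q' = Q := by
  induction h generalizing Q' with
  | single a => exact h'.eq_singleton
  | @cons a c b Q hac h ha hu ih =>
    rcases h'.eq_singleton_or_exists_tail with ⟨rfl, -⟩ | ⟨-, c', hac', hP, -⟩
    · exact absurd h.right_mem ha
    have hsub : Q' \ {a} ⊆ Q := by rwa [sdiff_singleton_subset_iff]
    obtain rfl : c' = c := hu c' (hsub hP.left_mem) hac'
    rw [← ih hP hsub, insert_sdiff_singleton, insert_eq_of_mem h'.left_mem]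

end IndPath

theorem Conn.exists_indPath {D : Set V} (hD : Conn G D) {a b : V} (ha : a ∈ D) (hb : b ∈ D) :
    ∃ Q ⊆ D, IndPath G a b Q := by
  have hall : {z ∈ D | ∃ Q ⊆ D, IndPath G z b Q} = D := by
    refine hD.eq_of_isClosedIn ⟨sep_subset _ _, ?_⟩ ⟨b, hb, {b}, by simpa using hb, .single b⟩
    rintro z ⟨_, Q, hQ, hP⟩ w hw hzw
    obtain ⟨Q', hQ', hP'⟩ := hP.exists_extend w ⟨z, hP.left_mem, Or.inr hzw.symm⟩
    exact ⟨hw, Q', hQ'.trans (insert_subset hw hQ), hP'⟩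
  exact (hall.ge ha).2

theorem IndPath.eq_of_conn {a b : V} {Q Q' : Set V} (h : IndPath G a b Q) (hQ' : Conn G Q')
    (hQ : Q' ⊆ Q) (ha : a ∈ Q') (hb : b ∈ Q') : Q' = Q := by
  obtain ⟨R, hR, hP⟩ := hQ'.exists_indPath ha hb
  exact hQ.antisymm (h.eq_of_subset hP (hR.trans hQ) ▸ hR)

/-- `Joins G P P' Q`: the set `Q` is connected and meets both `P` and `P'`. -/
structure Joins (G : SimpleGraph V) (P P' Q : Set V) : Prop where
  conn : Conn G Q
  nonempty_left : (Q ∩ P).Nonempty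
  nonempty_right : (Q ∩ P').Nonempty

theorem Joins.symm {P P' Q : Set V} (h : Joins G P P' Q) : Joins G P' P Q :=
  ⟨h.conn, h.nonempty_right, h.nonempty_left⟩

theorem joins_comm {P P' : Set V} : Joins G P P' = Joins G P' P :=
  funext fun _ => propext ⟨Joins.symm, Joins.symm⟩

theorem IndPath.minimal_joins {P P' Q : Set V} {p q : V} (h : IndPath G p q Q)
    (hp : Q ∩ P = {p}) (hq : Q ∩ P' = {q}) : Minimal (Joins G P P') Q := by
  refine ⟨⟨h.conn, by simp [hp], by simp [hq]⟩, fun Q' ⟨hc, ⟨z, hz, hzP⟩, w, hw, hwP⟩ hQ' => ?_⟩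
  obtain rfl : z = p := hp.le ⟨hQ' hz, hzP⟩
  obtain rfl : w = q := hq.le ⟨hQ' hw, hwP⟩
  exact (h.eq_of_conn hc hQ' hz hw).ge

theorem IndPath.inter_eq_singleton_of_minimal {P P' Q : Set V} {p q : V} (hP : IndPath G p q Q)
    (h : Minimal (Joins G P P') Q) (hp : p ∈ P) (hq : q ∈ P') : Q ∩ P = {p} := by
  refine subset_antisymm ?_ (by simpa using ⟨hP.left_mem, hp⟩)
  rintro z ⟨hzQ, hz⟩
  obtain ⟨R, hR, hPR, heq⟩ := hP.exists_suffix hzQ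
  have hRQ := h.eq_of_subset ⟨hPR.conn, ⟨z, hPR.left_mem, hz⟩, q, hPR.right_mem, hq⟩ hR
  exact heq (hRQ ▸ hP.left_mem)

theorem exists_indPath_of_minimal_joins {P P' Q : Set V} (h : Minimal (Joins G P P') Q) :
    ∃ p q, IndPath G p q Q ∧ Q ∩ P = {p} ∧ Q ∩ P' = {q} := by
  obtain ⟨p, hpQ, hp⟩ := h.prop.nonempty_left
  obtain ⟨q, hqQ, hq⟩ := h.prop.nonempty_right
  obtain ⟨R, hR, hP⟩ := h.prop.conn.exists_indPath hpQ hqQ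
  obtain rfl := h.eq_of_subset ⟨hP.conn, ⟨p, hP.left_mem, hp⟩, q, hP.right_mem, hq⟩ hR
  exact ⟨p, q, hP, hP.inter_eq_singleton_of_minimal h hp hq,
    hP.symm.inter_eq_singleton_of_minimal (joins_comm ▸ h) hq hp⟩

end InducedPaths

section InducedCycles

open SimpleGraph

variable {V : Type*} {G : SimpleGraph V}

theorem pathGraph_adj_zero_succ {n : ℕ} (i : Fin (n + 1)) :
    (pathGraph (n + 2)).Adj 0 i.succ ↔ i = 0 := by
  simp only [pathGraph_adj, Fin.val_zero, Fin.val_succ, Fin.ext_iff]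
  omega

theorem pathGraph_adj_succ_succ {n : ℕ} (i j : Fin n) :
    (pathGraph (n + 1)).Adj i.succ j.succ ↔ (pathGraph n).Adj i j := by
  simp [pathGraph_adj]

theorem val_sub_eq_one_iff {n : ℕ} (i j : Fin (n + 3)) :
    (i - j).val = 1 ↔ i.val = j.val + 1 ∨ (i.val = 0 ∧ j.val = n + 2) := by
  have := i.2
  have := j.2
  rw [Fin.val_sub]
  rcases le_or_gt j.val i.val with h | h
  · rw [show n + 3 - j.val + i.val = (n + 3) + (i.val - j.val) by omega, Nat.add_mod_left,
      Nat.mod_eq_of_lt (by omega)]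
    omega
  · rw [Nat.mod_eq_of_lt (by omega)]
    omega

theorem cycleGraph_adj_zero_succ {n : ℕ} (i : Fin (n + 2)) :
    (cycleGraph (n + 3)).Adj 0 i.succ ↔ i = 0 ∨ i = Fin.last (n + 1) := by
  simp only [cycleGraph_adj', val_sub_eq_one_iff, Fin.val_zero, Fin.val_succ, Fin.ext_iff,
    Fin.val_last, true_and]
  omega

theorem cycleGraph_adj_succ_succ {n : ℕ} (i j : Fin (n + 2)) :
    (cycleGraph (n + 3)).Adj i.succ j.succ ↔ (pathGraph (n + 2)).Adj i j := by
  have hi := i.2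
  have hj := j.2
  simp only [cycleGraph_adj', val_sub_eq_one_iff, pathGraph_adj, Fin.val_succ]
  omega

theorem exists_embedding_cons {n : ℕ} {H : SimpleGraph (Fin n)} {H' : SimpleGraph (Fin (n + 1))}
    (hH : ∀ i j : Fin n, H'.Adj i.succ j.succ ↔ H.Adj i j) (f : H ↪g G) {a : V}
    (ha : a ∉ range f) (hadj : ∀ i, G.Adj a (f i) ↔ H'.Adj 0 i.succ) :
    ∃ g : H' ↪g G, ⇑g = Fin.cons a f := by
  refine ⟨⟨⟨Fin.cons a f, Fin.cons_injective_iff.2 ⟨ha, f.injective⟩⟩, fun {i j} => ?_⟩, rfl⟩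
  cases i using Fin.cases <;> cases j using Fin.cases <;>
    simp [hH, hadj, G.adj_comm _ a, H'.adj_comm _ 0]

theorem IndPath.exists_embedding {a b : V} {Q : Set V} (h : IndPath G a b Q) :
    ∃ (n : ℕ) (f : pathGraph (n + 1) ↪g G), range f = Q ∧ f 0 = a ∧ f (Fin.last n) = b := by
  induction h with
  | single a =>
    exact ⟨0, ⟨⟨fun _ => a, fun i j _ => Subsingleton.elim (α := Fin 1) i j⟩,
      by simp [pathGraph_adj]⟩, range_const, rfl, rfl⟩
  | @cons a c b Q hac h ha hu ih =>
    obtain ⟨n, f, rfl, rfl, rfl⟩ := ih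
    have hadj : ∀ i, G.Adj a (f i) ↔ i = 0 := fun i =>
      ⟨fun hai => f.injective (hu _ (mem_range_self i) hai), fun hi => hi ▸ hac⟩
    obtain ⟨g, hg⟩ := exists_embedding_cons pathGraph_adj_succ_succ f ha fun i =>
      (hadj i).trans (pathGraph_adj_zero_succ i).symm
    exact ⟨n + 1, g, by rw [hg, Fin.range_cons], by rw [hg, Fin.cons_zero],
      by rw [hg, ← Fin.succ_last, Fin.cons_succ]⟩

theorem indPath_of_embedding {n : ℕ} (f : pathGraph (n + 1) ↪g G) :
    IndPath G (f 0) (f (Fin.last n)) (range f) := by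
  induction n with
  | zero => simpa [range_unique] using IndPath.single (f 0)
  | succ n ih =>
    let g : pathGraph (n + 1) ↪g G :=
      ⟨(Fin.succEmb (n + 1)).trans f.toEmbedding, by simp [pathGraph_adj_succ_succ]⟩
    have hrange : range f = insert (f 0) (range g) := by
      rw [← Fin.range_cons]
      exact congrArg range (Fin.cons_self_tail f).symm
    rw [hrange, ← Fin.succ_last]
    refine .cons (f.map_adj_iff.2 ((pathGraph_adj_zero_succ 0).2 rfl)) (ih g) ?_ ?_
    · rintro ⟨i, hi⟩
      exact Fin.succ_ne_zero i (f.injective hi)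
    · rintro _ ⟨i, rfl⟩ hi
      obtain rfl : i = 0 := (pathGraph_adj_zero_succ i).1 (f.map_adj_iff.1 hi)
      rfl

theorem isCycleGraph_induce_iff {A : Set V} :
    IsCycleGraph (G.induce A) ↔ ∃ (n : ℕ) (f : cycleGraph (n + 3) ↪g G), range f = A := by
  constructor
  · rintro ⟨n, hn, ⟨e⟩⟩
    obtain ⟨m, rfl⟩ := Nat.exists_eq_add_of_le' hn
    refine ⟨m, (Embedding.induce A).comp e.symm.toEmbedding, ?_⟩
    exact (e.symm.surjective.range_comp Subtype.val).trans Subtype.range_coe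
  · rintro ⟨n, f, rfl⟩
    exact ⟨n + 3, Nat.le_add_left 3 n, ⟨f.isoInduceRange.symm⟩⟩

theorem exists_rotate_embedding {n : ℕ} (f : cycleGraph (n + 3) ↪g G) (k : Fin (n + 3)) :
    ∃ g : cycleGraph (n + 3) ↪g G, range g = range f ∧ g 0 = f k :=
  ⟨⟨(Equiv.addLeft k).toEmbedding.trans f.toEmbedding, by simp [cycleGraph_adj]⟩,
    (Equiv.addLeft k).surjective.range_comp f, congrArg f (add_zero k)⟩

theorem IndPath.isCycleGraph {p q v : V} {Q : Set V} (h : IndPath G p q Q) (hpq : p ≠ q)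
    (hv : v ∉ Q) (hadj : ∀ z ∈ Q, G.Adj v z ↔ z = p ∨ z = q) :
    IsCycleGraph (G.induce (insert v Q)) := by
  obtain ⟨n, f, rfl, rfl, rfl⟩ := h.exists_embedding
  obtain ⟨n, rfl⟩ := Nat.exists_eq_succ_of_ne_zero (n := n) (by rintro rfl; exact hpq rfl)
  obtain ⟨g, hg⟩ := exists_embedding_cons cycleGraph_adj_succ_succ f hv fun i => by
    rw [hadj _ (mem_range_self i), f.injective.eq_iff, f.injective.eq_iff,
      cycleGraph_adj_zero_succ]
  exact isCycleGraph_induce_iff.2 ⟨n, g, by rw [hg, Fin.range_cons]⟩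

theorem IsCycleGraph.exists_indPath {A : Set V} (h : IsCycleGraph (G.induce A)) {v : V}
    (hv : v ∈ A) : ∃ p q, p ≠ q ∧ IndPath G p q (A \ {v}) ∧
      ∀ z ∈ A, G.Adj v z ↔ z = p ∨ z = q := by
  obtain ⟨n, f, rfl⟩ := isCycleGraph_induce_iff.1 h
  obtain ⟨k, rfl⟩ := hv
  obtain ⟨f, hf, hk⟩ := exists_rotate_embedding f k
  rw [← hf, ← hk]
  let g : pathGraph (n + 2) ↪g G :=
    ⟨(Fin.succEmb (n + 2)).trans f.toEmbedding, by simp [cycleGraph_adj_succ_succ]⟩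
  have hg : f 0 ∉ range g := fun ⟨i, hi⟩ => Fin.succ_ne_zero i (f.injective hi)
  have hrange : range f = insert (f 0) (range g) := by
    rw [← Fin.range_cons]
    exact congrArg range (Fin.cons_self_tail f).symm
  refine ⟨g 0, g (Fin.last _), g.injective.ne (by simp [Fin.ext_iff]), ?_, ?_⟩
  · rw [hrange, insert_sdiff_self_of_notMem hg]
    exact indPath_of_embedding g
  · rw [hrange]
    rintro _ (rfl | ⟨i, rfl⟩)
    · exact iff_of_false G.irrefl fun h => h.elim (fun h => hg ⟨_, h.symm⟩) fun h => hg ⟨_, h.symm⟩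
    · rw [g.injective.eq_iff, g.injective.eq_iff, ← cycleGraph_adj_zero_succ]
      exact f.map_adj_iff

theorem IsCycleGraph.conn {A : Set V} (h : IsCycleGraph (G.induce A)) : Conn G A := by
  obtain ⟨n, hn, ⟨e⟩⟩ := h
  obtain ⟨m, rfl⟩ := Nat.exists_eq_add_of_le' hn
  exact e.connected_iff.2 cycleGraph_connected

/-- The set `Q` completes the edge `vx` to an induced cycle. -/
structure IsConnector (G : SimpleGraph V) (v x : V) (Q : Set V) : Prop where
  minimal : Minimal (Joins G (G.neighborSet v) (G.neighborSet x)) Q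
  notMem_left : v ∉ Q
  notMem_right : x ∉ Q

theorem IsConnector.joins {v x : V} {Q : Set V} (h : IsConnector G v x Q) :
    Joins G (G.neighborSet v) (G.neighborSet x) Q :=
  h.minimal.prop

theorem IsConnector.eq_of_subset {v x : V} {Q Q' : Set V} (h : IsConnector G v x Q)
    (h' : IsConnector G v x Q') (hQ : Q' ⊆ Q) : Q' = Q :=
  h.minimal.eq_of_subset h'.joins hQ

theorem isConnector_comm {v x : V} {Q : Set V} : IsConnector G v x Q ↔ IsConnector G x v Q := by
  have {v x : V} (h : IsConnector G v x Q) : IsConnector G x v Q :=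
    ⟨joins_comm ▸ h.minimal, h.notMem_right, h.notMem_left⟩
  exact ⟨this, this⟩

theorem inter_neighborSet_eq_singleton_iff {Q : Set V} {v p : V} (hp : p ∈ Q) :
    Q ∩ G.neighborSet v = {p} ↔ ∀ z ∈ Q, G.Adj v z ↔ z = p := by
  simp only [Set.ext_iff, mem_inter_iff, mem_neighborSet, mem_singleton_iff]
  exact ⟨fun h z hz => by simpa [hz] using h z, fun h z =>
    ⟨fun hz => (h z hz.1).1 hz.2, fun hz => ⟨hz ▸ hp, (h z (hz ▸ hp)).2 hz⟩⟩⟩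

theorem IsConnector.exists_indPath {v x : V} {Q : Set V} (h : IsConnector G v x Q) :
    ∃ p q, IndPath G p q Q ∧ (∀ z ∈ Q, G.Adj v z ↔ z = p) ∧ (∀ z ∈ Q, G.Adj x z ↔ z = q) := by
  obtain ⟨p, q, hP, hp, hq⟩ := exists_indPath_of_minimal_joins h.minimal
  exact ⟨p, q, hP, (inter_neighborSet_eq_singleton_iff hP.left_mem).1 hp,
    (inter_neighborSet_eq_singleton_iff hP.right_mem).1 hq⟩

theorem IsConnector.isCycleGraph {v x : V} {Q : Set V} (h : IsConnector G v x Q)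
    (hvx : G.Adj v x) : IsCycleGraph (G.induce (insert v (insert x Q))) := by
  obtain ⟨p, q, hP, hp, hq⟩ := h.exists_indPath
  have hxP : IndPath G x p (insert x Q) :=
    .cons ((hq q hP.right_mem).2 rfl) hP.symm h.notMem_right fun z hz => (hq z hz).1
  refine hxP.isCycleGraph (fun hxp => h.notMem_right (hxp ▸ hP.left_mem)) ?_ ?_
  · rintro (rfl | hv)
    · exact G.irrefl hvx
    · exact h.notMem_left hv
  · rintro z (rfl | hz)
    · simp [hvx]
    · rw [hp z hz]
      exact ⟨Or.inr, fun h' => h'.resolve_left fun hzx => h.notMem_right (hzx ▸ hz)⟩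

theorem Joins.exists_isConnector_subset [Finite V] {v x : V} {E : Set V}
    (hE : Joins G (G.neighborSet v) (G.neighborSet x) E) (hv : v ∉ E) (hx : x ∉ E) :
    ∃ Q ⊆ E, IsConnector G v x Q := by
  obtain ⟨Q, hQ, h⟩ :=
    (toFinite {Q | Joins G (G.neighborSet v) (G.neighborSet x) Q}).exists_le_minimal hE
  exact ⟨Q, hQ, h, fun h => hv (hQ h), fun h => hx (hQ h)⟩

theorem IsCycleGraph.isConnector {A : Set V} (h : IsCycleGraph (G.induce A)) {v x : V}
    (hv : v ∈ A) (hx : x ∈ A) (hvx : G.Adj v x) : IsConnector G v x (A \ {v, x}) := by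
  obtain ⟨q, hqx, hP, hadj⟩ : ∃ q, x ≠ q ∧ IndPath G x q (A \ {v}) ∧
      ∀ z ∈ A, G.Adj v z ↔ z = x ∨ z = q := by
    obtain ⟨p, q, hpq, hP, hadj⟩ := h.exists_indPath hv
    rcases (hadj x hx).1 hvx with rfl | rfl
    · exact ⟨q, hpq, hP, hadj⟩
    · exact ⟨p, hpq.symm, hP.symm, fun z hz => (hadj z hz).trans or_comm⟩
  obtain ⟨-, c, hxc, hcq, huniq⟩ := hP.eq_singleton_or_exists_tail.resolve_left fun h => hqx h.1
  rw [sdiff_sdiff, union_singleton, pair_comm] at hcq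
  refine ⟨hcq.symm.minimal_joins ?_ ?_, by simp, by simp⟩
  · refine (inter_neighborSet_eq_singleton_iff hcq.right_mem).2 fun z hz => ?_
    exact (hadj z hz.1).trans (or_iff_right fun hzx => hz.2 (Or.inr hzx))
  · refine (inter_neighborSet_eq_singleton_iff hcq.left_mem).2 fun z hz => ?_
    exact ⟨huniq z ⟨hz.1, fun hzv => hz.2 (Or.inl hzv)⟩, fun hzc => hzc ▸ hxc⟩

end InducedCycles

/-! ### Solids and connectors -/

section Solids

variable {V : Type*} {G : SimpleGraph V}

theorem IsCycleGraph.of_iso {W W' : Type*} {H : SimpleGraph W} {H' : SimpleGraph W'}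
    (h : IsCycleGraph H) (e : H' ≃g H) : IsCycleGraph H' := by
  obtain ⟨n, hn, ⟨f⟩⟩ := h
  exact ⟨n, hn, ⟨e.trans f⟩⟩

theorem isPyramid_insert {C : Set V} {w : V} (hC : IsCycleGraph (G.induce C)) (hw : w ∉ C)
    {a b c : V} (ha : a ∈ C) (hb : b ∈ C) (hc : c ∈ C) (hab : a ≠ b) (hac : a ≠ c) (hbc : b ≠ c)
    (hwa : G.Adj w a) (hwb : G.Adj w b) (hwc : G.Adj w c) :
    IsPyramid (G.induce (insert w C)) := by
  refine ⟨⟨w, Or.inl rfl⟩, hC.of_iso ?_, ?_⟩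
  · have hmem : ∀ z : (insert w C : Set V), z ∈ ({⟨w, Or.inl rfl⟩}ᶜ : Set _) ↔ z.1 ∈ C := by
      rintro ⟨z, rfl | hz⟩
      · simp [hw]
      · simpa [hz, Subtype.ext_iff] using fun hzw : z = w => hw (hzw ▸ hz)
    exact ⟨⟨fun z => ⟨z.1.1, (hmem z.1).1 z.2⟩, fun z => ⟨⟨z.1, Or.inr z.2⟩, (hmem _).2 z.2⟩,
      fun _ => rfl, fun _ => rfl⟩, by simp⟩
  · have hsub : ({⟨a, Or.inr ha⟩, ⟨b, Or.inr hb⟩, ⟨c, Or.inr hc⟩} : Set (insert w C : Set V)) ⊆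
        (G.induce (insert w C)).neighborSet ⟨w, Or.inl rfl⟩ := by
      rintro z (rfl | rfl | rfl) <;> simpa
    refine le_trans ?_ (encard_le_encard hsub)
    rw [encard_insert_of_notMem (by simp [Subtype.ext_iff, hab, hac]),
      encard_pair (fun h => hbc (congrArg Subtype.val h))]
    norm_num

theorem IndPath.exists_walk {a b : V} {Q A : Set V} (h : IndPath G a b Q) (hQ : Q ⊆ A) :
    ∃ w : (G.induce A).Walk ⟨a, hQ h.left_mem⟩ ⟨b, hQ h.right_mem⟩, w.IsPath ∧
      (∀ z, z ∈ w.support ↔ z.1 ∈ Q) ∧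
      ∀ y z : A, y.1 ∈ Q → z.1 ∈ Q → G.Adj y z → w.toSubgraph.Adj y z := by
  induction h with
  | single a =>
    refine ⟨.nil, by simp, fun z => by simp [Subtype.ext_iff], ?_⟩
    rintro ⟨y, hyA⟩ ⟨z, hzA⟩ rfl rfl hyz
    exact absurd hyz G.irrefl
  | @cons a c b Q hac h ha hu ih =>
    obtain ⟨w, hw, hs, he⟩ := ih ((subset_insert _ _).trans hQ)
    have haA : a ∈ A := hQ (mem_insert _ _)
    have hcA : c ∈ A := hQ (Or.inr h.left_mem)
    have hadj : (G.induce A).Adj ⟨a, haA⟩ ⟨c, hcA⟩ := by simpa using hac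
    refine ⟨.cons hadj w, ?_, fun z => ?_, fun y z hy hz hyz => ?_⟩
    · exact (SimpleGraph.Walk.cons_isPath_iff _ _).2 ⟨hw, fun haw => ha ((hs _).1 haw)⟩
    · rw [SimpleGraph.Walk.support_cons, List.mem_cons, hs, mem_insert_iff, Subtype.ext_iff]
    · simp only [SimpleGraph.Walk.toSubgraph, SimpleGraph.Subgraph.sup_adj,
        SimpleGraph.subgraphOfAdj_adj]
      obtain ⟨y, hyA⟩ := y
      obtain ⟨z, hzA⟩ := z
      rcases hy with rfl | hy <;> rcases hz with rfl | hz
      · exact absurd hyz G.irrefl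
      · obtain rfl := hu _ hz hyz
        exact Or.inl rfl
      · obtain rfl := hu _ hy hyz.symm
        exact Or.inl Sym2.eq_swap
      · exact Or.inr (he _ _ hy hz hyz)

section Paths

variable {P : Fin 3 → Set V}

theorem sup_iSup_toSubgraph_eq_top {a b : Fin 3 → (⋃ i, P i : Set V)}
    {w : ∀ i, (G.induce (⋃ i, P i)).Walk (a i) (b i)} (S : (G.induce (⋃ i, P i)).Subgraph)
    (hs : ∀ i z, z ∈ (w i).support ↔ z.1 ∈ P i)
    (he : ∀ i (y z : (⋃ i, P i : Set V)), y.1 ∈ P i → z.1 ∈ P i → G.Adj y z →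
      (w i).toSubgraph.Adj y z)
    (hS : ∀ i j, i ≠ j → ∀ y z : (⋃ i, P i : Set V), y.1 ∈ P i → z.1 ∈ P j → G.Adj y z →
      S.Adj y z ∨ ∃ k, y.1 ∈ P k ∧ z.1 ∈ P k) :
    S ⊔ ⨆ i, (w i).toSubgraph = ⊤ := by
  refine eq_top_iff.2 ⟨fun z _ => ?_, fun y z hyz => ?_⟩
  · obtain ⟨i, hi⟩ := mem_iUnion.1 z.2
    rw [SimpleGraph.Subgraph.verts_sup, SimpleGraph.Subgraph.verts_iSup]
    exact Or.inr (mem_iUnion.2 ⟨i, (SimpleGraph.Walk.mem_verts_toSubgraph _).2 ((hs i z).2 hi)⟩)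
  · have hyz' : G.Adj y z := by simpa using hyz
    rw [SimpleGraph.Subgraph.sup_adj, SimpleGraph.Subgraph.iSup_adj]
    obtain ⟨i, hi⟩ := mem_iUnion.1 y.2
    obtain ⟨j, hj⟩ := mem_iUnion.1 z.2
    rcases eq_or_ne i j with rfl | hij
    · exact Or.inr ⟨i, he i y z hi hj hyz'⟩
    · exact (hS i j hij y z hi hj hyz').imp_right fun ⟨k, hk, hk'⟩ => ⟨k, he k y z hk hk' hyz'⟩

theorem isTrihedron_iUnion {a b : V} (hab : a ≠ b) (hnab : ¬ G.Adj a b)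
    (hP : ∀ i, IndPath G a b (P i)) (hdis : ∀ i j, i ≠ j → ∀ z ∈ P i, z ∈ P j → z = a ∨ z = b)
    (hE : ∀ i j, i ≠ j → ∀ y ∈ P i, ∀ z ∈ P j, G.Adj y z → ∃ k, y ∈ P k ∧ z ∈ P k) :
    IsTrihedron (G.induce (⋃ i, P i)) := by
  choose w hw hs he using fun i => (hP i).exists_walk (subset_iUnion P i)
  refine ⟨⟨a, mem_iUnion.2 ⟨0, (hP 0).left_mem⟩⟩, ⟨b, mem_iUnion.2 ⟨0, (hP 0).right_mem⟩⟩, w,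
    fun h => hab (congrArg Subtype.val h), fun i => ⟨hw i, ?_⟩, fun i j hij z hz hz' => ?_, ?_⟩
  · by_contra! hlt
    obtain h | h : (w i).length = 0 ∨ (w i).length = 1 := by omega
    · exact hab (congrArg Subtype.val (SimpleGraph.Walk.eq_of_length_eq_zero h))
    · exact hnab (by simpa using SimpleGraph.Walk.adj_of_length_eq_one h)
  · exact (hdis i j hij z ((hs i z).1 hz) ((hs j z).1 hz')).imp Subtype.ext Subtype.ext
  · rw [← bot_sup_eq (⨆ i, (w i).toSubgraph)]
    exact sup_iSup_toSubgraph_eq_top ⊥ hs he fun i j hij y z hy hz hyz =>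
      Or.inr (hE i j hij y hy z hz hyz)

theorem isStamp_iUnion {t : Fin 3 → V} {b : V} (ht : ∀ i j, i ≠ j → G.Adj (t i) (t j))
    (htb : ∀ i, t i ≠ b) (hP : ∀ i, IndPath G (t i) b (P i))
    (hdis : ∀ i j, i ≠ j → ∀ z ∈ P i, z ∈ P j → z = b)
    (hE : ∀ i j, i ≠ j → ∀ y ∈ P i, ∀ z ∈ P j, G.Adj y z →
      (∃ k, y ∈ P k ∧ z ∈ P k) ∨ (y = t i ∧ z = t j)) :
    IsStamp (G.induce (⋃ i, P i)) := by
  choose w hw hs he using fun i => (hP i).exists_walk (subset_iUnion P i)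
  refine ⟨fun i => ⟨t i, mem_iUnion.2 ⟨i, (hP i).left_mem⟩⟩,
    ⟨b, mem_iUnion.2 ⟨0, (hP 0).right_mem⟩⟩, w, fun i j hij => by simpa using ht i j hij,
    fun i => ⟨hw i, Nat.one_le_iff_ne_zero.2 fun h => ?_⟩, fun i j hij z hz hz' => ?_, ?_⟩
  · exact htb i (congrArg Subtype.val (SimpleGraph.Walk.eq_of_length_eq_zero h))
  · exact Subtype.ext (hdis i j hij z ((hs i z).1 hz) ((hs j z).1 hz'))
  · refine sup_iSup_toSubgraph_eq_top _ hs he fun i j hij y z hy hz hyz => ?_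
    refine (hE i j hij y hy z hz hyz).symm.imp_left fun h => ?_
    exact ⟨⟨i, Subtype.ext h.1.symm⟩, ⟨j, Subtype.ext h.2.symm⟩, hyz⟩

theorem isPrism_iUnion {s t : Fin 3 → V} (hs : ∀ i j, i ≠ j → G.Adj (s i) (s j))
    (ht : ∀ i j, i ≠ j → G.Adj (t i) (t j)) (hst : ∀ i, s i ≠ t i)
    (hP : ∀ i, IndPath G (s i) (t i) (P i)) (hdis : ∀ i j, i ≠ j → ∀ z ∈ P i, z ∉ P j)
    (hE : ∀ i j, i ≠ j → ∀ y ∈ P i, ∀ z ∈ P j, G.Adj y z →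
      (y = s i ∧ z = s j) ∨ (y = t i ∧ z = t j)) :
    IsPrism (G.induce (⋃ i, P i)) := by
  choose w hw hsup he using fun i => (hP i).exists_walk (subset_iUnion P i)
  refine ⟨fun i => ⟨s i, mem_iUnion.2 ⟨i, (hP i).left_mem⟩⟩,
    fun i => ⟨t i, mem_iUnion.2 ⟨i, (hP i).right_mem⟩⟩, w, fun i j hij => by simpa using hs i j hij,
    fun i j hij => by simpa using ht i j hij, fun i j h => ?_, hw, fun i j hij z hz hz' => ?_, ?_⟩
  · have hij : s i = t j := congrArg Subtype.val h
    rcases eq_or_ne i j with rfl | hne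
    · exact hst i hij
    · exact hdis i j hne _ (hP i).left_mem (hij ▸ (hP j).right_mem)
  · exact hdis i j hij z ((hsup i z).1 hz) ((hsup j z).1 hz')
  · refine sup_iSup_toSubgraph_eq_top _ hsup he fun i j hij y z hy hz hyz => Or.inl ?_
    refine (hE i j hij y hy z hz hyz).imp (fun h => ?_) fun h => ?_ <;>
      exact ⟨⟨i, Subtype.ext h.1.symm⟩, ⟨j, Subtype.ext h.2.symm⟩, hyz⟩

theorem forall_ne_of_symm {R : Fin 3 → Fin 3 → Prop} (hR : ∀ i j, R i j → R j i) (h01 : R 0 1)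
    (h02 : R 0 2) (h12 : R 1 2) (i j : Fin 3) (hij : i ≠ j) : R i j := by
  fin_cases i <;> fin_cases j <;> first | exact absurd rfl hij | assumption | (apply hR; assumption)

theorem iUnion_fin_three (P : Fin 3 → Set V) : ⋃ i, P i = P 0 ∪ (P 1 ∪ P 2) := by
  ext z
  simp [Fin.exists_fin_succ]

end Paths

section ThreePaths

variable {P₀ P₁ P₂ : Set V}

theorem isTrihedron_union {a b : V} (hab : a ≠ b) (hnab : ¬ G.Adj a b) (h₀ : IndPath G a b P₀)
    (h₁ : IndPath G a b P₁) (h₂ : IndPath G a b P₂)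
    (r₀₁ : ∀ y ∈ P₀, ∀ z ∈ P₁, (y = z → y = a ∨ y = b) ∧ (G.Adj y z → y ∈ P₁ ∨ z ∈ P₀))
    (r₀₂ : ∀ y ∈ P₀, ∀ z ∈ P₂, (y = z → y = a ∨ y = b) ∧ (G.Adj y z → y ∈ P₂ ∨ z ∈ P₀))
    (r₁₂ : ∀ y ∈ P₁, ∀ z ∈ P₂, (y = z → y = a ∨ y = b) ∧ (G.Adj y z → y ∈ P₂ ∨ z ∈ P₁)) :
    IsTrihedron (G.induce (P₀ ∪ (P₁ ∪ P₂))) := by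
  have hr := forall_ne_of_symm (R := fun i j => ∀ y ∈ ![P₀, P₁, P₂] i, ∀ z ∈ ![P₀, P₁, P₂] j,
    (y = z → y = a ∨ y = b) ∧ (G.Adj y z → y ∈ ![P₀, P₁, P₂] j ∨ z ∈ ![P₀, P₁, P₂] i))
    (fun i j h y hy z hz => ⟨fun hyz => hyz ▸ (h z hz y hy).1 hyz.symm,
      fun hyz => ((h z hz y hy).2 hyz.symm).symm⟩) r₀₁ r₀₂ r₁₂
  have := isTrihedron_iUnion (P := ![P₀, P₁, P₂]) hab hnab
    (fun i => by fin_cases i <;> assumption)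
    (fun i j hij z hz hz' => (hr i j hij z hz z hz').1 rfl)
    (fun i j hij y hy z hz hyz => ((hr i j hij y hy z hz).2 hyz).elim (fun h => ⟨j, h, hz⟩)
      fun h => ⟨i, hy, h⟩)
  rwa [iUnion_fin_three] at this

theorem isStamp_union {t₀ t₁ t₂ b : V} (h₀ : IndPath G t₀ b P₀) (h₁ : IndPath G t₁ b P₁)
    (h₂ : IndPath G t₂ b P₂) (n₀ : t₀ ≠ b) (n₁ : t₁ ≠ b) (n₂ : t₂ ≠ b) (t₀₁ : G.Adj t₀ t₁)
    (t₀₂ : G.Adj t₀ t₂) (t₁₂ : G.Adj t₁ t₂)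
    (r₀₁ : ∀ y ∈ P₀, ∀ z ∈ P₁, (y = z → y = b) ∧
      (G.Adj y z → (y ∈ P₁ ∨ z ∈ P₀) ∨ (y = t₀ ∧ z = t₁)))
    (r₀₂ : ∀ y ∈ P₀, ∀ z ∈ P₂, (y = z → y = b) ∧
      (G.Adj y z → (y ∈ P₂ ∨ z ∈ P₀) ∨ (y = t₀ ∧ z = t₂)))
    (r₁₂ : ∀ y ∈ P₁, ∀ z ∈ P₂, (y = z → y = b) ∧
      (G.Adj y z → (y ∈ P₂ ∨ z ∈ P₁) ∨ (y = t₁ ∧ z = t₂))) :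
    IsStamp (G.induce (P₀ ∪ (P₁ ∪ P₂))) := by
  have ht := forall_ne_of_symm (R := fun i j => G.Adj (![t₀, t₁, t₂] i) (![t₀, t₁, t₂] j))
    (fun i j h => h.symm) t₀₁ t₀₂ t₁₂
  have hr := forall_ne_of_symm (R := fun i j => ∀ y ∈ ![P₀, P₁, P₂] i, ∀ z ∈ ![P₀, P₁, P₂] j,
    (y = z → y = b) ∧ (G.Adj y z → (y ∈ ![P₀, P₁, P₂] j ∨ z ∈ ![P₀, P₁, P₂] i) ∨
      (y = ![t₀, t₁, t₂] i ∧ z = ![t₀, t₁, t₂] j)))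
    (fun i j h y hy z hz => ⟨fun hyz => hyz ▸ (h z hz y hy).1 hyz.symm,
      fun hyz => ((h z hz y hy).2 hyz.symm).imp Or.symm And.symm⟩) r₀₁ r₀₂ r₁₂
  have := isStamp_iUnion (P := ![P₀, P₁, P₂]) (t := ![t₀, t₁, t₂]) (b := b) ht
    (fun i => by fin_cases i <;> assumption) (fun i => by fin_cases i <;> assumption)
    (fun i j hij z hz hz' => (hr i j hij z hz z hz').1 rfl)
    (fun i j hij y hy z hz hyz => ((hr i j hij y hy z hz).2 hyz).imp_left fun h =>
      h.elim (fun h => ⟨j, h, hz⟩) fun h => ⟨i, hy, h⟩)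
  rwa [iUnion_fin_three] at this

theorem isPrism_union {s₀ s₁ s₂ t₀ t₁ t₂ : V} (h₀ : IndPath G s₀ t₀ P₀)
    (h₁ : IndPath G s₁ t₁ P₁) (h₂ : IndPath G s₂ t₂ P₂) (n₀ : s₀ ≠ t₀) (n₁ : s₁ ≠ t₁)
    (n₂ : s₂ ≠ t₂) (s₀₁ : G.Adj s₀ s₁) (s₀₂ : G.Adj s₀ s₂) (s₁₂ : G.Adj s₁ s₂) (t₀₁ : G.Adj t₀ t₁)
    (t₀₂ : G.Adj t₀ t₂) (t₁₂ : G.Adj t₁ t₂)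
    (r₀₁ : ∀ y ∈ P₀, ∀ z ∈ P₁, y ≠ z ∧ (G.Adj y z → (y = s₀ ∧ z = s₁) ∨ (y = t₀ ∧ z = t₁)))
    (r₀₂ : ∀ y ∈ P₀, ∀ z ∈ P₂, y ≠ z ∧ (G.Adj y z → (y = s₀ ∧ z = s₂) ∨ (y = t₀ ∧ z = t₂)))
    (r₁₂ : ∀ y ∈ P₁, ∀ z ∈ P₂, y ≠ z ∧ (G.Adj y z → (y = s₁ ∧ z = s₂) ∨ (y = t₁ ∧ z = t₂))) :
    IsPrism (G.induce (P₀ ∪ (P₁ ∪ P₂))) := by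
  have hs := forall_ne_of_symm (R := fun i j => G.Adj (![s₀, s₁, s₂] i) (![s₀, s₁, s₂] j))
    (fun i j h => h.symm) s₀₁ s₀₂ s₁₂
  have ht := forall_ne_of_symm (R := fun i j => G.Adj (![t₀, t₁, t₂] i) (![t₀, t₁, t₂] j))
    (fun i j h => h.symm) t₀₁ t₀₂ t₁₂
  have hr := forall_ne_of_symm (R := fun i j => ∀ y ∈ ![P₀, P₁, P₂] i, ∀ z ∈ ![P₀, P₁, P₂] j,
    y ≠ z ∧ (G.Adj y z → (y = ![s₀, s₁, s₂] i ∧ z = ![s₀, s₁, s₂] j) ∨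
      (y = ![t₀, t₁, t₂] i ∧ z = ![t₀, t₁, t₂] j)))
    (fun i j h y hy z hz => ⟨(h z hz y hy).1.symm,
      fun hyz => ((h z hz y hy).2 hyz.symm).imp And.symm And.symm⟩) r₀₁ r₀₂ r₁₂
  have := isPrism_iUnion (P := ![P₀, P₁, P₂]) hs ht
    (fun i => by fin_cases i <;> assumption) (fun i => by fin_cases i <;> assumption)
    (fun i j hij z hz hz' => (hr i j hij z hz z hz').1 rfl)
    (fun i j hij y hy z hz hyz => (hr i j hij y hy z hz).2 hyz)
  rwa [iUnion_fin_three] at this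

end ThreePaths

theorem IndPath.isCycleGraph_union {u w p q : V} {E A : Set V} (hE : IndPath G u w E)
    (hA : IndPath G p q A) (huw : u ≠ w) (hd : ∀ z ∈ A, z ∉ E)
    (hadj : ∀ y ∈ E, ∀ z ∈ A, G.Adj y z ↔ (y = u ∧ z = p) ∨ (y = w ∧ z = q)) :
    IsCycleGraph (G.induce (E ∪ A)) := by
  obtain ⟨-, c, huc, hP, hc⟩ := hE.eq_singleton_or_exists_tail.resolve_left fun h => huw h.1
  have hcp : IndPath G c p (E \ {u} ∪ A) := by
    refine hP.append hA.symm ((hadj w hE.right_mem q hA.right_mem).2 (Or.inr ⟨rfl, rfl⟩))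
      (fun z hz hzA => hd z hzA hz.1) fun y hy z hz hyz => ?_
    exact ((hadj y hy.1 z hz).1 hyz).resolve_left fun h => hy.2 h.1
  have hcycle := hcp.isCycleGraph (v := u) (fun h => hd p hA.left_mem (h ▸ hP.left_mem.1)) ?_ ?_
  · rwa [← insert_union, insert_sdiff_singleton, insert_eq_of_mem hE.left_mem] at hcycle
  · rintro (h | h)
    · exact h.2 rfl
    · exact hd u h hE.left_mem
  · rintro z (hz | hz)
    · refine ⟨fun h => Or.inl (hc z hz.1 h), ?_⟩
      rintro (rfl | rfl)
      · exact huc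
      · exact absurd hz.1 (hd _ hA.left_mem)
    · rw [hadj u hE.left_mem z hz]
      refine ⟨fun h => h.elim (fun h => Or.inr h.2) fun h => absurd h.1 huw, ?_⟩
      rintro (rfl | rfl)
      · exact absurd hP.left_mem.1 (hd _ hz)
      · exact Or.inl ⟨rfl, rfl⟩

end Solids

section Linked

variable {V : Type*} {G : SimpleGraph V} {v x : V}

/-- Connectors in `D` are linked if they are joined by a chain of connectors such that any two
consecutive ones lie in a common proper connected subset of `D`. -/
def Linked (G : SimpleGraph V) (v x : V) (D : Set V) : Set V → Set V → Prop :=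
  Relation.EqvGen fun Q Q' => IsConnector G v x Q ∧ IsConnector G v x Q' ∧
    ∃ E, E ⊂ D ∧ Conn G E ∧ Q ⊆ E ∧ Q' ⊆ E

theorem Linked.symm {D Q Q' : Set V} (h : Linked G v x D Q Q') : Linked G v x D Q' Q :=
  Relation.EqvGen.symm _ _ h

theorem Linked.swap {D Q Q' : Set V} (h : Linked G v x D Q Q') : Linked G x v D Q Q' := by
  simpa only [Linked, isConnector_comm (v := v)] using h

theorem linked_of_subset {D E Q Q' : Set V} (hQ : IsConnector G v x Q)
    (hQ' : IsConnector G v x Q') (hED : E ⊂ D) (hE : Conn G E) (h : Q ⊆ E) (h' : Q' ⊆ E) :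
    Linked G v x D Q Q' :=
  Relation.EqvGen.rel _ _ ⟨hQ, hQ', E, hED, hE, h, h'⟩

theorem linked_of_subset_inter [Finite V] {D E₁ E₂ E₃ Q₁ Q₂ : Set V} (hQ₁ : IsConnector G v x Q₁)
    (hQ₂ : IsConnector G v x Q₂) (hv : v ∉ D) (hx : x ∉ D) (h₁ : E₁ ⊂ D) (h₂ : E₂ ⊂ D)
    (c₁ : Conn G E₁) (c₂ : Conn G E₂) (hE₃ : Joins G (G.neighborSet v) (G.neighborSet x) E₃)
    (s₁ : Q₁ ⊆ E₁) (s₂ : Q₂ ⊆ E₂) (s₃ : E₃ ⊆ E₁ ∩ E₂) : Linked G v x D Q₁ Q₂ := by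
  obtain ⟨Q, hQ, h⟩ := hE₃.exists_isConnector_subset (fun h => hv (h₁.subset (s₃ h).1))
    (fun h => hx (h₁.subset (s₃ h).1))
  exact Relation.EqvGen.trans _ _ _
    (linked_of_subset hQ₁ h h₁ c₁ s₁ (hQ.trans (s₃.trans inter_subset_left)))
    (linked_of_subset h hQ₂ h₂ c₂ (hQ.trans (s₃.trans inter_subset_right)) s₂)

theorem exists_fin_three_of_forall_exists_ne {A B : Fin 3 → Prop} (hA : ∀ i, ∃ j, j ≠ i ∧ A j)
    (hB : ∀ i, ∃ j, j ≠ i ∧ B j) : ∃ i, A i ∧ B i := by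
  have key : ∀ j j' k k' : Fin 3, j' ≠ j → k' ≠ k → j = k ∨ j = k' ∨ j' = k ∨ j' = k' := by decide
  obtain ⟨j, -, hj⟩ := hA 0
  obtain ⟨j', hjj, hj'⟩ := hA j
  obtain ⟨k, -, hk⟩ := hB 0
  obtain ⟨k', hkk, hk'⟩ := hB k
  rcases key j j' k k' hjj hkk with rfl | rfl | rfl | rfl
  exacts [⟨_, hj, hk⟩, ⟨_, hj, hk'⟩, ⟨_, hj', hk⟩, ⟨_, hj', hk'⟩]

/-- `Reaches G D N d i`: the vertex `d i` can be reached from the vertices in `N` inside `D` without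
meeting another one of the vertices `d j`. -/
def Reaches {ι : Type*} (G : SimpleGraph V) (D N : Set V) (d : ι → V) (i : ι) : Prop :=
  ∃ Y ⊆ D, Conn G Y ∧ (Y ∩ N).Nonempty ∧ Y ∩ range d = {d i}

theorem IndPath.exists_reaches {ι : Type*} {p q : V} {D N Q : Set V} {d : ι → V}
    (hQ : IndPath G p q Q) (hQD : Q ⊆ D) (hp : p ∈ N) (hd : (Q ∩ range d).Nonempty) :
    ∃ i, d i ∈ Q ∧ Reaches G D N d i := by
  obtain ⟨z, Y, Y', hY, -, hYY', hz, -⟩ := hQ.exists_split hd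
  have hYQ : Y ⊆ Q := hYY' ▸ subset_union_left
  obtain ⟨i, rfl⟩ : z ∈ range d := (hz ▸ rfl : z ∈ Y ∩ range d).2
  exact ⟨i, hYQ hY.right_mem, Y, hYQ.trans hQD, hY.conn, ⟨p, hY.left_mem, hp⟩, hz⟩

theorem Reaches.exists_joins {ι : Type*} {D N N' : Set V} {d : ι → V} {i : ι}
    (h : Reaches G D N d i) (h' : Reaches G D N' d i) :
    ∃ E ⊆ D, Joins G N N' E ∧ ∀ j, d j ∈ E → d j = d i := by
  obtain ⟨Y, hY, hYc, hYN, hYi⟩ := h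
  obtain ⟨Z, hZ, hZc, hZN, hZi⟩ := h'
  have hiY : d i ∈ Y := (hYi ▸ rfl : d i ∈ Y ∩ range d).1
  have hiZ : d i ∈ Z := (hZi ▸ rfl : d i ∈ Z ∩ range d).1
  refine ⟨Y ∪ Z, union_subset hY hZ, ⟨hYc.union hZc ⟨d i, hiY, d i, hiZ, Or.inl rfl⟩,
    hYN.mono (inter_subset_inter_left _ subset_union_left),
    hZN.mono (inter_subset_inter_left _ subset_union_right)⟩, ?_⟩
  rintro j (hj | hj)
  · exact hYi.subset ⟨hj, j, rfl⟩
  · exact hZi.subset ⟨hj, j, rfl⟩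

theorem linked_of_notMem [Finite V] {D E Q Q' : Set V} {d d' : V} (hQ : IsConnector G v x Q)
    (hQ' : IsConnector G v x Q') (hv : v ∉ D) (hx : x ∉ D) (hd : d ∈ D) (hd' : d' ∈ D)
    (hc : Conn G (D \ {d})) (hc' : Conn G (D \ {d'})) (hQd : Q ⊆ D \ {d}) (hQd' : Q' ⊆ D \ {d'})
    (hED : E ⊆ D) (hE : Joins G (G.neighborSet v) (G.neighborSet x) E) (hdE : d ∉ E)
    (hdE' : d' ∉ E) : Linked G v x D Q Q' :=
  linked_of_subset_inter hQ hQ' hv hx (sdiff_singleton_ssubset.2 hd) (sdiff_singleton_ssubset.2 hd')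
    hc hc' hE hQd hQd' (subset_inter (subset_sdiff_singleton hED hdE)
      (subset_sdiff_singleton hED hdE'))

/- Delete from `D` a non-cut vertex `d i` outside each `Q i`. If no two of the connectors are
linked, then a connected set meeting both neighbourhoods avoids at most one `d i`; so no `d i` is
reached from both ends, while each end reaches at least two of the three vertices `d i`. -/
theorem exists_linked_of_three [Finite V] {D : Set V} (hD : Conn G D) (hv : v ∉ D) (hx : x ∉ D)
    (Q : Fin 3 → Set V) (hQ : ∀ i, IsConnector G v x (Q i)) (hQD : ∀ i, Q i ⊆ D) :
    ∃ i j, i ≠ j ∧ Linked G v x D (Q i) (Q j) := by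
  by_contra! hcon
  have hss : ∀ i, Q i ⊂ D := fun i => by
    refine (hQD i).ssubset_of_ne fun h => ?_
    obtain ⟨j, hj⟩ : ∃ j, j ≠ i := exists_ne i
    have := (hQ i).eq_of_subset (hQ j) (h ▸ hQD j)
    exact hcon j i hj (this ▸ Relation.EqvGen.refl _)
  choose d hdD hdQ hd using fun i => hD.exists_conn_diff_singleton (hQ i).joins.conn (hss i)
  have hmeet : ∀ i j, i ≠ j → ∀ E ⊆ D, Joins G (G.neighborSet v) (G.neighborSet x) E →
      d i ∉ E → d j ∈ E := fun i j hij E hED hE hi =>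
    by_contra fun hj => hcon i j hij (linked_of_notMem (hQ i) (hQ j) hv hx (hdD i) (hdD j) (hd i)
      (hd j) (subset_sdiff_singleton (hQD i) (hdQ i)) (subset_sdiff_singleton (hQD j) (hdQ j))
      hED hE hi hj)
  have hmem : ∀ i j, i ≠ j → d j ∈ Q i := fun i j hij =>
    hmeet i j hij (Q i) (hQD i) (hQ i).joins (hdQ i)
  have hne : ∀ i j, i ≠ j → d i ≠ d j := fun i j hij h => hdQ j (h ▸ hmem j i hij.symm)
  have hreach : ∀ N p q i, IndPath G p q (Q i) → p ∈ N → ∃ j, j ≠ i ∧ Reaches G D N d j := by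
    intro N p q i hP hp
    obtain ⟨k, hk⟩ : ∃ k, k ≠ i := exists_ne i
    obtain ⟨j, hj, hjN⟩ := hP.exists_reaches (hQD i) hp ⟨d k, hmem i k hk.symm, k, rfl⟩
    exact ⟨j, fun hji => hdQ i (hji ▸ hj), hjN⟩
  obtain ⟨i, hvi, hxi⟩ := exists_fin_three_of_forall_exists_ne
    (A := Reaches G D (G.neighborSet v) d) (B := Reaches G D (G.neighborSet x) d)
    (fun i => by
      obtain ⟨p, q, hP, hp, -⟩ := (hQ i).exists_indPath
      exact hreach _ p q i hP ((hp p hP.left_mem).2 rfl))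
    (fun i => by
      obtain ⟨p, q, hP, -, hq⟩ := (hQ i).exists_indPath
      exact hreach _ q p i hP.symm ((hq q hP.right_mem).2 rfl))
  obtain ⟨E, hED, hE, hdE⟩ := hvi.exists_joins hxi
  obtain ⟨j, k, hji, hki, hjk⟩ : ∃ j k, j ≠ i ∧ k ≠ i ∧ j ≠ k :=
    (by decide : ∀ i : Fin 3, ∃ j k, j ≠ i ∧ k ≠ i ∧ j ≠ k) i
  have hk := hmeet j k hjk E hED hE fun hj => hne j i hji (hdE j hj)
  exact hne k i hki (hdE k hk)

end Linked

section Ears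

variable {V : Type*} {G : SimpleGraph V}

/-- An ear of `E` at two of its vertices `u` and `w`: an induced path `A` outside `E`, with ends `p`
and `q`, such that `up` and `wq` are the only edges between `E` and `A`. -/
structure Ear (G : SimpleGraph V) (E : Set V) (u w : V) (A : Set V) (p q : V) : Prop where
  indPath : IndPath G p q A
  ne : u ≠ w
  left_mem : u ∈ E
  right_mem : w ∈ E
  notMem : ∀ z ∈ A, z ∉ E
  adj_iff : ∀ y ∈ E, ∀ z ∈ A, G.Adj y z ↔ (y = u ∧ z = p) ∨ (y = w ∧ z = q)

namespace Ear

variable {E A B : Set V} {u w p q p' q' : V}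

theorem swap (h : Ear G E u w A p q) : Ear G E w u A q p where
  indPath := h.indPath.symm
  ne := h.ne.symm
  left_mem := h.right_mem
  right_mem := h.left_mem
  notMem := h.notMem
  adj_iff y hy z hz := (h.adj_iff y hy z hz).trans or_comm

theorem adj_left_iff (h : Ear G E u w A p q) {z : V} (hz : z ∈ A) : G.Adj u z ↔ z = p := by
  simp [h.adj_iff u h.left_mem z hz, h.ne]

theorem adj_left (h : Ear G E u w A p q) : G.Adj u p :=
  (h.adj_left_iff h.indPath.left_mem).2 rfl

theorem notMem_of_ne (hA : Ear G E u w A p q) (hB : Ear G E u w B p' q') (hp : p ≠ p') : p' ∉ A :=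
  fun hp' => hp ((hA.adj_left_iff hp').1 hB.adj_left).symm

theorem ne_of_ne (hA : Ear G E u w A p q) (hB : Ear G E u w B p q') (hAB : A ≠ B) : p ≠ q := by
  rintro rfl
  obtain rfl := (hB.swap.adj_left_iff hB.indPath.left_mem).1 hA.swap.adj_left
  exact hAB (hA.indPath.eq_singleton.trans hB.indPath.eq_singleton.symm)

theorem indPath_insert_right (h : Ear G E u w A p q) : IndPath G p w (insert w A) :=
  (IndPath.cons h.swap.adj_left h.indPath.symm (fun hw => h.notMem w hw h.right_mem)
    fun _ hz => (h.swap.adj_left_iff hz).1).symm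

theorem indPath_insert_insert (h : Ear G E u w A p q) (huw : ¬ G.Adj u w) :
    IndPath G u w (insert u (insert w A)) := by
  refine .cons h.adj_left h.indPath_insert_right ?_ ?_
  · rintro (hu | hu)
    · exact h.ne hu
    · exact h.notMem u hu h.left_mem
  · rintro z (rfl | hz) huz
    · exact absurd huz huw
    · exact (h.adj_left_iff hz).1 huz

theorem not_adj (h : Ear G E u w A p q) (hpq : p ≠ q) : ¬ G.Adj p w := fun hpw =>
  hpq ((h.swap.adj_left_iff h.indPath.left_mem).1 hpw.symm)

theorem indPath_insert (h : Ear G E u w A p q) (hE : IndPath G u w E) (hpq : p ≠ q) :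
    IndPath G p w (insert p E) := by
  refine .cons h.adj_left.symm hE (h.notMem p h.indPath.left_mem) fun z hz hpz => ?_
  exact ((h.adj_iff z hz p h.indPath.left_mem).1 hpz.symm).elim And.left fun hw => absurd hw.2 hpq

theorem exists_shift (h : Ear G E u w A p q) (hpq : p ≠ q) :
    ∃ c, Ear G (insert p E) p w (A \ {p}) c q := by
  obtain ⟨-, c, hpc, hP, hc⟩ := h.indPath.eq_singleton_or_exists_tail.resolve_left fun e => hpq e.1
  have hpE := h.notMem p h.indPath.left_mem
  have hpw : p ≠ w := fun e => hpE (e ▸ h.right_mem)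
  refine ⟨c, hP, hpw, Or.inl rfl, Or.inr h.right_mem, ?_, ?_⟩
  · rintro z hz (hzp | hzE)
    exacts [hz.2 hzp, h.notMem z hz.1 hzE]
  · rintro y (rfl | hy) z ⟨hz, hzp⟩
    · simpa [hpw] using ⟨hc z hz, fun hzc => hzc ▸ hpc⟩
    · have hyp : y ≠ p := fun e => hpE (e ▸ hy)
      rw [h.adj_iff y hy z hz, or_iff_right fun e => hzp e.2, or_iff_right fun e => hyp e.1]

theorem isTrihedron (hE : IndPath G u w E) (hA : Ear G E u w A p q) (hB : Ear G E u w B p' q')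
    (huw : ¬ G.Adj u w) (hAB : ¬ Touch G A B) : IsTrihedron (G.induce (E ∪ (A ∪ B))) := by
  have hEP {A : Set V} {p q : V} (hA : Ear G E u w A p q) : ∀ y ∈ E, ∀ z ∈ insert u (insert w A),
      (y = z → y = u ∨ y = w) ∧ (G.Adj y z → y ∈ insert u (insert w A) ∨ z ∈ E) := by
    rintro y hy z (rfl | rfl | hz)
    · exact ⟨Or.inl, fun _ => Or.inr hA.left_mem⟩
    · exact ⟨Or.inr, fun _ => Or.inr hA.right_mem⟩
    · exact ⟨fun e => absurd (e ▸ hy) (hA.notMem z hz), fun hyz => Or.inl <|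
        ((hA.adj_iff y hy z hz).1 hyz).imp And.left fun e => Or.inl e.1⟩
  have htri := isTrihedron_union hA.ne huw hE (hA.indPath_insert_insert huw)
    (hB.indPath_insert_insert huw) (hEP hA) (hEP hB) ?_
  · have hset : E ∪ (A ∪ B) = E ∪ (insert u (insert w A) ∪ insert u (insert w B)) := by
      have := hA.left_mem
      have := hA.right_mem
      grind
    rwa [hset]
  · rintro y (rfl | rfl | hy)
    · exact fun z _ => ⟨fun _ => Or.inl rfl, fun _ => Or.inl (Or.inl rfl)⟩
    · exact fun z _ => ⟨fun _ => Or.inr rfl, fun _ => Or.inl (Or.inr (Or.inl rfl))⟩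
    · rintro z (rfl | rfl | hz)
      · exact ⟨Or.inl, fun _ => Or.inr (Or.inl rfl)⟩
      · exact ⟨Or.inr, fun _ => Or.inr (Or.inr (Or.inl rfl))⟩
      · exact ⟨fun e => absurd ⟨y, hy, z, hz, Or.inl e⟩ hAB,
          fun e => absurd ⟨y, hy, z, hz, Or.inr e⟩ hAB⟩

theorem isPyramid (hE : IndPath G u w E) (hA : Ear G E u w A p p) (hB : Ear G E u w B p' q')
    (hp : p ≠ p') (hAB : Touch G A B) : IsPyramid (G.induce (E ∪ (A ∪ B))) := by
  obtain rfl := hA.indPath.eq_singleton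
  have hpB : p ∉ B := hB.notMem_of_ne hA hp.symm
  obtain ⟨_, rfl, b, hb, hab⟩ := hAB
  have hbE := hB.notMem b hb
  rw [union_left_comm, singleton_union]
  exact isPyramid_insert (hE.isCycleGraph_union hB.indPath hA.ne hB.notMem hB.adj_iff)
    (fun h => h.elim (hA.notMem _ rfl) hpB) (Or.inl hA.left_mem) (Or.inl hA.right_mem) (Or.inr hb)
    hA.ne (fun e => hbE (e ▸ hA.left_mem)) (fun e => hbE (e ▸ hA.right_mem)) hA.adj_left.symm
    hA.swap.adj_left.symm (hab.resolve_left fun e => hpB (e ▸ hb))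

theorem isStamp (hE : IndPath G u w E) (hA : Ear G E u w A p q) (hB : Ear G E u w B p' q')
    (hpp : G.Adj p p') (hdis : ∀ z ∈ A, z ∉ B)
    (hadj : ∀ y ∈ A, ∀ z ∈ B, G.Adj y z → y = p ∧ z = p') :
    IsStamp (G.induce (E ∪ (A ∪ B))) := by
  have hne {A : Set V} {p q : V} (hA : Ear G E u w A p q) : p ≠ w := fun e =>
    hA.notMem p hA.indPath.left_mem (e ▸ hA.right_mem)
  have hEP {A : Set V} {p q : V} (hA : Ear G E u w A p q) : ∀ y ∈ E, ∀ z ∈ insert w A,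
      (y = z → y = w) ∧ (G.Adj y z → (y ∈ insert w A ∨ z ∈ E) ∨ (y = u ∧ z = p)) := by
    rintro y hy z (rfl | hz)
    · exact ⟨id, fun _ => Or.inl (Or.inr hA.right_mem)⟩
    · exact ⟨fun e => absurd (e ▸ hy) (hA.notMem z hz), fun hyz =>
        ((hA.adj_iff y hy z hz).1 hyz).elim Or.inr fun e => Or.inl (Or.inl (Or.inl e.1))⟩
  have hstamp := isStamp_union hE hA.indPath_insert_right hB.indPath_insert_right hA.ne (hne hA)
    (hne hB) hA.adj_left hB.adj_left hpp (hEP hA) (hEP hB) ?_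
  · have hset : E ∪ (A ∪ B) = E ∪ (insert w A ∪ insert w B) := by
      have := hA.right_mem
      grind
    rwa [hset]
  · rintro y (rfl | hy)
    · exact fun z _ => ⟨fun _ => rfl, fun _ => Or.inl (Or.inl (Or.inl rfl))⟩
    · rintro z (rfl | hz)
      · exact ⟨id, fun _ => Or.inl (Or.inr (Or.inl rfl))⟩
      · exact ⟨fun e => absurd (e ▸ hz) (hdis y hy), fun e => Or.inr (hadj y hy z hz e)⟩

theorem isPrism (hE : IndPath G u w E) (hA : Ear G E u w A p q) (hB : Ear G E u w B p' q')
    (hpp : G.Adj p p') (hqq : G.Adj q q') (hpq : p ≠ q) (hpq' : p' ≠ q') (hdis : ∀ z ∈ A, z ∉ B)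
    (hadj : ∀ y ∈ A, ∀ z ∈ B, G.Adj y z → (y = p ∧ z = p') ∨ (y = q ∧ z = q')) :
    IsPrism (G.induce (E ∪ (A ∪ B))) :=
  isPrism_union hE hA.indPath hB.indPath hA.ne hpq hpq' hA.adj_left hB.adj_left hpp
    hA.swap.adj_left hB.swap.adj_left hqq
    (fun y hy z hz => ⟨fun e => hA.notMem z hz (e ▸ hy), (hA.adj_iff y hy z hz).1⟩)
    (fun y hy z hz => ⟨fun e => hB.notMem z hz (e ▸ hy), (hB.adj_iff y hy z hz).1⟩)
    (fun y hy z hz => ⟨fun e => hdis y hy (e ▸ hz), hadj y hy z hz⟩)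

end Ear

theorem insert_union_sdiff_singleton {S C : Set V} {p : V} (hp : p ∈ C) :
    insert p S ∪ C \ {p} = S ∪ C := by
  rw [insert_union, ← union_insert, insert_sdiff_self_of_mem hp]

/-- Two ears `A` and `B` of an induced path `E` from `u` to `w` which the set `S ⊆ E` completes to
connectors of `v` and `x` that are not linked. -/
structure Parallel (G : SimpleGraph V) (v x : V) (S E : Set V) (u w : V) (A : Set V) (p q : V)
    (B : Set V) (p' q' : V) : Prop where
  indPath : IndPath G u w E
  ear_left : Ear G E u w A p q
  ear_right : Ear G E u w B p' q'
  subset : S ⊆ E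
  isConnector_left : IsConnector G v x (S ∪ A)
  isConnector_right : IsConnector G v x (S ∪ B)
  not_linked : ¬ Linked G v x (S ∪ (A ∪ B)) (S ∪ A) (S ∪ B)
  joins : ∀ Y, (∀ z ∈ Y, z ∉ E) → Joins G (G.neighborSet u) (G.neighborSet w) Y →
    Joins G (G.neighborSet v) (G.neighborSet x) (S ∪ Y)
  touch_or_not_adj : Touch G A B ∨ ¬ G.Adj u w

namespace Parallel

variable {v x u w p q p' q' : V} {S E A B : Set V}

theorem swap (h : Parallel G v x S E u w A p q B p' q') : Parallel G v x S E w u A q p B q' p' where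
  indPath := h.indPath.symm
  ear_left := h.ear_left.swap
  ear_right := h.ear_right.swap
  subset := h.subset
  isConnector_left := h.isConnector_left
  isConnector_right := h.isConnector_right
  not_linked := h.not_linked
  joins Y hY hj := h.joins Y hY hj.symm
  touch_or_not_adj := h.touch_or_not_adj.imp_right fun h h' => h h'.symm

theorem ne (h : Parallel G v x S E u w A p q B p' q') : A ≠ B := by
  rintro rfl
  exact h.not_linked (Relation.EqvGen.refl _)

theorem exists_shift (h : Parallel G v x S E u w A p q B p q') :
    ∃ c c', Parallel G v x (insert p S) (insert p E) p w (A \ {p}) c q (B \ {p}) c' q' := by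
  have hpq := h.ear_left.ne_of_ne h.ear_right h.ne
  have hpq' := h.ear_right.ne_of_ne h.ear_left h.ne.symm
  have hA := h.ear_left.indPath.left_mem
  have hB := h.ear_right.indPath.left_mem
  obtain ⟨c, hc⟩ := h.ear_left.exists_shift hpq
  obtain ⟨c', hc'⟩ := h.ear_right.exists_shift hpq'
  refine ⟨c, c', h.ear_left.indPath_insert h.indPath hpq, hc, hc', insert_subset_insert h.subset,
    ?_, ?_, ?_, fun Y hY hj => ?_, Or.inr (h.ear_left.not_adj hpq)⟩
  · rw [insert_union_sdiff_singleton hA]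
    exact h.isConnector_left
  · rw [insert_union_sdiff_singleton hB]
    exact h.isConnector_right
  · rw [insert_union_sdiff_singleton hA, insert_union_sdiff_singleton hB, ← union_sdiff_distrib,
      insert_union_sdiff_singleton (mem_union_left B hA)]
    exact h.not_linked
  · obtain ⟨y, hy, hpy⟩ := hj.nonempty_left
    rw [insert_union, ← union_insert]
    refine h.joins _ ?_ ⟨hj.conn.insert_adj hy hpy, ⟨p, Or.inl rfl, h.ear_left.adj_left⟩,
      hj.nonempty_right.mono (inter_subset_inter_left _ (subset_insert p Y))⟩
    rintro z (rfl | hz)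
    · exact h.ear_left.notMem z hA
    · exact fun hzE => hY z hz (Or.inr hzE)

theorem not_touch [Finite V] (h : Parallel G v x S E u w A p q B p' q') (hp : p ≠ p') (hq : q ≠ q')
    (hpq : p ≠ q) (hpq' : p' ≠ q') : ¬ Touch G (A \ {q}) (B \ {p'}) := by
  intro ht
  obtain ⟨-, _, -, hPA, -⟩ :=
    h.ear_left.indPath.symm.eq_singleton_or_exists_tail.resolve_left fun e => hpq e.1.symm
  obtain ⟨-, _, -, hPB, -⟩ :=
    h.ear_right.indPath.eq_singleton_or_exists_tail.resolve_left fun e => hpq' e.1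
  have hjoins {Y : Set V} (hc : Conn G Y) (hY : Y ⊆ A ∪ B) (hpY : p ∈ Y) (hqY : q' ∈ Y) :=
    h.joins Y (fun z hz => (hY hz).elim (h.ear_left.notMem z) (h.ear_right.notMem z))
      ⟨hc, ⟨p, hpY, h.ear_left.adj_left⟩, q', hqY, h.ear_right.swap.adj_left⟩
  have hssubset {Y : Set V} {z : V} (hY : Y ⊆ A ∪ B) (hz : z ∈ A ∪ B) (hzE : z ∉ E) (hzY : z ∉ Y) :
      S ∪ Y ⊂ S ∪ (A ∪ B) :=
    ssubset_iff_exists.2 ⟨union_subset_union_right S hY, z, Or.inr hz,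
      fun hzS => hzS.elim (fun hzS => hzE (h.subset hzS)) hzY⟩
  have hpA : p ∈ A := h.ear_left.indPath.left_mem
  have hqA : q ∈ A := h.ear_left.indPath.right_mem
  have hp'B : p' ∈ B := h.ear_right.indPath.left_mem
  have hq'B : q' ∈ B := h.ear_right.indPath.right_mem
  have hp'A : p' ∉ A := h.ear_left.notMem_of_ne h.ear_right hp
  have hqB : q ∉ B := h.ear_right.swap.notMem_of_ne h.ear_left.swap hq.symm
  have hAB₁ : A ∪ B \ {p'} ⊆ A ∪ B := union_subset_union_right A sdiff_subset
  have hAB₂ : A \ {q} ∪ B ⊆ A ∪ B := union_subset_union_left B sdiff_subset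
  have hj₁ := hjoins (h.ear_left.indPath.conn.union hPB.conn (ht.mono sdiff_subset subset_rfl)) hAB₁
    (Or.inl hpA) (Or.inr hPB.right_mem)
  have hj₂ := hjoins (hPA.conn.union h.ear_right.indPath.conn (ht.mono subset_rfl sdiff_subset))
    hAB₂ (Or.inl hPA.right_mem) (Or.inr hq'B)
  have hj₃ := hjoins (hPA.conn.union hPB.conn ht) (union_subset_union sdiff_subset sdiff_subset)
    (Or.inl hPA.right_mem) (Or.inr hPB.right_mem)
  refine h.not_linked (linked_of_subset_inter h.isConnector_left h.isConnector_right ?_ ?_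
    (hssubset hAB₁ (Or.inr hp'B) (h.ear_right.notMem p' hp'B) (by simp [hp'A]))
    (hssubset hAB₂ (Or.inl hqA) (h.ear_left.notMem q hqA) (by simp [hqB]))
    hj₁.conn hj₂.conn hj₃ ?_ ?_ ?_)
  · rw [union_union_distrib_left]
    exact fun hv => hv.elim h.isConnector_left.notMem_left h.isConnector_right.notMem_left
  · rw [union_union_distrib_left]
    exact fun hx => hx.elim h.isConnector_left.notMem_right h.isConnector_right.notMem_right
  · exact union_subset_union_right S subset_union_left
  · exact union_subset_union_right S subset_union_right
  · exact subset_inter (union_subset_union_right S (union_subset_union_left _ sdiff_subset))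
      (union_subset_union_right S (union_subset_union_right _ sdiff_subset))

theorem eq_or_eq_of_touch [Finite V] (h : Parallel G v x S E u w A p q B p' q') (hp : p ≠ p')
    (hq : q ≠ q') (hpq : p ≠ q) (hpq' : p' ≠ q') :
    ∀ y ∈ A, ∀ z ∈ B, (y = z ∨ G.Adj y z) → (y = p ∧ z = p') ∨ (y = q ∧ z = q') := by
  intro y hy z hz hyz
  have hqp : y = q ∨ z = p' := by
    by_contra! hcon
    exact h.not_touch hp hq hpq hpq' ⟨y, ⟨hy, hcon.1⟩, z, ⟨hz, hcon.2⟩, hyz⟩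
  have hpq : y = p ∨ z = q' := by
    by_contra! hcon
    exact h.swap.not_touch hq hp hpq.symm hpq'.symm ⟨y, ⟨hy, hcon.1⟩, z, ⟨hz, hcon.2⟩, hyz⟩
  grind

theorem isSolidGraph_of_ne [Finite V] (h : Parallel G v x S E u w A p q B p' q') (hp : p ≠ p')
    (hq : q ≠ q') : IsSolidGraph (G.induce (E ∪ (A ∪ B))) := by
  obtain ⟨hE, hA, hB⟩ := And.intro h.indPath (And.intro h.ear_left h.ear_right)
  by_cases ht : Touch G A B
  swap
  · exact Or.inr (Or.inl (hA.isTrihedron hE hB (h.touch_or_not_adj.resolve_left ht) ht))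
  by_cases hpq : p = q
  · subst hpq
    exact Or.inl (hA.isPyramid hE hB hp ht)
  by_cases hpq' : p' = q'
  · subst hpq'
    rw [union_comm A B]
    exact Or.inl (hB.isPyramid hE hA hp.symm ht.symm)
  have hcontact := h.eq_or_eq_of_touch hp hq hpq hpq'
  have hdis : ∀ z ∈ A, z ∉ B := by
    intro z hz hz'
    rcases hcontact z hz z hz' (Or.inl rfl) with ⟨rfl, e⟩ | ⟨rfl, e⟩
    exacts [hp e, hq e]
  have hadj := fun y hy z hz hyz => hcontact y hy z hz (Or.inr hyz)
  by_cases hpp : G.Adj p p' <;> by_cases hqq : G.Adj q q'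
  · exact Or.inr (Or.inr (Or.inr (hA.isPrism hE hB hpp hqq hpq hpq' hdis hadj)))
  · refine Or.inr (Or.inr (Or.inl (hA.isStamp hE hB hpp hdis fun y hy z hz hyz => ?_)))
    exact (hadj y hy z hz hyz).resolve_right fun e => hqq (e.1 ▸ e.2 ▸ hyz)
  · refine Or.inr (Or.inr (Or.inl
      (hA.swap.isStamp hE.symm hB.swap hqq hdis fun y hy z hz hyz => ?_)))
    exact (hadj y hy z hz hyz).resolve_left fun e => hpp (e.1 ▸ e.2 ▸ hyz)
  · obtain ⟨y, hy, z, hz, hyz⟩ := ht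
    rcases hcontact y hy z hz hyz with ⟨rfl, rfl⟩ | ⟨rfl, rfl⟩
    · exact absurd (hyz.resolve_left hp) hpp
    · exact absurd (hyz.resolve_left hq) hqq

theorem isSolidGraph [Finite V] {u w p q p' q' : V} {S E A B : Set V}
    (h : Parallel G v x S E u w A p q B p' q') :
    IsSolidGraph (G.induce (E ∪ (A ∪ B))) := by
  by_cases hp : p = p'
  · subst hp
    obtain ⟨c, c', h'⟩ := h.exists_shift
    have hA := h.ear_left.indPath.left_mem
    have := ncard_sdiff_singleton_lt_of_mem hA
    rw [← insert_union_sdiff_singleton (mem_union_left B hA), union_sdiff_distrib]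
    exact isSolidGraph h'
  by_cases hq : q = q'
  · subst hq
    obtain ⟨c, c', h'⟩ := h.swap.exists_shift
    have hA := h.ear_left.indPath.right_mem
    have := ncard_sdiff_singleton_lt_of_mem hA
    rw [← insert_union_sdiff_singleton (mem_union_left B hA), union_sdiff_distrib]
    exact isSolidGraph h'
  exact h.isSolidGraph_of_ne hp hq
termination_by A.ncard

end Parallel

theorem isSolidGraph_of_touch [Finite V] {v x : V} (hvx : G.Adj v x) {Q Q' : Set V}
    (hQ : IsConnector G v x Q) (hQ' : IsConnector G v x Q') (ht : Touch G Q Q')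
    (hl : ¬ Linked G v x (Q ∪ Q') Q Q') :
    IsSolidGraph (G.induce (insert v (insert x (Q ∪ Q')))) := by
  have hE : IndPath G v x {v, x} := .cons hvx (.single x) hvx.ne fun z hz _ => hz
  have hear {Q : Set V} (hQ : IsConnector G v x Q) : ∃ p q, Ear G {v, x} v x Q p q := by
    obtain ⟨p, q, hP, hp, hq⟩ := hQ.exists_indPath
    refine ⟨p, q, hP, hvx.ne, Or.inl rfl, Or.inr rfl, ?_, ?_⟩
    · rintro z hz (rfl | rfl)
      exacts [hQ.notMem_left hz, hQ.notMem_right hz]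
    · rintro y (rfl | rfl) z hz
      · simp [hp z hz, hvx.ne]
      · simp [hq z hz, hvx.ne']
  obtain ⟨p, q, hA⟩ := hear hQ
  obtain ⟨p', q', hB⟩ := hear hQ'
  have hpar : Parallel G v x ∅ {v, x} v x Q p q Q' p' q' :=
    ⟨hE, hA, hB, empty_subset _, by rwa [empty_union], by rwa [empty_union],
      by simpa only [empty_union] using hl, fun Y _ hY => by rwa [empty_union], Or.inl ht⟩
  have hsolid := hpar.isSolidGraph
  rwa [insert_union, singleton_union] at hsolid

end Ears

section Bridges

variable {V : Type*} {G : SimpleGraph V}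

/-- A bridge between two sets `A` and `B`: an induced path `R` outside them that has neighbours in
`A` at its end `r` only and neighbours in `B` at its end `s` only. -/
structure Bridge (G : SimpleGraph V) (A R B : Set V) (r s : V) : Prop where
  indPath : IndPath G r s R
  notMem_left : ∀ z ∈ A, z ∉ R
  notMem_right : ∀ z ∈ B, z ∉ R
  eq_left : ∀ y ∈ R, ∀ z ∈ A, G.Adj y z → y = r
  eq_right : ∀ y ∈ R, ∀ z ∈ B, G.Adj y z → y = s
  exists_left : ∃ z ∈ A, G.Adj r z
  exists_right : ∃ z ∈ B, G.Adj s z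

namespace Bridge

variable {A R B : Set V} {r s : V}

theorem symm (h : Bridge G A R B r s) : Bridge G B R A s r where
  indPath := h.indPath.symm
  notMem_left := h.notMem_right
  notMem_right := h.notMem_left
  eq_left := h.eq_right
  eq_right := h.eq_left
  exists_left := h.exists_right
  exists_right := h.exists_left

theorem touch_left (h : Bridge G A R B r s) : Touch G A R := by
  obtain ⟨z, hz, hrz⟩ := h.exists_left
  exact ⟨z, hz, r, h.indPath.left_mem, Or.inr hrz.symm⟩

theorem conn_union (h : Bridge G A R B r s) (hA : Conn G A) : Conn G (A ∪ R) :=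
  hA.union h.indPath.conn h.touch_left

theorem indPath_union (h : Bridge G A R B r s) (ht : ¬ Touch G A B) {q p p' q' : V}
    (hA : IndPath G q p A) (hB : IndPath G p' q' B) (hrp : ∀ y ∈ A, G.Adj r y → y = p)
    (hsp : ∀ z ∈ B, G.Adj s z → z = p') : IndPath G q q' (A ∪ (R ∪ B)) := by
  obtain ⟨y, hy, hry⟩ := h.exists_left
  obtain ⟨z, hz, hsz⟩ := h.exists_right
  obtain rfl := hrp y hy hry
  obtain rfl := hsp z hz hsz
  have hRB : IndPath G r q' (R ∪ B) := by
    refine h.indPath.append hB hsz (fun a ha ha' => h.notMem_right a ha' ha) fun a ha b hb hab => ?_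
    obtain rfl := h.eq_right a ha b hb hab
    exact ⟨rfl, hsp b hb hab⟩
  refine hA.append hRB hry.symm ?_ ?_
  · rintro a ha (ha' | ha')
    exacts [h.notMem_left a ha ha', ht ⟨a, ha, a, ha', Or.inl rfl⟩]
  · rintro a ha b (hb | hb) hab
    · obtain rfl := h.eq_left b hb a ha hab.symm
      exact ⟨hrp a ha hab.symm, rfl⟩
    · exact absurd ⟨a, ha, b, hb, Or.inr hab⟩ ht

end Bridge

theorem Conn.exists_bridge [Finite V] {D A B : Set V} (hD : Conn G D) (hA : A.Nonempty)
    (hB : B.Nonempty) (hAD : A ⊆ D) (hBD : B ⊆ D) (ht : ¬ Touch G A B) :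
    ∃ R ⊆ D, ∃ r s, Bridge G A R B r s := by
  have hmin {P P' E : Set V} (hE : Joins G P P' E) : ∃ E' ⊆ E, Minimal (Joins G P P') E' :=
    (toFinite {E | Joins G P P' E}).exists_le_minimal hE
  obtain ⟨R', hR'D, hR'⟩ := hmin (P := A) (P' := B) ⟨hD, by rwa [inter_eq_right.2 hAD],
    by rwa [inter_eq_right.2 hBD]⟩
  obtain ⟨a, b, hP, hRA, hRB⟩ := exists_indPath_of_minimal_joins hR'
  have haA : a ∈ A := (hRA.ge rfl).2
  have hbB : b ∈ B := (hRB.ge rfl).2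
  obtain ⟨-, c, hac, hP₁, -⟩ :=
    hP.eq_singleton_or_exists_tail.resolve_left fun e => ht ⟨a, haA, b, hbB, Or.inl e.1⟩
  obtain ⟨-, d, hbd, hP₂, -⟩ := hP₁.symm.eq_singleton_or_exists_tail.resolve_left fun e =>
    ht ⟨a, haA, b, hbB, Or.inr (e.1 ▸ hac)⟩
  obtain ⟨R, hR, hRmin⟩ := hmin (P := {z | ∃ y ∈ A, G.Adj z y}) (P' := {z | ∃ y ∈ B, G.Adj z y})
    ⟨hP₂.conn, ⟨c, hP₂.right_mem, a, haA, hac.symm⟩, d, hP₂.left_mem, b, hbB, hbd.symm⟩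
  obtain ⟨r, s, hrs, hr, hs⟩ := exists_indPath_of_minimal_joins hRmin
  have hsub : R ⊆ R' := fun z hz => (hR hz).1.1
  exact ⟨R, hsub.trans hR'D, r, s,
    { indPath := hrs
      notMem_left := fun z hz hzR => (hR hzR).1.2 (hRA.le ⟨hsub hzR, hz⟩)
      notMem_right := fun z hz hzR => (hR hzR).2 (hRB.le ⟨hsub hzR, hz⟩)
      eq_left := fun y hy z hz hyz => hr.le ⟨hy, z, hz, hyz⟩
      eq_right := fun y hy z hz hyz => hs.le ⟨hy, z, hz, hyz⟩
      exists_left := (hr.ge rfl).2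
      exists_right := (hs.ge rfl).2 }⟩

/-- A connector `Q` of `v` and `x` as an induced path, whose end `p` is the neighbour of `v` and
whose end `q` is the neighbour of `x`. -/
structure ConnectorPath (G : SimpleGraph V) (v x p q : V) (Q : Set V) : Prop where
  isConnector : IsConnector G v x Q
  indPath : IndPath G p q Q
  adj_left_iff : ∀ z ∈ Q, G.Adj v z ↔ z = p
  adj_right_iff : ∀ z ∈ Q, G.Adj x z ↔ z = q

namespace ConnectorPath

variable {v x p q a : V} {Q Q₁ Q₂ : Set V}

theorem swap (h : ConnectorPath G v x p q Q) : ConnectorPath G x v q p Q where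
  isConnector := isConnector_comm.1 h.isConnector
  indPath := h.indPath.symm
  adj_left_iff := h.adj_right_iff
  adj_right_iff := h.adj_left_iff

theorem adj_left (h : ConnectorPath G v x p q Q) : G.Adj v p :=
  (h.adj_left_iff p h.indPath.left_mem).2 rfl

theorem indPath_insert (h : ConnectorPath G v x p q Q) (hQ₁ : Q₁ ⊆ Q) (hP : IndPath G p a Q₁) :
    IndPath G v a (insert v Q₁) :=
  .cons h.adj_left hP (fun hv => h.isConnector.notMem_left (hQ₁ hv))
    fun z hz => (h.adj_left_iff z (hQ₁ hz)).1

theorem eq_or_eq_of_split (h : ConnectorPath G v x p q Q) (hvx : v ≠ x)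
    (hP₁ : IndPath G p a Q₁) (hP₂ : IndPath G a q Q₂) (hun : Q₁ ∪ Q₂ = Q)
    (hint : ∀ y ∈ Q₁, y ∈ Q₂ → y = a)
    (hadj : ∀ y ∈ Q₁, ∀ z ∈ Q₂, G.Adj y z → y = a ∨ z = a) :
    ∀ y ∈ insert v Q₁, ∀ z ∈ insert x Q₂, (y = z → y = a) ∧
      (G.Adj y z → (y = v ∧ z = x) ∨ y = a ∨ z = a) := by
  subst hun
  rintro y (rfl | hy) z (rfl | hz)
  · exact ⟨fun e => absurd e hvx, fun _ => Or.inl ⟨rfl, rfl⟩⟩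
  · refine ⟨fun e => absurd (Or.inr (e ▸ hz)) h.isConnector.notMem_left, fun e => ?_⟩
    obtain rfl := (h.adj_left_iff z (Or.inr hz)).1 e
    exact Or.inr (Or.inr (hint z hP₁.left_mem hz))
  · refine ⟨fun e => absurd (Or.inl (e ▸ hy)) h.isConnector.notMem_right, fun e => ?_⟩
    obtain rfl := (h.adj_right_iff y (Or.inl hy)).1 e.symm
    exact Or.inr (Or.inl (hint y hy hP₂.right_mem))
  · exact ⟨fun e => hint y hy (e ▸ hz), fun e => Or.inr (hadj y hy z hz e)⟩

end ConnectorPath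

theorem union_union_rev (A R B : Set V) : A ∪ (R ∪ B) = B ∪ (R ∪ A) := by
  rw [← union_assoc, union_comm, union_comm A]

/-- Two connectors `A` and `B` of an edge `vx` that do not touch, are not linked, and are joined by
a bridge `R`. -/
structure BridgedPair (G : SimpleGraph V) (v x : V) (A R B : Set V) (p q r s p' q' : V) :
    Prop where
  adj : G.Adj v x
  left : ConnectorPath G v x p q A
  right : ConnectorPath G v x p' q' B
  bridge : Bridge G A R B r s
  notMem_left : v ∉ R
  notMem_right : x ∉ R
  not_touch : ¬ Touch G A B
  not_linked : ¬ Linked G v x (A ∪ (R ∪ B)) A B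

namespace BridgedPair

variable {v x p q r s p' q' : V} {A R B : Set V}

theorem swap (h : BridgedPair G v x A R B p q r s p' q') :
    BridgedPair G x v A R B q p r s q' p' where
  adj := h.adj.symm
  left := h.left.swap
  right := h.right.swap
  bridge := h.bridge
  notMem_left := h.notMem_right
  notMem_right := h.notMem_left
  not_touch := h.not_touch
  not_linked hl := h.not_linked hl.swap

theorem flip (h : BridgedPair G v x A R B p q r s p' q') :
    BridgedPair G v x B R A p' q' s r p q where
  adj := h.adj
  left := h.right
  right := h.left
  bridge := h.bridge.symm
  notMem_left := h.notMem_left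
  notMem_right := h.notMem_right
  not_touch ht := h.not_touch ht.symm
  not_linked hl := h.not_linked (union_union_rev A R B ▸ hl.symm)

theorem ne_of_mem (h : BridgedPair G v x A R B p q r s p' q') {y z : V} (hy : y ∈ A)
    (hz : z ∈ B) : y ≠ z :=
  fun e => h.not_touch ⟨y, hy, z, hz, Or.inl e⟩

theorem notMem_union_left (h : BridgedPair G v x A R B p q r s p' q') : v ∉ A ∪ (R ∪ B) := by
  rintro (hv | hv | hv)
  exacts [h.left.isConnector.notMem_left hv, h.notMem_left hv, h.right.isConnector.notMem_left hv]

theorem conn_union_right (h : BridgedPair G v x A R B p q r s p' q') : Conn G (R ∪ B) :=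
  union_comm B R ▸ h.bridge.symm.conn_union h.right.indPath.conn

theorem false_of_joins [Finite V] (h : BridgedPair G v x A R B p q r s p' q') {E X Y : Set V}
    {d d' : V} (hY : Y ⊆ R ∪ B) (hd : d ∈ B) (hdY : d ∉ Y) (hX : X ⊆ A ∪ R) (hd' : d' ∈ A)
    (hdX : d' ∉ X) (hAY : Conn G (A ∪ Y)) (hXB : Conn G (X ∪ B))
    (hE : Joins G (G.neighborSet v) (G.neighborSet x) E) (hEY : E ⊆ A ∪ Y) (hEX : E ⊆ X ∪ B) :
    False := by
  refine h.not_linked (linked_of_subset_inter h.left.isConnector h.right.isConnector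
    h.notMem_union_left h.swap.notMem_union_left (ssubset_iff_exists.2
      ⟨union_subset_union_right A hY, d, Or.inr (Or.inr hd), ?_⟩) (ssubset_iff_exists.2
      ⟨?_, d', Or.inl hd', ?_⟩) hAY hXB hE subset_union_left subset_union_right
    (subset_inter hEY hEX))
  · exact fun hdA => hdA.elim (fun hdA => h.ne_of_mem hdA hd rfl) hdY
  · rw [← union_assoc]
    exact union_subset_union_left B hX
  · exact fun hdB => hdB.elim hdX fun hdB => h.ne_of_mem hd' hdB rfl

theorem not_adj_of_adj [Finite V] (h : BridgedPair G v x A R B p q r s p' q') {a b : V}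
    (ha : a ∈ R) (hva : G.Adj v a) (hb : b ∈ R) : ¬ G.Adj x b := fun hxb =>
  have hp := h.left.indPath.left_mem
  have hp' := h.right.indPath.left_mem
  h.false_of_joins (E := R) subset_union_left hp' (h.bridge.notMem_right p' hp') subset_union_right
    hp (h.bridge.notMem_left p hp) (h.bridge.conn_union h.left.indPath.conn) h.conn_union_right
    ⟨h.bridge.indPath.conn, ⟨a, ha, hva⟩, b, hb, hxb⟩ subset_union_right subset_union_left

theorem eq_of_adj [Finite V] (h : BridgedPair G v x A R B p q r s p' q') {a y : V} (ha : a ∈ R)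
    (hva : G.Adj v a) (hy : y ∈ A) (hry : G.Adj r y) : y = p := by
  by_contra! hyp
  obtain ⟨hpq, c, -, hP, -⟩ :=
    h.left.indPath.eq_singleton_or_exists_tail.resolve_left fun e => hyp (e.2.le hy)
  have hp := h.left.indPath.left_mem
  have hp' := h.right.indPath.left_mem
  have hr := h.bridge.indPath.left_mem
  have hq : q ∈ A \ {p} := ⟨h.left.indPath.right_mem, hpq.symm⟩
  have ht : Touch G (A \ {p}) R := ⟨y, ⟨hy, hyp⟩, r, hr, Or.inr hry.symm⟩
  refine h.false_of_joins (E := A \ {p} ∪ R) (X := A \ {p} ∪ R) subset_union_left hp'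
    (h.bridge.notMem_right p' hp') (union_subset_union_left R sdiff_subset) hp ?_
    (h.bridge.conn_union h.left.indPath.conn) ?_ ⟨hP.conn.union h.bridge.indPath.conn ht,
      ⟨a, Or.inr ha, hva⟩, q, Or.inl hq, h.swap.left.adj_left⟩
    (union_subset_union_left R sdiff_subset) subset_union_left
  · exact fun hpX => hpX.elim (fun hpX => hpX.2 rfl) (h.bridge.notMem_left p hp)
  · rw [union_assoc]
    exact hP.conn.union h.conn_union_right (ht.mono subset_rfl subset_union_left)

theorem eq_of_adj_of_ne [Finite V] (h : BridgedPair G v x A R B p q r s p' q') {y z : V}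
    (hy : y ∈ A) (hyq : y ≠ q) (hry : G.Adj r y) (hz : z ∈ B) (hsz : G.Adj s z) : z = p' := by
  by_contra! hzp
  obtain ⟨-, c, -, hP, -⟩ :=
    h.left.indPath.symm.eq_singleton_or_exists_tail.resolve_left fun e => hyq (e.2.le hy)
  obtain ⟨-, c', -, hP', -⟩ :=
    h.right.indPath.eq_singleton_or_exists_tail.resolve_left fun e => hzp (e.2.le hz)
  have hq := h.left.indPath.right_mem
  have hp' := h.right.indPath.left_mem
  have hr := h.bridge.indPath.left_mem
  have hRB : Conn G (R ∪ B \ {p'}) := h.bridge.indPath.conn.union hP'.conn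
    ⟨s, h.bridge.indPath.right_mem, z, ⟨hz, hzp⟩, Or.inr hsz⟩
  have ht : Touch G (A \ {q}) R := ⟨y, ⟨hy, hyq⟩, r, hr, Or.inr hry.symm⟩
  refine h.false_of_joins (E := A \ {q} ∪ (R ∪ B \ {p'})) (X := A \ {q} ∪ R)
    (union_subset_union_right R sdiff_subset) hp' ?_ (union_subset_union_left R sdiff_subset) hq ?_
    (h.left.indPath.conn.union hRB (ht.mono sdiff_subset subset_union_left)) ?_
    ⟨hP.conn.union hRB (ht.mono subset_rfl subset_union_left),
      ⟨p, Or.inl hP.right_mem, h.left.adj_left⟩,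
      q', Or.inr (Or.inr hP'.right_mem), h.swap.right.adj_left⟩
    (union_subset_union_left _ sdiff_subset) ?_
  · exact fun hpY => hpY.elim (h.bridge.notMem_right p' hp') fun hpY => hpY.2 rfl
  · exact fun hqX => hqX.elim (fun hqX => hqX.2 rfl) (h.bridge.notMem_left q hq)
  · rw [union_assoc]
    exact hP.conn.union h.conn_union_right (ht.mono subset_rfl subset_union_left)
  · rw [union_assoc]
    exact union_subset_union_right _ (union_subset_union_right _ sdiff_subset)

theorem isPyramid (h : BridgedPair G v x A R B p q r s p' q') (hA : ∀ y ∈ A, G.Adj r y → y = p)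
    (hB : ∀ z ∈ B, G.Adj s z → z = p') (hx : ∀ t ∈ R, ¬ G.Adj x t) :
    IsPyramid (G.induce (insert v (insert x (A ∪ (R ∪ B))))) := by
  have hp := h.left.indPath.left_mem
  have hp' := h.right.indPath.left_mem
  have hq := h.left.indPath.right_mem
  have hq' := h.right.indPath.right_mem
  have hcycle : IsCycleGraph (G.induce (insert x (A ∪ (R ∪ B)))) := by
    have hP := h.bridge.indPath_union h.not_touch h.left.indPath.symm h.right.indPath hA hB
    refine hP.isCycleGraph (h.ne_of_mem hq hq') h.swap.notMem_union_left ?_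
    rintro z (hz | hz | hz)
    · rw [h.left.adj_right_iff z hz, or_iff_left (h.ne_of_mem hz hq')]
    · refine iff_of_false (hx z hz) ?_
      rintro (rfl | rfl)
      exacts [h.bridge.notMem_left _ hq hz, h.bridge.notMem_right _ hq' hz]
    · rw [h.right.adj_right_iff z hz, or_iff_right (h.ne_of_mem hq hz).symm]
  exact isPyramid_insert hcycle (fun hv => hv.elim h.adj.ne h.notMem_union_left)
    (Or.inl rfl) (Or.inr (Or.inl hp)) (Or.inr (Or.inr (Or.inr hp')))
    (fun e => h.left.isConnector.notMem_right (e ▸ hp))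
    (fun e => h.right.isConnector.notMem_right (e ▸ hp')) (h.ne_of_mem hp hp') h.adj
    h.left.adj_left h.right.adj_left

theorem indPath_insert (h : BridgedPair G v x {p} R B p p r s p' q') :
    IndPath G p s (insert p R) := by
  obtain ⟨_, rfl, hrp⟩ := h.bridge.exists_left
  exact .cons hrp.symm h.bridge.indPath (h.bridge.notMem_left _ rfl)
    fun y hy hpy => h.bridge.eq_left y hy _ rfl hpy.symm

theorem ne_and_eq_or_eq_of_adj (h : BridgedPair G v x {p} R B p p r s p' q')
    (hv : ∀ t ∈ R, ¬ G.Adj v t) : ∀ y ∈ insert p R, ∀ z ∈ insert v B,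
      y ≠ z ∧ (G.Adj y z → (y = p ∧ z = v) ∨ (y = s ∧ z ∈ B ∧ G.Adj s z)) := by
  rintro y (rfl | hy) z (rfl | hz)
  · exact ⟨h.left.adj_left.ne', fun _ => Or.inl ⟨rfl, rfl⟩⟩
  · exact ⟨h.ne_of_mem rfl hz, fun e => absurd ⟨y, rfl, z, hz, Or.inr e⟩ h.not_touch⟩
  · exact ⟨fun e => h.notMem_left (e ▸ hy), fun e => absurd e.symm (hv y hy)⟩
  · refine ⟨fun e => h.bridge.notMem_right z hz (e ▸ hy), fun e => ?_⟩
    obtain rfl := h.bridge.eq_right y hy z hz e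
    exact Or.inr ⟨rfl, hz, e⟩

variable {a c : V} {Q₁ Q₂ : Set V}

theorem isStamp (h : BridgedPair G v x {p} R B p p r s p' q') (hv : ∀ t ∈ R, ¬ G.Adj v t)
    (hx : ∀ t ∈ R, ¬ G.Adj x t) (hP₁ : IndPath G p' a Q₁) (hP₂ : IndPath G a q' Q₂)
    (hun : Q₁ ∪ Q₂ = B) (hint : ∀ y ∈ Q₁, y ∈ Q₂ → y = a)
    (hadj : ∀ y ∈ Q₁, ∀ z ∈ Q₂, G.Adj y z → y = a ∨ z = a) (hs : ∀ z ∈ B, G.Adj s z ↔ z = a) :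
    IsStamp (G.induce (insert v (insert x ({p} ∪ (R ∪ B))))) := by
  have hQ₁ : Q₁ ⊆ B := hun ▸ subset_union_left
  have hQ₂ : Q₂ ⊆ B := hun ▸ subset_union_right
  have ha₁ := hP₁.right_mem
  have ha₂ := hP₂.left_mem
  have haB := hQ₁ ha₁
  have hcv := h.ne_and_eq_or_eq_of_adj hv
  have hcx := h.swap.ne_and_eq_or_eq_of_adj hx
  have hcvx := h.right.eq_or_eq_of_split h.adj.ne hP₁ hP₂ hun hint hadj
  have hP₀ : IndPath G p a (insert p R ∪ {a}) := by
    refine h.indPath_insert.append (.single a) ((hs a haB).2 rfl) ?_ ?_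
    · exact fun y hy hya => (hcv y hy a (Or.inr haB)).1 hya
    · rintro y hy z rfl hyz
      obtain ⟨-, rfl⟩ | ⟨rfl, -⟩ := (hcv y hy z (Or.inr haB)).2 hyz
      exacts [absurd haB h.right.isConnector.notMem_left, ⟨rfl, rfl⟩]
  have hstamp := isStamp_union hP₀ (h.right.indPath_insert hQ₁ hP₁)
    (h.right.swap.indPath_insert hQ₂ hP₂.symm) (h.ne_of_mem rfl haB)
    (fun e => h.right.isConnector.notMem_left (e ▸ haB))
    (fun e => h.right.isConnector.notMem_right (e ▸ haB)) h.left.adj_left.symm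
    h.swap.left.adj_left.symm h.adj ?_ ?_ ?_
  · have hset : insert v (insert x ({p} ∪ (R ∪ B))) =
        insert p R ∪ {a} ∪ (insert v Q₁ ∪ insert x Q₂) := by grind
    rwa [hset]
  · have := h.left.adj_left.ne
    grind
  · grind
  · grind

theorem isPrism (h : BridgedPair G v x {p} R B p p r s p' q') (hv : ∀ t ∈ R, ¬ G.Adj v t)
    (hx : ∀ t ∈ R, ¬ G.Adj x t) (hP₁ : IndPath G p' a Q₁) (hP₂ : IndPath G a q' Q₂)
    (hun : Q₁ ∪ Q₂ = B) (hint : ∀ y ∈ Q₁, y ∈ Q₂ → y = a)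
    (hadj : ∀ y ∈ Q₁, ∀ z ∈ Q₂, G.Adj y z → y = a ∨ z = a) (hP : IndPath G c q' (Q₂ \ {a}))
    (hc : ∀ z ∈ Q₂, G.Adj a z ↔ z = c) (hs : ∀ z ∈ B, G.Adj s z ↔ z = a ∨ z = c) :
    IsPrism (G.induce (insert v (insert x ({p} ∪ (R ∪ B))))) := by
  have hQ₁ : Q₁ ⊆ B := hun ▸ subset_union_left
  have hQ₂ : Q₂ ⊆ B := hun ▸ subset_union_right
  have ha₁ := hP₁.right_mem
  have ha₂ := hP₂.left_mem
  have haB := hQ₁ ha₁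
  have hcmem := hP.left_mem
  have hcB := hQ₂ hcmem.1
  have hcv := h.ne_and_eq_or_eq_of_adj hv
  have hcx := h.swap.ne_and_eq_or_eq_of_adj hx
  have hcvx := h.right.eq_or_eq_of_split h.adj.ne hP₁ hP₂ hun hint hadj
  have hxa : ¬ G.Adj x a := fun e => hP.right_mem.2 ((h.right.adj_right_iff a haB).1 e).symm
  have hprism := isPrism_union h.indPath_insert (h.right.indPath_insert hQ₁ hP₁)
    (h.right.swap.indPath_insert (sdiff_subset.trans hQ₂) hP.symm)
    (fun e => h.bridge.notMem_left p rfl (e ▸ h.bridge.indPath.right_mem))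
    (fun e => h.right.isConnector.notMem_left (e ▸ haB))
    (fun e => h.right.isConnector.notMem_right (e ▸ hcB)) h.left.adj_left.symm
    h.swap.left.adj_left.symm h.adj ((hs a haB).2 (Or.inl rfl)) ((hs c hcB).2 (Or.inr rfl))
    ((hc c hcmem.1).2 rfl) ?_ ?_ ?_
  · have hset : insert v (insert x ({p} ∪ (R ∪ B))) =
        insert p R ∪ (insert v Q₁ ∪ insert x (Q₂ \ {a})) := by grind
    rwa [hset]
  · grind
  · intro y hy z hz
    obtain ⟨hyz, hadj'⟩ := hcx y hy z (insert_subset_insert (sdiff_subset.trans hQ₂) hz)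
    refine ⟨hyz, fun e => (hadj' e).imp_right ?_⟩
    rintro ⟨rfl, hzB, hsz⟩
    obtain rfl | rfl := (hs z hzB).1 hsz
    · exact (hz.elim (fun e => h.right.isConnector.notMem_right (e ▸ haB)) fun hz => hz.2 rfl).elim
    · exact ⟨rfl, rfl⟩
  · have hxB := h.right.isConnector.notMem_right
    grind [G.adj_comm]

theorem false_of_adj_of_ne [Finite V] (h : BridgedPair G v x {p} R B p p r s p' q')
    (hP₁ : IndPath G p' a Q₁) (hun : Q₁ ∪ Q₂ = B)
    (hint : ∀ y ∈ Q₁, y ∈ Q₂ → y = a) (hsa : G.Adj s a) (hP : IndPath G c q' (Q₂ \ {a})) {z : V}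
    (hz : z ∈ Q₂ \ {a}) (hsz : G.Adj s z) (hzc : z ≠ c) : False := by
  have hQ₁ : Q₁ ⊆ B := hun ▸ subset_union_left
  have hQ₂ : Q₂ ⊆ B := hun ▸ subset_union_right
  obtain ⟨Q', hQ', hP', hcQ'⟩ := hP.exists_suffix hz
  have hc := hP.left_mem
  have hs := h.bridge.indPath.right_mem
  have hRQ : Conn G (R ∪ (Q₁ ∪ Q')) := by
    rw [← union_assoc]
    exact (h.bridge.indPath.conn.union hP₁.conn ⟨s, hs, a, hP₁.right_mem, Or.inr hsa⟩).union
      hP'.conn ⟨s, Or.inl hs, z, hP'.left_mem, Or.inr hsz⟩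
  have hEB : R ∪ (Q₁ ∪ Q') ⊆ R ∪ B :=
    union_subset_union_right R (union_subset hQ₁ (hQ'.trans (sdiff_subset.trans hQ₂)))
  refine h.false_of_joins (E := R ∪ (Q₁ ∪ Q')) (X := R) hEB (hQ₂ hc.1) ?_ subset_union_right rfl
    (h.bridge.notMem_left p rfl)
    (h.left.indPath.conn.union hRQ (h.bridge.touch_left.mono subset_rfl subset_union_left))
    h.conn_union_right ⟨hRQ, ⟨p', Or.inr (Or.inl hP₁.left_mem), h.right.adj_left⟩,
      q', Or.inr (Or.inr hP'.right_mem), h.swap.right.adj_left⟩ subset_union_right hEB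
  rintro (hcR | hcQ₁ | hcQ)
  exacts [h.bridge.notMem_right c (hQ₂ hc.1) hcR, hc.2 (hint c hcQ₁ hc.1), hzc (hcQ' hcQ)]

theorem isSolidGraph_of_eq [Finite V] (h : BridgedPair G v x A R B p p r s p' q')
    (hv : ∀ t ∈ R, ¬ G.Adj v t) (hx : ∀ t ∈ R, ¬ G.Adj x t) :
    IsSolidGraph (G.induce (insert v (insert x (A ∪ (R ∪ B))))) := by
  obtain rfl := h.left.indPath.eq_singleton
  obtain ⟨a, Q₁, Q₂, hP₁, hP₂, hun, ha, hint, hadj⟩ :=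
    h.right.indPath.exists_split (S := G.neighborSet s) h.bridge.exists_right
  have hsa : G.Adj s a := (ha.ge rfl).2
  have hsQ₁ : ∀ z ∈ Q₁, G.Adj s z → z = a := fun z hz hsz => ha.le ⟨hz, hsz⟩
  by_cases hsQ₂ : ∀ z ∈ Q₂, G.Adj s z → z = a
  · exact Or.inr (Or.inr (Or.inl (h.isStamp hv hx hP₁ hP₂ hun hint hadj (by grind))))
  push Not at hsQ₂
  obtain ⟨z, hz, hsz, hza⟩ := hsQ₂
  obtain ⟨-, c, hac, hP, hc⟩ := hP₂.eq_singleton_or_exists_tail.resolve_left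
    fun e => hza (e.2.le hz)
  have hs : ∀ y ∈ Q₂, G.Adj s y → y = a ∨ y = c := fun y hy hsy =>
    or_iff_not_imp_left.2 fun hya => by_contra fun hyc =>
      h.false_of_adj_of_ne hP₁ hun hint hsa hP ⟨hy, hya⟩ hsy hyc
  obtain rfl := (hs z hz hsz).resolve_left hza
  exact Or.inr (Or.inr (Or.inr (h.isPrism hv hx hP₁ hP₂ hun hint hadj hP (by grind) (by grind))))

theorem isSolidGraph [Finite V] (h : BridgedPair G v x A R B p q r s p' q') :
    IsSolidGraph (G.induce (insert v (insert x (A ∪ (R ∪ B))))) := by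
  by_cases hv : ∃ t ∈ R, G.Adj v t
  · obtain ⟨t, ht, hvt⟩ := hv
    exact Or.inl (h.isPyramid (fun y => h.eq_of_adj ht hvt) (fun z => h.flip.eq_of_adj ht hvt)
      fun b => h.not_adj_of_adj ht hvt)
  by_cases hx : ∃ t ∈ R, G.Adj x t
  · obtain ⟨t, ht, hxt⟩ := hx
    rw [insert_comm]
    exact Or.inl (h.swap.isPyramid (fun y => h.swap.eq_of_adj ht hxt)
      (fun z => h.swap.flip.eq_of_adj ht hxt) fun b => h.swap.not_adj_of_adj ht hxt)
  push Not at hv hx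
  have hor {p q p' q' v x : V} (h : BridgedPair G v x A R B p q r s p' q') :
      (∀ y ∈ A, G.Adj r y → y = q) ∨ ∀ z ∈ B, G.Adj s z → z = p' := by
    by_contra! hcon
    obtain ⟨⟨y, hy, hry, hyq⟩, z, hz, hsz, hzp⟩ := hcon
    exact hzp (h.eq_of_adj_of_ne hy hyq hry hz hsz)
  obtain ⟨y, hy, hry⟩ := h.bridge.exists_left
  obtain ⟨z, hz, hsz⟩ := h.bridge.exists_right
  obtain hq | hp' := hor h <;> obtain hp | hq' := hor h.swap
  · obtain rfl := (hp y hy hry).symm.trans (hq y hy hry)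
    exact h.isSolidGraph_of_eq hv hx
  · rw [insert_comm]
    exact Or.inl (h.swap.isPyramid hq hq' hv)
  · exact Or.inl (h.isPyramid hp hp' hx)
  · obtain rfl := (hp' z hz hsz).symm.trans (hq' z hz hsz)
    rw [union_union_rev]
    exact h.flip.isSolidGraph_of_eq hv hx

end BridgedPair

theorem isSolidGraph_of_not_linked [Finite V] {v x : V} {D Q Q' : Set V} (hD : Conn G D)
    (hv : v ∉ D) (hx : x ∉ D) (hvx : G.Adj v x) (hQ : IsConnector G v x Q)
    (hQ' : IsConnector G v x Q') (hQD : Q ⊆ D) (hQD' : Q' ⊆ D) (hl : ¬ Linked G v x D Q Q') :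
    IsSolidGraph (G.induce (insert v (insert x D))) := by
  have hfull {E : Set V} (hE : Conn G E) (hED : E ⊆ D) (hQE : Q ⊆ E) (hQE' : Q' ⊆ E) : E = D :=
    hED.eq_or_ssubset.resolve_right fun hss => hl (linked_of_subset hQ hQ' hss hE hQE hQE')
  by_cases ht : Touch G Q Q'
  · have hu := hQ.joins.conn.union hQ'.joins.conn ht
    obtain rfl := hfull hu (union_subset hQD hQD') subset_union_left subset_union_right
    exact isSolidGraph_of_touch hvx hQ hQ' ht hl
  obtain ⟨R, hRD, r, s, hR⟩ :=
    hD.exists_bridge hQ.joins.conn.nonempty hQ'.joins.conn.nonempty hQD hQD' ht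
  obtain rfl := hfull (hQ.joins.conn.union (union_comm Q' R ▸ hR.symm.conn_union hQ'.joins.conn)
      (hR.touch_left.mono subset_rfl subset_union_left))
    (union_subset hQD (union_subset hRD hQD')) subset_union_left
    (subset_union_right.trans subset_union_right)
  obtain ⟨p, q, hP, hp, hq⟩ := hQ.exists_indPath
  obtain ⟨p', q', hP', hp', hq'⟩ := hQ'.exists_indPath
  exact BridgedPair.isSolidGraph
    { adj := hvx
      left := ⟨hQ, hP, hp, hq⟩
      right := ⟨hQ', hP', hp', hq'⟩
      bridge := hR
      notMem_left := fun h => hv (Or.inr (Or.inl h))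
      notMem_right := fun h => hx (Or.inr (Or.inl h))
      not_touch := ht
      not_linked := hl }

end Bridges

/-! ### Counting connectors -/

section Counting

theorem card_le_card_add_card {α β γ : Type*} [Finite α] [Finite β] [Finite γ] (p : β → α × α)
    (c : γ → α) (h : ∀ φ : α → ℚ, (∀ i, φ (p i).1 = φ (p i).2) → (∀ k, φ (c k) = 0) → φ = 0) :
    Nat.card α ≤ Nat.card β + Nat.card γ := by
  have := Fintype.ofFinite α
  have := Fintype.ofFinite β
  have := Fintype.ofFinite γ
  let ev (a : α) : (α → ℚ) →ₗ[ℚ] ℚ := LinearMap.proj a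
  let Φ : (α → ℚ) →ₗ[ℚ] (β ⊕ γ → ℚ) :=
    LinearMap.pi (Sum.elim (fun i => ev (p i).1 - ev (p i).2) fun k => ev (c k))
  have hΦ : Function.Injective Φ := (injective_iff_map_eq_zero Φ).2 fun φ hφ =>
    h φ (fun i => sub_eq_zero.1 (congrFun hφ (Sum.inl i))) fun k => congrFun hφ (Sum.inr k)
  simpa [Nat.card_eq_fintype_card] using LinearMap.finrank_le_finrank_of_injective hΦ

variable {V : Type*} {G : SimpleGraph V} {v x : V} {W : Set V}

/-- The connectors of `v` and `x` that lie in `W`. -/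
def connectors (G : SimpleGraph V) (v x : V) (W : Set V) : Set (Set V) :=
  {Q | Q ⊆ W ∧ IsConnector G v x Q}

/-- The components of the graph induced on `W` that contain neighbours of both `v` and `x`. -/
def commonComps (G : SimpleGraph V) (v x : V) (W : Set V) : Set (Set V) :=
  {K ∈ comps G W | (K ∩ G.neighborSet v).Nonempty ∧ (K ∩ G.neighborSet x).Nonempty}

/-- A pair of connectors in `D` that are not linked in `D`. -/
structure UnlinkedPair (G : SimpleGraph V) (v x : V) (D : Set V) (P : Set V × Set V) : Prop where
  fst_mem : P.1 ∈ connectors G v x D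
  snd_mem : P.2 ∈ connectors G v x D
  not_linked : ¬ Linked G v x D P.1 P.2

/-- The connected subsets of `W` in which some two connectors are not linked. -/
def unlinkedSets (G : SimpleGraph V) (v x : V) (W : Set V) : Set (Set V) :=
  {D | D ⊆ W ∧ Conn G D ∧ ∃ P, UnlinkedPair G v x D P}

theorem connectors_mono {W' : Set V} (h : W ⊆ W') : connectors G v x W ⊆ connectors G v x W' :=
  fun _ hQ => ⟨hQ.1.trans h, hQ.2⟩

theorem Linked.apply_eq {α : Type*} {D Q Q' : Set V} {φ : Set V → α} (h : Linked G v x D Q Q')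
    (hφ : ∀ E ⊂ D, Conn G E → ∀ Q ∈ connectors G v x E, ∀ Q' ∈ connectors G v x E, φ Q = φ Q') :
    φ Q = φ Q' :=
  Setoid.eqvGen_le (s := Setoid.ker φ)
    (fun Q Q' ⟨hQ, hQ', E, hED, hE, hQE, hQE'⟩ => hφ E hED hE Q ⟨hQE, hQ⟩ Q' ⟨hQE', hQ'⟩) h

/-- By `exists_linked_of_three` there are at most two classes of linked connectors in a set, so one
equation between unlinked connectors settles that set. -/
theorem Conn.apply_eq_of_unlinkedPair [Finite V] {α : Type*} (hv : v ∉ W) (hx : x ∉ W)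
    {φ : Set V → α}
    (hφ : ∀ D ∈ unlinkedSets G v x W, ∃ P, UnlinkedPair G v x D P ∧ φ P.1 = φ P.2) {D : Set V}
    (hD : Conn G D) (hDW : D ⊆ W) :
    ∀ Q ∈ connectors G v x D, ∀ Q' ∈ connectors G v x D, φ Q = φ Q' := by
  induction D using WellFoundedLT.induction with
  | ind D ih =>
    have hlink {Q Q' : Set V} (hl : Linked G v x D Q Q') : φ Q = φ Q' :=
      hl.apply_eq fun E hE hEc => ih E hE hEc (hE.subset.trans hDW)
    by_contra! hcon
    obtain ⟨Q, hQ, Q', hQ', hne⟩ := hcon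
    obtain ⟨⟨R, R'⟩, hR, heq⟩ := hφ D ⟨hDW, hD, (Q, Q'), hQ, hQ', fun hl => hne (hlink hl)⟩
    have hall : ∀ P ∈ connectors G v x D, φ P = φ R := by
      intro P hP
      have hmem : ∀ i, (![P, R, R'] : Fin 3 → Set V) i ∈ connectors G v x D := by
        intro i
        fin_cases i
        exacts [hP, hR.fst_mem, hR.snd_mem]
      obtain ⟨i, j, hij, hl⟩ := exists_linked_of_three hD (fun h => hv (hDW h))
        (fun h => hx (hDW h)) _ (fun i => (hmem i).2) fun i => (hmem i).1
      have hRR := hR.not_linked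
      have hRR' : ¬ Linked G v x D R' R := fun hl => hRR hl.symm
      have hφl := hlink hl
      fin_cases i <;> fin_cases j <;> simp_all
    exact hne ((hall Q hQ).trans (hall Q' hQ').symm)

theorem exists_mem_connectors_of_mem_commonComps [Finite V] (hv : v ∉ W) (hx : x ∉ W) {K : Set V}
    (hK : K ∈ commonComps G v x W) : ∃ Q ∈ connectors G v x W, Q ⊆ K := by
  obtain ⟨hK, hKv, hKx⟩ := hK
  obtain ⟨Q, hQK, hQ⟩ := Joins.exists_isConnector_subset ⟨hK.1, hKv, hKx⟩
    (fun h => hv (hK.2.subset h)) fun h => hx (hK.2.subset h)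
  exact ⟨Q, ⟨hQK.trans hK.2.subset, hQ⟩, hQK⟩

theorem exists_mem_commonComps_of_mem_connectors {Q : Set V} (hQ : Q ∈ connectors G v x W) :
    ∃ K ∈ commonComps G v x W, Q ⊆ K := by
  obtain ⟨hQW, hQ⟩ := hQ
  obtain ⟨hconn, ⟨a, ha, hva⟩, b, hb, hxb⟩ := hQ.joins
  obtain ⟨K, hK, haK⟩ := exists_mem_comps (G := G) (hQW ha)
  have hQK := hconn.subset_of_mem_comps hQW hK ha haK
  exact ⟨K, ⟨hK, ⟨a, haK, hva⟩, b, hQK hb, hxb⟩, hQK⟩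

theorem ncard_connectors_le_ncard_unlinkedSets_add [Finite V] (hv : v ∉ W) (hx : x ∉ W) :
    (connectors G v x W).ncard ≤
      (unlinkedSets G v x W).ncard + (commonComps G v x W).ncard := by
  have hpair (D : unlinkedSets G v x W) : ∃ P : connectors G v x W × connectors G v x W,
      UnlinkedPair G v x D (P.1, P.2) := by
    obtain ⟨D, hDW, -, ⟨Q, Q'⟩, h⟩ := D
    exact ⟨(⟨Q, connectors_mono hDW h.fst_mem⟩, ⟨Q', connectors_mono hDW h.snd_mem⟩), h⟩
  have hconn (K : commonComps G v x W) : ∃ Q : connectors G v x W, Q.1 ⊆ K := by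
    obtain ⟨Q, hQ, hQK⟩ := exists_mem_connectors_of_mem_commonComps hv hx K.2
    exact ⟨⟨Q, hQ⟩, hQK⟩
  choose p hp using hpair
  choose c hc using hconn
  simp only [← Nat.card_coe_set_eq]
  refine card_le_card_add_card p c fun φ hφp hφc => funext fun Q => ?_
  obtain ⟨K, hK, hQK⟩ := exists_mem_commonComps_of_mem_connectors Q.2
  have hext := Subtype.val_injective.extend_apply φ 0
  have heq := hK.1.1.apply_eq_of_unlinkedPair hv hx (φ := Function.extend Subtype.val φ 0)
    (fun D hD => ⟨_, hp ⟨D, hD⟩, by rw [hext, hext, hφp]⟩) hK.1.2.subset Q ⟨hQK, Q.2.2⟩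
    (c ⟨K, hK⟩) ⟨hc ⟨K, hK⟩, (c ⟨K, hK⟩).2.2⟩
  rwa [hext, hext, hφc] at heq

theorem ncard_connectors_le [Finite V] (hv : v ∉ W) (hx : x ∉ W) (hvx : G.Adj v x) :
    (connectors G v x W).ncard ≤
      {D | D ⊆ W ∧ IsSolidGraph (G.induce (insert v (insert x D)))}.ncard +
        (commonComps G v x W).ncard := by
  refine (ncard_connectors_le_ncard_unlinkedSets_add hv hx).trans
    (Nat.add_le_add_right (ncard_le_ncard ?_) _)
  rintro D ⟨hDW, hD, P, h⟩
  exact ⟨hDW, isSolidGraph_of_not_linked hD (fun h => hv (hDW h)) (fun h => hx (hDW h)) hvx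
    h.fst_mem.2 h.snd_mem.2 h.fst_mem.1 h.snd_mem.1 h.not_linked⟩

end Counting

/-! ### The excess -/

section Components

variable {V : Type*} {G : SimpleGraph V} {v x : V} {W : Set V}

/-- The components of the graph induced on `W` that contain a neighbour of `v`. -/
def nearComps (G : SimpleGraph V) (v : V) (W : Set V) : Set (Set V) :=
  {K ∈ comps G W | (K ∩ G.neighborSet v).Nonempty}

theorem exists_comps_insert_eq (hx : x ∉ W) :
    ∃ L, x ∈ L ∧ comps G (insert x W) = insert L (comps G W \ nearComps G x W) := by
  obtain ⟨L, hL, hxL⟩ := exists_mem_comps (G := G) (mem_insert x W)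
  refine ⟨L, hxL, ext fun K => ⟨fun hK => ?_, ?_⟩⟩
  · by_cases hxK : x ∈ K
    · exact Or.inl (comps_eq_of_mem hK hL hxK hxL)
    · refine Or.inr ⟨⟨hK.1, (subset_insert_iff_of_notMem hxK).1 hK.2.subset,
        fun a ha b hb => hK.2.mem_of_adj a ha b (Or.inr hb)⟩, ?_⟩
      rintro ⟨-, a, ha, hxa⟩
      exact hxK (hK.2.mem_of_adj a ha x (Or.inl rfl) hxa.symm)
  · rintro (rfl | ⟨hK, hn⟩)
    · exact hL
    · refine ⟨hK.1, hK.2.subset.trans (subset_insert _ _), ?_⟩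
      rintro a ha b (rfl | hb) hab
      · exact absurd ⟨hK, a, ha, hab.symm⟩ hn
      · exact hK.2.mem_of_adj a ha b hb hab

theorem ncard_comps_insert [Finite V] (hx : x ∉ W) :
    (comps G (insert x W)).ncard + (nearComps G x W).ncard = (comps G W).ncard + 1 := by
  obtain ⟨L, hxL, hL⟩ := exists_comps_insert_eq (G := G) hx
  have hcard := ncard_sdiff_add_ncard_of_subset (s := nearComps G x W) (t := comps G W)
    (sep_subset _ _)
  rw [hL, ncard_insert_of_notMem fun h => hx (h.1.2.subset hxL)]
  omega

theorem nearComps_eq_empty (h : ∀ z ∈ W, ¬ G.Adj v z) : nearComps G v W = ∅ :=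
  eq_empty_of_forall_notMem fun _ ⟨hK, z, hzK, hvz⟩ => h z (hK.2.subset hzK) hvz

theorem ncard_nearComps_insert [Finite V] (hx : x ∉ W) (hvx : G.Adj v x) :
    (nearComps G v (insert x W)).ncard + (commonComps G v x W).ncard =
      (nearComps G v W).ncard + 1 := by
  obtain ⟨L, hxL, hL⟩ := exists_comps_insert_eq (G := G) hx
  have hnear : nearComps G v (insert x W) = insert L (nearComps G v W \ commonComps G v x W) := by
    ext K
    simp only [nearComps, commonComps, hL, mem_sdiff, mem_insert_iff, mem_ofPred_eq]
    constructor
    · tauto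
    · rintro (rfl | h)
      · exact ⟨Or.inl rfl, x, hxL, hvx⟩
      · tauto
  have hcard := ncard_sdiff_add_ncard_of_subset (s := commonComps G v x W) (t := nearComps G v W)
    fun K hK => ⟨hK.1, hK.2.1⟩
  rw [hnear, ncard_insert_of_notMem fun h => hx (h.1.1.2.subset hxL)]
  omega

end Components

section Difference

variable {V : Type*} {a : V} {S : Finset V} {P : Set V → Prop} {h : Set V → ℤ} {B U : Set V}

/-- The iterated difference of a function of vertex sets with respect to all vertices in `S`,
expanded into an alternating sum. -/
def iterDiff (S : Finset V) (h : Set V → ℤ) (U : Set V) : ℤ :=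
  ∑ T ∈ S.powerset, (-1) ^ T.card * h (U \ T)

theorem iterDiff_add (S : Finset V) (g h : Set V → ℤ) :
    iterDiff S (g + h) = iterDiff S g + iterDiff S h :=
  funext fun U => by simp only [iterDiff, Pi.add_apply, mul_add, Finset.sum_add_distrib]

theorem iterDiff_sub (S : Finset V) (g h : Set V → ℤ) :
    iterDiff S (g - h) = iterDiff S g - iterDiff S h :=
  funext fun U => by simp only [iterDiff, Pi.sub_apply, mul_sub, Finset.sum_sub_distrib]

theorem iterDiff_singleton (a : V) (h : Set V → ℤ) (U : Set V) :
    iterDiff {a} h U = h U - h (U \ {a}) := by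
  classical
  rw [iterDiff, show ({a} : Finset V) = insert a ∅ from rfl,
    Finset.sum_powerset_insert (Finset.notMem_empty a)]
  simp [sub_eq_add_neg]

theorem iterDiff_insert [DecidableEq V] (ha : a ∉ S) (h : Set V → ℤ) :
    iterDiff (insert a S) h = iterDiff S (iterDiff {a} h) := by
  funext U
  have hcoe (T : Finset V) : U \ ↑(insert a T) = (U \ T) \ {a} := by
    rw [Finset.coe_insert, insert_eq, union_comm, sdiff_sdiff]
  rw [iterDiff, Finset.sum_powerset_insert ha, ← Finset.sum_add_distrib]
  refine Finset.sum_congr rfl fun T hT => ?_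
  rw [iterDiff_singleton, hcoe,
    Finset.card_insert_of_notMem fun haT => ha (Finset.mem_powerset.1 hT haT)]
  ring

theorem iterDiff_pair [DecidableEq V] {b : V} (hab : a ≠ b) (h : Set V → ℤ) (U : Set V) :
    iterDiff {a, b} h U = h U - h (U \ {a}) - (h (U \ {b}) - h ((U \ {b}) \ {a})) := by
  simp only [iterDiff_insert (Finset.notMem_singleton.2 hab), iterDiff_singleton]

theorem iterDiff_union (hSB : Disjoint (S : Set V) B)
    (hh : ∀ J ⊆ (S : Set V), J.Nonempty → h (B ∪ J) = 0) :
    iterDiff S h (B ∪ S) = (-1) ^ S.card * h B := by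
  rw [iterDiff, Finset.sum_eq_single_of_mem S (Finset.mem_powerset_self S) fun T hT hTS => ?_,
    union_sdiff_right, hSB.symm.sdiff_eq_left]
  have hTS' : T ⊆ S := Finset.mem_powerset.1 hT
  rw [union_sdiff_distrib, (hSB.mono_left (Finset.coe_subset.2 hTS')).symm.sdiff_eq_left,
    hh _ sdiff_subset, mul_zero]
  exact sdiff_nonempty.2 fun hST => hTS (hTS'.antisymm (Finset.coe_subset.1 hST))

/-- The number of subsets of `U` with the property `P`, as a function of `U`. -/
noncomputable def count (P : Set V → Prop) (U : Set V) : ℤ :=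
  ({A | A ⊆ U ∧ P A}.ncard : ℤ)

theorem count_nonneg (P : Set V → Prop) (U : Set V) : 0 ≤ count P U := Int.natCast_nonneg _

theorem count_eq_zero (h : ∀ A ⊆ U, ¬ P A) : count P U = 0 := by
  have hempty : {A | A ⊆ U ∧ P A} = ∅ := eq_empty_of_forall_notMem fun A hA => h A hA.1 hA.2
  simp [count, hempty]

theorem iterDiff_singleton_count [Finite V] (a : V) (P : Set V → Prop) :
    iterDiff {a} (count P) = count fun A => a ∈ A ∧ P A := by
  funext U
  have hsub : {A | A ⊆ U \ {a} ∧ P A} ⊆ {A | A ⊆ U ∧ P A} := fun A hA =>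
    ⟨hA.1.trans sdiff_subset, hA.2⟩
  have hdiff : {A | A ⊆ U ∧ a ∈ A ∧ P A} = {A | A ⊆ U ∧ P A} \ {A | A ⊆ U \ {a} ∧ P A} := by
    ext A
    simp only [mem_sdiff, mem_ofPred_eq, subset_sdiff, disjoint_singleton_right]
    tauto
  have hcard := ncard_sdiff_add_ncard_of_subset hsub
  rw [iterDiff_singleton, count, count, count, hdiff]
  omega

theorem iterDiff_count [Finite V] (S : Finset V) (P : Set V → Prop) :
    iterDiff S (count P) = count fun A => ↑S ⊆ A ∧ P A := by
  classical
  induction S using Finset.induction generalizing P with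
  | empty => funext U; simp [iterDiff]
  | insert a S ha ih =>
    rw [iterDiff_insert ha, iterDiff_singleton_count, ih]
    simp only [Finset.coe_insert, insert_subset_iff, and_left_comm, and_assoc]

end Difference

section Excess

variable {V : Type*} {G : SimpleGraph V} {v x : V} {U W : Set V} {S : Finset V} {k : ℕ}

/-- The number of solids in an induced subgraph. -/
noncomputable def solidCount (G : SimpleGraph V) : Set V → ℤ :=
  count fun A => IsSolidGraph (G.induce A)

/-- The number of induced cycles in an induced subgraph. -/
noncomputable def cycleCount (G : SimpleGraph V) : Set V → ℤ :=
  count fun A => IsCycleGraph (G.induce A)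

/-- The number of cliques of size `k` in an induced subgraph: its vertices for `k = 1` and its edges
for `k = 2`. -/
noncomputable def cliqueCount (G : SimpleGraph V) (k : ℕ) : Set V → ℤ :=
  count fun A => G.IsClique A ∧ A.ncard = k

/-- The number of components of an induced subgraph. -/
noncomputable def compCount (G : SimpleGraph V) (U : Set V) : ℤ := (comps G U).ncard

/-- The quantity `|S(H)| - |C(H)| + |E(H)| - |V(H)| + c(H)` for an induced subgraph `H` of `G`, with
`c(H)` its number of components. -/
noncomputable def excess (G : SimpleGraph V) : Set V → ℤ :=
  solidCount G - cycleCount G + cliqueCount G 2 - cliqueCount G 1 + compCount G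

theorem iterDiff_excess (S : Finset V) (U : Set V) :
    iterDiff S (excess G) U = iterDiff S (solidCount G) U - iterDiff S (cycleCount G) U +
      iterDiff S (cliqueCount G 2) U - iterDiff S (cliqueCount G 1) U +
      iterDiff S (compCount G) U := by
  simp only [excess, iterDiff_add, iterDiff_sub, Pi.add_apply, Pi.sub_apply]

theorem excess_empty_nonneg : 0 ≤ excess G ∅ := by
  have hcycles : cycleCount G ∅ = 0 :=
    count_eq_zero fun A hA hC => hC.conn.nonempty.ne_empty (subset_empty_iff.1 hA)
  have hvertices : cliqueCount G 1 ∅ = 0 := by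
    refine count_eq_zero fun A hA h => ?_
    simp [subset_empty_iff.1 hA] at h
  have hsolids : 0 ≤ solidCount G ∅ := count_nonneg _ ∅
  have hedges : 0 ≤ cliqueCount G 2 ∅ := count_nonneg _ ∅
  have hcomps : 0 ≤ compCount G ∅ := Int.natCast_nonneg _
  simp only [excess, Pi.add_apply, Pi.sub_apply]
  omega

theorem IsCycleGraph.ncard_inter_neighborSet {A : Set V} (h : IsCycleGraph (G.induce A))
    (hv : v ∈ A) : (A ∩ G.neighborSet v).ncard = 2 := by
  obtain ⟨p, q, hpq, hP, hpq'⟩ := h.exists_indPath hv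
  have hpair : A ∩ G.neighborSet v = {p, q} := by
    ext z
    refine ⟨fun hz => (hpq' z hz.1).1 hz.2, ?_⟩
    rintro (rfl | rfl)
    · exact ⟨hP.left_mem.1, (hpq' _ hP.left_mem.1).2 (Or.inl rfl)⟩
    · exact ⟨hP.right_mem.1, (hpq' _ hP.right_mem.1).2 (Or.inr rfl)⟩
  rw [hpair, ncard_pair hpq]

variable [Finite V]

theorem iterDiff_solidCount_nonneg (S : Finset V) (U : Set V) :
    0 ≤ iterDiff S (solidCount G) U := by
  rw [solidCount, iterDiff_count]
  exact count_nonneg _ U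

theorem iterDiff_cycleCount_eq_zero (hv : v ∈ S)
    (h : ∀ A ⊆ U, ↑S ⊆ A → (A ∩ G.neighborSet v).ncard ≠ 2) :
    iterDiff S (cycleCount G) U = 0 := by
  rw [cycleCount, iterDiff_count]
  exact count_eq_zero fun A hAU hA => h A hAU hA.1 (hA.2.ncard_inter_neighborSet (hA.1 hv))

theorem iterDiff_cliqueCount_nonneg (S : Finset V) (k : ℕ) (U : Set V) :
    0 ≤ iterDiff S (cliqueCount G k) U := by
  rw [cliqueCount, iterDiff_count]
  exact count_nonneg _ U

theorem iterDiff_cliqueCount_eq_zero (hk : k < S.card) : iterDiff S (cliqueCount G k) U = 0 := by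
  rw [cliqueCount, iterDiff_count]
  refine count_eq_zero fun A _ hA => hk.not_ge ?_
  rw [← hA.2.2, ← ncard_coe_finset]
  exact ncard_le_ncard hA.1

theorem iterDiff_cliqueCount_eq_one (hS : G.IsClique S) (hk : S.card = k) (hSU : ↑S ⊆ U) :
    iterDiff S (cliqueCount G k) U = 1 := by
  have hS' : {A : Set V | A ⊆ U ∧ ↑S ⊆ A ∧ G.IsClique A ∧ A.ncard = k} = {↑S} := by
    ext A
    refine ⟨fun ⟨_, hSA, _, hA⟩ => ?_, ?_⟩
    · exact (eq_of_subset_of_ncard_le hSA (by rw [hA, ncard_coe_finset, hk])).symm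
    · rintro rfl
      exact ⟨hSU, subset_rfl, hS, by rw [ncard_coe_finset, hk]⟩
  rw [cliqueCount, iterDiff_count, count, hS', ncard_singleton, Nat.cast_one]

theorem iterDiff_singleton_compCount (hv : v ∉ W) :
    iterDiff {v} (compCount G) (insert v W) = 1 - (nearComps G v W).ncard := by
  have hcard := ncard_comps_insert (G := G) hv
  rw [iterDiff_singleton, insert_sdiff_of_mem _ (mem_singleton v), sdiff_singleton_eq_self hv,
    compCount, compCount]
  omega

theorem iterDiff_singleton_compCount_eq_one (hv : v ∉ W) (h : ∀ z ∈ W, ¬ G.Adj v z) :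
    iterDiff {v} (compCount G) (insert v W) = 1 := by
  rw [iterDiff_singleton_compCount hv, nearComps_eq_empty h, ncard_empty]
  rfl

theorem iterDiff_pair_compCount [DecidableEq V] (hv : v ∉ W) (hx : x ∉ W) (hvx : G.Adj v x) :
    iterDiff {v, x} (compCount G) (insert v (insert x W)) = (commonComps G v x W).ncard - 1 := by
  have hxW : x ∉ insert v W := fun h => h.elim hvx.ne' hx
  have hvW : v ∉ insert x W := fun h => h.elim hvx.ne hv
  have hcard := ncard_nearComps_insert hx hvx
  rw [iterDiff_insert (Finset.notMem_singleton.2 hvx.ne), iterDiff_singleton,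
    iterDiff_singleton_compCount hvW, insert_comm, insert_sdiff_of_mem _ (mem_singleton x),
    sdiff_singleton_eq_self hxW, iterDiff_singleton_compCount hv]
  omega

theorem iterDiff_pair_cycleCount_le [DecidableEq V] (hvx : G.Adj v x) :
    iterDiff {v, x} (cycleCount G) (insert v (insert x W)) ≤ (connectors G v x W).ncard := by
  rw [cycleCount, iterDiff_count, count, Nat.cast_le, Finset.coe_pair]
  refine ncard_le_ncard_of_injOn (fun A => A \ {v, x}) ?_ ?_
  · rintro A ⟨hA, hvxA, hC⟩
    refine ⟨?_, hC.isConnector (hvxA (Or.inl rfl)) (hvxA (Or.inr rfl)) hvx⟩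
    rwa [sdiff_subset_iff, insert_union, singleton_union]
  · rintro A ⟨-, hA, -⟩ B ⟨-, hB, -⟩ (h : A \ {v, x} = B \ {v, x})
    rw [← sdiff_union_of_subset hA, h, sdiff_union_of_subset hB]

theorem le_iterDiff_pair_solidCount [DecidableEq V] (hv : v ∉ W) (hx : x ∉ W) :
    {D | D ⊆ W ∧ IsSolidGraph (G.induce (insert v (insert x D)))}.ncard ≤
      iterDiff {v, x} (solidCount G) (insert v (insert x W)) := by
  rw [solidCount, iterDiff_count, count, Nat.cast_le, Finset.coe_pair]
  have hdisj {D : Set V} (hD : D ⊆ W) : Disjoint {v, x} D :=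
    disjoint_left.2 <| by rintro z (rfl | rfl) hz; exacts [hv (hD hz), hx (hD hz)]
  refine ncard_le_ncard_of_injOn (fun D => insert v (insert x D)) ?_ ?_
  · rintro D ⟨hD, hs⟩
    exact ⟨insert_subset_insert (insert_subset_insert hD),
      insert_subset_insert (singleton_subset_iff.2 (mem_insert x D)), hs⟩
  · rintro A ⟨hA, -⟩ B ⟨hB, -⟩ (h : insert v (insert x A) = insert v (insert x B))
    simp only [← singleton_union (a := x), ← insert_union] at h
    rw [← union_sdiff_cancel_left (hdisj hA).le_bot, h, union_sdiff_cancel_left (hdisj hB).le_bot]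

theorem iterDiff_pair_excess_nonneg [DecidableEq V] (hv : v ∈ U) (hx : x ∈ U) (hvx : G.Adj v x) :
    0 ≤ iterDiff {v, x} (excess G) U := by
  have hvxU : {v, x} ⊆ U := insert_subset hv (singleton_subset_iff.2 hx)
  obtain ⟨W, hvW, hxW, rfl⟩ : ∃ W, v ∉ W ∧ x ∉ W ∧ U = insert v (insert x W) := by
    refine ⟨U \ {v, x}, fun h => h.2 (Or.inl rfl), fun h => h.2 (Or.inr rfl), ?_⟩
    rw [← singleton_union (a := x), ← insert_union, union_sdiff_cancel hvxU]
  have hcard : ({v, x} : Finset V).card = 2 := Finset.card_pair hvx.ne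
  have hclique : G.IsClique ({v, x} : Finset V) := by
    rw [Finset.coe_pair, SimpleGraph.isClique_pair]
    exact fun _ => hvx
  have hedges : iterDiff {v, x} (cliqueCount G 2) (insert v (insert x W)) = 1 :=
    iterDiff_cliqueCount_eq_one hclique hcard (by rwa [Finset.coe_pair])
  have hvertices : iterDiff {v, x} (cliqueCount G 1) (insert v (insert x W)) = 0 :=
    iterDiff_cliqueCount_eq_zero (by omega)
  have hcycles := iterDiff_pair_cycleCount_le (W := W) hvx
  have hsolids := le_iterDiff_pair_solidCount (G := G) hvW hxW
  have hcomps := iterDiff_pair_compCount hvW hxW hvx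
  have hconnectors := ncard_connectors_le hvW hxW hvx
  rw [iterDiff_excess]
  omega

theorem excess_sdiff_singleton_le_of_inter_eq_empty (hv : v ∈ U) (hU : U ∩ G.neighborSet v = ∅) :
    excess G (U \ {v}) ≤ excess G U := by
  have hvU : v ∉ U \ {v} := fun h => h.2 rfl
  have hcycles : iterDiff {v} (cycleCount G) U = 0 := by
    refine iterDiff_cycleCount_eq_zero (Finset.mem_singleton_self v) fun A hA _ => ?_
    rw [subset_empty_iff.1 ((inter_subset_inter_left _ hA).trans hU.subset), ncard_empty]
    decide
  have hvertices : iterDiff {v} (cliqueCount G 1) U = 1 :=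
    iterDiff_cliqueCount_eq_one (by simp) (Finset.card_singleton v) (by simpa using hv)
  have hcomps : iterDiff {v} (compCount G) U = 1 := by
    rw [← insert_sdiff_self_of_mem hv]
    exact iterDiff_singleton_compCount_eq_one hvU fun z hz hvz => hU.subset ⟨hz.1, hvz⟩
  have hsolids := iterDiff_solidCount_nonneg (G := G) {v} U
  have hedges := iterDiff_cliqueCount_nonneg (G := G) {v} 2 U
  rw [← sub_nonneg, ← iterDiff_singleton, iterDiff_excess]
  omega

theorem excess_sdiff_singleton_le (hv : v ∈ U) : excess G (U \ {v}) ≤ excess G U := by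
  classical
  induction U using WellFoundedLT.induction with
  | ind U ih =>
    obtain hU | ⟨x, hx, hvx⟩ := (U ∩ G.neighborSet v).eq_empty_or_nonempty
    · exact excess_sdiff_singleton_le_of_inter_eq_empty hv hU
    · have hpair := iterDiff_pair_excess_nonneg hv hx hvx
      rw [iterDiff_pair hvx.ne] at hpair
      linarith [ih (U \ {x}) (sdiff_singleton_ssubset.2 hx) ⟨hv, hvx.ne⟩]

theorem monotone_excess : Monotone (excess G) := by
  intro U' U h
  induction U using WellFoundedLT.induction with
  | ind U ih =>
    obtain rfl | ⟨-, v, hv, hvU'⟩ := h.eq_or_ssubset.imp_right ssubset_iff_exists.1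
    · rfl
    · exact (ih (U \ {v}) (sdiff_singleton_ssubset.2 hv) (subset_sdiff_singleton h hvU')).trans
        (excess_sdiff_singleton_le hv)

theorem excess_nonneg (U : Set V) : 0 ≤ excess G U :=
  excess_empty_nonneg.trans (monotone_excess (empty_subset U))

theorem excess_eq_zero (h : excess G univ = 0) : excess G = 0 :=
  funext fun U => ((monotone_excess (subset_univ U)).trans_eq h).antisymm (excess_nonneg U)

end Excess

/-! ### Colouring -/

section Degenerate

variable {V : Type*} {G : SimpleGraph V} {v : V} {C J K U W : Set V}

/-- Two vertices that are adjacent or both have neighbours in `C`, so that a connected `C` makes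
them connected in `C ∪ {a, b}`. -/
def AdjThrough (G : SimpleGraph V) (C : Set V) (a b : V) : Prop :=
  G.Adj a b ∨ (∃ z ∈ C, G.Adj a z) ∧ ∃ z ∈ C, G.Adj b z

theorem AdjThrough.exists_conn (hC : C.Nonempty → Conn G C) {a b : V} (h : AdjThrough G C a b) :
    ∃ S ⊆ insert a (insert b C), Conn G S ∧ a ∈ S ∧ b ∈ S := by
  obtain hab | ⟨⟨z, hz, haz⟩, y, hy, hby⟩ := h
  · exact ⟨{a, b}, insert_subset_insert (singleton_subset_iff.2 (mem_insert b C)),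
      (conn_singleton b).insert_adj rfl hab, Or.inl rfl, Or.inr rfl⟩
  · exact ⟨insert a (insert b C), subset_rfl,
      ((hC ⟨z, hz⟩).insert_adj hy hby).insert_adj (Or.inr hz) haz, Or.inl rfl, Or.inr (Or.inl rfl)⟩

theorem exists_nearComps_eq_singleton (hC : C.Nonempty → Conn G C) (hvC : ∀ z ∈ C, ¬ G.Adj v z)
    (hvJ : ∀ z ∈ J, G.Adj v z) (hJ : J.Nonempty) (hCJ : J.Pairwise (AdjThrough G C)) :
    ∃ K, nearComps G v (C ∪ J) = {K} := by
  obtain ⟨a, ha⟩ := hJ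
  obtain ⟨K, hK, haK⟩ := exists_mem_comps (G := G) (show a ∈ C ∪ J from Or.inr ha)
  refine ⟨K, eq_singleton_iff_unique_mem.2 ⟨⟨hK, a, haK, hvJ a ha⟩, ?_⟩⟩
  rintro K' ⟨hK', b, hbK, hvb⟩
  have hb : b ∈ J := (hK'.2.subset hbK).resolve_left fun h => hvC b h hvb
  obtain rfl | hab := eq_or_ne a b
  · exact comps_eq_of_mem hK' hK hbK haK
  · obtain ⟨S, hS, hSconn, haS, hbS⟩ := (hCJ ha hb hab).exists_conn hC
    have hSU : S ⊆ C ∪ J := hS.trans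
      (insert_subset (Or.inr ha) (insert_subset (Or.inr hb) subset_union_left))
    exact comps_eq_of_mem hK' hK hbK (hSconn.subset_of_mem_comps hSU hK haS haK hbS)

theorem iterDiff_insert_compCount_eq_one [Finite V] [DecidableEq V] (hC : C.Nonempty → Conn G C)
    (hv : v ∉ C) (hvC : ∀ z ∈ C, ¬ G.Adj v z) {F : Finset V} (hF : Even F.card)
    (hFC : Disjoint (F : Set V) C) (hvF : ∀ z ∈ F, G.Adj v z)
    (hCF : (F : Set V).Pairwise (AdjThrough G C)) :
    iterDiff (insert v F) (compCount G) (insert v C ∪ F) = 1 := by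
  have hvF' : v ∉ F := fun h => (hvF v h).ne rfl
  rw [iterDiff_insert hvF', iterDiff_union, hF.neg_one_pow, one_mul,
    iterDiff_singleton_compCount_eq_one hv hvC]
  · exact disjoint_insert_right.2 ⟨hvF', hFC⟩
  · intro J hJF hJ
    have hvJ : v ∉ C ∪ J := fun h => h.elim hv fun h => hvF' (hJF h)
    obtain ⟨K, hK⟩ := exists_nearComps_eq_singleton hC hvC (fun z hz => hvF z (hJF hz)) hJ
      (hCF.mono hJF)
    rw [insert_union, iterDiff_singleton_compCount hvJ, hK, ncard_singleton]
    rfl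

theorem excess_ne_zero [Finite V] (hC : C.Nonempty → Conn G C) (hv : v ∉ C)
    (hvC : ∀ z ∈ C, ¬ G.Adj v z) {F : Finset V} (hF : Even F.card) (hF2 : 2 < F.card)
    (hFC : Disjoint (F : Set V) C) (hvF : ∀ z ∈ F, G.Adj v z)
    (hCF : (F : Set V).Pairwise (AdjThrough G C)) : excess G ≠ 0 := by
  classical
  intro h0
  have hcard : F.card ≤ (insert v F).card := Finset.card_le_card (Finset.subset_insert v F)
  have hcycles : iterDiff (insert v F) (cycleCount G) (insert v C ∪ F) = 0 := by
    refine iterDiff_cycleCount_eq_zero (Finset.mem_insert_self v F) fun A _ hA h => ?_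
    have hFA : ↑F ⊆ A ∩ G.neighborSet v := fun z hz => ⟨hA (Finset.mem_insert_of_mem hz), hvF z hz⟩
    have hle := ncard_le_ncard hFA
    rw [ncard_coe_finset] at hle
    omega
  have hvertices : iterDiff (insert v F) (cliqueCount G 1) (insert v C ∪ F) = 0 :=
    iterDiff_cliqueCount_eq_zero (by omega)
  have hedges : iterDiff (insert v F) (cliqueCount G 2) (insert v C ∪ F) = 0 :=
    iterDiff_cliqueCount_eq_zero (by omega)
  have hsolids := iterDiff_solidCount_nonneg (G := G) (insert v F) (insert v C ∪ F)
  have hcomps := iterDiff_insert_compCount_eq_one hC hv hvC hF hFC hvF hCF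
  have hexcess := iterDiff_excess (G := G) (insert v F) (insert v C ∪ F)
  have hzero : iterDiff (insert v F) (excess G) (insert v C ∪ F) = 0 := by simp [h0, iterDiff]
  omega

/-- `W` is a pocket of the graph induced on `U`, attached to the rest through `K` only, and `K` is
tied together by a connected set `C` off `W` (empty at the start). A pocket that is not a clique
contains a smaller one, and the vertices of a clique pocket have small degree. -/
structure IsPocket (G : SimpleGraph V) (U C K W : Set V) : Prop where
  conn : C.Nonempty → Conn G C
  notMem_of_mem_left : ∀ k ∈ K, k ∉ C
  notMem_of_mem : ∀ w ∈ W, w ∉ C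
  exists_adj : ∀ k ∈ K, ∃ z ∈ C, G.Adj k z
  adj : ∀ w ∈ W, ∀ k ∈ K, G.Adj w k
  not_adj : ∀ w ∈ W, ∀ z ∈ C, ¬ G.Adj w z
  mem_of_adj : ∀ w ∈ W, ∀ z ∈ U, G.Adj w z → z ∈ W ∪ K

theorem isPocket_empty (U : Set V) : IsPocket G U ∅ ∅ U where
  conn h := absurd h not_nonempty_empty
  notMem_of_mem_left _ _ h := h
  notMem_of_mem _ _ h := h
  exists_adj _ h := absurd h (notMem_empty _)
  adj _ _ _ h := absurd h (notMem_empty _)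
  not_adj _ _ _ h := absurd h (notMem_empty _)
  mem_of_adj _ _ _ hz _ := Or.inl hz

theorem IsPocket.exists_ncard_le_of_isClique [Finite V] (h : IsPocket G U C K W)
    (h0 : excess G = 0) (hW : W.Nonempty) (hclique : G.IsClique W) :
    ∃ w ∈ W, (U ∩ G.neighborSet w).ncard ≤ 3 := by
  obtain ⟨v, hv⟩ := hW
  refine ⟨v, hv, ?_⟩
  by_contra! hcon
  obtain ⟨F, hFU, hF⟩ := exists_subset_card_eq hcon
  lift F to Finset V using F.toFinite
  rw [ncard_coe_finset] at hF
  have hFWK : ↑F ⊆ W ∪ K := fun a ha => h.mem_of_adj v hv a (hFU ha).1 (hFU ha).2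
  refine excess_ne_zero h.conn (h.notMem_of_mem v hv) (h.not_adj v hv) (F := F) (hF ▸ by decide)
    (by omega) ?_ (fun a ha => (hFU ha).2) ?_ h0
  · exact disjoint_left.2 fun a ha =>
      (hFWK ha).elim (h.notMem_of_mem a) (h.notMem_of_mem_left a)
  · intro a ha b hb hab
    rcases hFWK ha with ha | ha <;> rcases hFWK hb with hb | hb
    · exact Or.inl (hclique ha hb hab)
    · exact Or.inl (h.adj a ha b hb)
    · exact Or.inl (h.adj b hb a ha).symm
    · exact Or.inr ⟨h.exists_adj a ha, h.exists_adj b hb⟩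

/-- The vertices of `W` outside `C` that have no neighbour in `C`. -/
def farVerts (G : SimpleGraph V) (W C : Set V) : Set V :=
  {w ∈ W \ C | ∀ z ∈ C, ¬ G.Adj w z}

/-- The vertices of `W` outside `C` that have a neighbour in `C`. -/
def nearVerts (G : SimpleGraph V) (W C : Set V) : Set V :=
  {w ∈ W \ C | ∃ z ∈ C, G.Adj w z}

theorem exists_maximal_conn_farVerts_nonempty [Finite V] (hW : ¬ G.IsClique W) :
    ∃ C, Maximal (fun C => Conn G C ∧ C ⊆ W ∧ (farVerts G W C).Nonempty) C := by
  simp only [SimpleGraph.IsClique, Set.Pairwise, not_forall] at hW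
  obtain ⟨a, ha, b, hb, hab, hadj⟩ := hW
  obtain ⟨C, -, hC⟩ := (toFinite _).exists_le_maximal
    (s := {C | Conn G C ∧ C ⊆ W ∧ (farVerts G W C).Nonempty}) (a := {b})
    ⟨conn_singleton b, singleton_subset_iff.2 hb, a, ⟨ha, hab⟩, by rintro z rfl; exact hadj⟩
  exact ⟨C, hC⟩

theorem adj_of_maximal_conn {w k : V}
    (hC : Maximal (fun C => Conn G C ∧ C ⊆ W ∧ (farVerts G W C).Nonempty) C)
    (hw : w ∈ farVerts G W C) (hk : k ∈ nearVerts G W C) : G.Adj w k := by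
  by_contra hwk
  obtain ⟨z, hz, hkz⟩ := hk.2
  refine hk.1.2 (hC.2 ⟨hC.1.1.insert_adj hz hkz, insert_subset hk.1.1 hC.1.2.1, w, ⟨hw.1.1, ?_⟩, ?_⟩
    (subset_insert k C) (mem_insert k C))
  · rintro (rfl | h)
    exacts [hw.2 z hz hkz, hw.1.2 h]
  · rintro y (rfl | hy)
    exacts [hwk, hw.2 y hy]

theorem IsPocket.farVerts {C' : Set V} (h : IsPocket G U C K W)
    (hC' : Maximal (fun C => Conn G C ∧ C ⊆ W ∧ (farVerts G W C).Nonempty) C') :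
    IsPocket G U C' (K ∪ nearVerts G W C') (farVerts G W C') where
  conn _ := hC'.1.1
  notMem_of_mem_left k hk hkC := hk.elim
    (fun hkK => (h.adj k (hC'.1.2.1 hkC) k hkK).ne rfl) fun hk => hk.1.2 hkC
  notMem_of_mem _ hw := hw.1.2
  exists_adj := by
    rintro k (hk | hk)
    · obtain ⟨c, hc⟩ := hC'.1.1.nonempty
      exact ⟨c, hc, (h.adj c (hC'.1.2.1 hc) k hk).symm⟩
    · exact hk.2
  adj w hw k hk := hk.elim (h.adj w hw.1.1 k) (adj_of_maximal_conn hC' hw)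
  not_adj _ hw := hw.2
  mem_of_adj w hw z hz hwz := by
    obtain hzW | hzK := h.mem_of_adj w hw.1.1 z hz hwz
    · have hzC : z ∉ C' := fun hzC => hw.2 z hzC hwz
      by_cases hzK : ∃ y ∈ C', G.Adj z y
      · exact Or.inr (Or.inr ⟨⟨hzW, hzC⟩, hzK⟩)
      · push Not at hzK
        exact Or.inl ⟨⟨hzW, hzC⟩, hzK⟩
    · exact Or.inr (Or.inl hzK)

theorem IsPocket.exists_ncard_le [Finite V] (h : IsPocket G U C K W) (h0 : excess G = 0)
    (hW : W.Nonempty) : ∃ w ∈ W, (U ∩ G.neighborSet w).ncard ≤ 3 := by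
  induction W using WellFoundedLT.induction generalizing C K with
  | ind W ih =>
    by_cases hclique : G.IsClique W
    · exact h.exists_ncard_le_of_isClique h0 hW hclique
    · obtain ⟨C', hC'⟩ := exists_maximal_conn_farVerts_nonempty hclique
      obtain ⟨c, hc⟩ := hC'.1.1.nonempty
      have hlt : GraphSolids.farVerts G W C' ⊂ W :=
        ssubset_iff_exists.2 ⟨fun w hw => hw.1.1, c, hC'.1.2.1 hc, fun hcf => hcf.1.2 hc⟩
      obtain ⟨w, hw, hdeg⟩ := ih _ hlt (h.farVerts hC') hC'.1.2.2
      exact ⟨w, hw.1.1, hdeg⟩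

theorem exists_ncard_inter_neighborSet_le [Finite V] (h0 : excess G = 0) (hU : U.Nonempty) :
    ∃ w ∈ U, (U ∩ G.neighborSet w).ncard ≤ 3 :=
  (isPocket_empty U).exists_ncard_le h0 hU

end Degenerate

section Coloring

variable {V : Type*} {G : SimpleGraph V} {d : ℕ}

theorem exists_coloring_of_sdiff_singleton [Finite V] {U : Set V} {w : V}
    (hw : (U ∩ G.neighborSet w).ncard ≤ d) {c : V → Fin (d + 1)}
    (hc : ∀ a ∈ U \ {w}, ∀ b ∈ U \ {w}, G.Adj a b → c a ≠ c b) :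
    ∃ c' : V → Fin (d + 1), ∀ a ∈ U, ∀ b ∈ U, G.Adj a b → c' a ≠ c' b := by
  classical
  obtain ⟨k, hk⟩ : ∃ k, k ∉ c '' (U ∩ G.neighborSet w) := by
    rw [← ne_univ_iff_exists_notMem]
    intro huniv
    have hle := ncard_image_le (f := c) (U ∩ G.neighborSet w).toFinite
    rw [huniv, ncard_univ, Nat.card_fin] at hle
    omega
  have hk' : ∀ b ∈ U, G.Adj w b → k ≠ c b := fun b hb hwb h => hk ⟨b, ⟨hb, hwb⟩, h.symm⟩
  refine ⟨Function.update c w k, fun a ha b hb hab => ?_⟩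
  obtain rfl | haw := eq_or_ne a w
  · rw [Function.update_self, Function.update_of_ne hab.ne']
    exact hk' b hb hab
  obtain rfl | hbw := eq_or_ne b w
  · rw [Function.update_self, Function.update_of_ne haw]
    exact (hk' a ha hab.symm).symm
  · rw [Function.update_of_ne haw, Function.update_of_ne hbw]
    exact hc a ⟨ha, haw⟩ b ⟨hb, hbw⟩ hab

theorem colorable_of_forall_exists_ncard_le [Finite V]
    (h : ∀ U : Set V, U.Nonempty → ∃ w ∈ U, (U ∩ G.neighborSet w).ncard ≤ d) :
    G.Colorable (d + 1) := by
  have hU (U : Set V) : ∃ c : V → Fin (d + 1), ∀ a ∈ U, ∀ b ∈ U, G.Adj a b → c a ≠ c b := by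
    induction U using WellFoundedLT.induction with
    | ind U ih =>
      obtain rfl | hne := U.eq_empty_or_nonempty
      · exact ⟨fun _ => 0, fun a ha => absurd ha (notMem_empty a)⟩
      · obtain ⟨w, hw, hdeg⟩ := h U hne
        obtain ⟨c, hc⟩ := ih (U \ {w}) (sdiff_singleton_ssubset.2 hw)
        exact exists_coloring_of_sdiff_singleton hdeg hc
  obtain ⟨c, hc⟩ := hU univ
  exact ⟨SimpleGraph.Coloring.mk c fun {a b} hab => hc a (mem_univ a) b (mem_univ b) hab⟩

end Coloring

section Subgraphs

variable {V : Type*} {G : SimpleGraph V}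

theorem coe_eq_induce {H : G.Subgraph} (hH : H.IsInduced) : H.coe = G.induce H.verts := by
  ext a b
  exact ⟨fun h => h.adj_sub, fun h => hH a.2 b.2 h⟩

theorem ncard_isInduced_and (P : ∀ A : Set V, SimpleGraph A → Prop) :
    {H : G.Subgraph | H.IsInduced ∧ P H.verts H.coe}.ncard = {A | P A (G.induce A)}.ncard := by
  refine ncard_congr (fun H _ => H.verts) ?_ ?_ ?_
  · rintro H ⟨hH, hP⟩
    rwa [coe_eq_induce hH] at hP
  · rintro H H' ⟨hH, -⟩ ⟨hH', -⟩ (h : H.verts = H'.verts)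
    rw [← hH.induce_top_verts, h, hH'.induce_top_verts]
  · intro A hA
    have hind : ((⊤ : G.Subgraph).induce A).IsInduced := fun a ha b hb hab => ⟨ha, hb, hab⟩
    refine ⟨(⊤ : G.Subgraph).induce A, ⟨hind, ?_⟩, rfl⟩
    rwa [coe_eq_induce hind]

theorem solidCount_univ : solidCount G univ = (solids G).ncard := by
  simp only [solidCount, count, subset_univ, true_and, solids,
    ncard_isInduced_and fun _ => IsSolidGraph]

theorem cycleCount_univ : cycleCount G univ = (inducedCycles G).ncard := by
  simp only [cycleCount, count, subset_univ, true_and, inducedCycles,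
    ncard_isInduced_and fun _ => IsCycleGraph]

theorem cliqueCount_one_univ : cliqueCount G 1 univ = Nat.card V := by
  have hsingle : {A : Set V | A ⊆ univ ∧ G.IsClique A ∧ A.ncard = 1} = range singleton := by
    ext A
    simp only [mem_ofPred_eq, subset_univ, true_and, ncard_eq_one, mem_range]
    constructor
    · rintro ⟨-, a, rfl⟩
      exact ⟨a, rfl⟩
    · rintro ⟨a, rfl⟩
      exact ⟨SimpleGraph.isClique_singleton a, a, rfl⟩
  rw [cliqueCount, count, hsingle, ← image_univ, ncard_image_of_injective _ singleton_injective,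
    ncard_univ]

theorem cliqueCount_two_univ : cliqueCount G 2 univ = G.edgeSet.ncard := by
  rw [cliqueCount, count, Nat.cast_inj]
  refine (ncard_congr (fun (e : Sym2 V) _ => (e : Set V)) ?_ ?_ ?_).symm
  · intro e he
    induction e with
    | h a b =>
      rw [Sym2.coe_mk]
      exact ⟨subset_univ _, SimpleGraph.isClique_pair.2 fun _ => he,
        ncard_pair (G.ne_of_adj he)⟩
  · exact fun e e' _ _ h => SetLike.coe_injective h
  · rintro A ⟨-, hA, hcard⟩
    obtain ⟨a, b, hab, rfl⟩ := ncard_eq_two.1 hcard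
    exact ⟨s(a, b), SimpleGraph.isClique_pair.1 hA hab, Sym2.coe_mk⟩

theorem compCount_univ : compCount G univ = Nat.card G.ConnectedComponent := by
  rw [compCount, comps_univ, ← image_univ,
    ncard_image_of_injective _ SimpleGraph.ConnectedComponent.supp_injective, ncard_univ]

theorem excess_univ : excess G univ = (solids G).ncard - (inducedCycles G).ncard +
    G.edgeSet.ncard - Nat.card V + Nat.card G.ConnectedComponent := by
  simp only [excess, Pi.add_apply, Pi.sub_apply, solidCount_univ, cycleCount_univ,
    cliqueCount_one_univ, cliqueCount_two_univ, compCount_univ]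

end Subgraphs

end GraphSolids

theorem corollary4p3p3_general {V : Type*} [Finite V] (G : SimpleGraph V)
    (D : GraphSolids.PlaneDrawing G) :
    D.regions.Finite ∧
    ((GraphSolids.solids G).ncard : ℤ) - ((GraphSolids.inducedCycles G).ncard : ℤ)
        + (D.regions.ncard : ℤ) ≥ 1 ∧
    (((GraphSolids.solids G).ncard : ℤ) - ((GraphSolids.inducedCycles G).ncard : ℤ)
        + (D.regions.ncard : ℤ) = 1 → G.chromaticNumber ≤ 4) := by
  have hfin := D.finite_regions
  have heuler := D.ncard_edgeSet_add_card_connectedComponent_lt hfin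
  have hexcess := GraphSolids.excess_univ (G := G)
  have hnonneg := GraphSolids.excess_nonneg (G := G) Set.univ
  refine ⟨hfin, by omega, fun h => ?_⟩
  have hzero : GraphSolids.excess G = 0 := GraphSolids.excess_eq_zero (by omega)
  exact (GraphSolids.colorable_of_forall_exists_ncard_le fun U hU =>
    GraphSolids.exists_ncard_inter_neighborSet_le hzero hU).chromaticNumber_le

theorem corollary4p3p3 {V : Type*} [Finite V] (G : SimpleGraph V) (hG : G.Connected)
    (D : GraphSolids.PlaneDrawing G) :
    D.regions.Finite ∧
    ((GraphSolids.solids G).ncard : ℤ) - ((GraphSolids.inducedCycles G).ncard : ℤ)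
        + (D.regions.ncard : ℤ) ≥ 1 ∧
    (((GraphSolids.solids G).ncard : ℤ) - ((GraphSolids.inducedCycles G).ncard : ℤ)
        + (D.regions.ncard : ℤ) = 1 → G.chromaticNumber ≤ 4) :=
  corollary4p3p3_general G D
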